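/- For $\tau$ in the upper half plane $\mathbb H$ let $\wp,\zeta,\sigma$ be the Weierstrass functions with periods $(2\omega_1,2\omega_3)=(1,\tau)$, $\wp'=\partial\wp/\partial z$, $\omega_2=-\omega_1-\omega_3$, $e_i=\wp(\omega_i)$, $\eta_k=\zeta(\omega_k)$ $(k=1,3)$. The elliptic sixth Painlevé equation with parameters $(\kappa_0,\kappa_1,\kappa_t,\kappa_\infty)$ is $$\frac{d^2\delta}{d\tau^2}=-\frac1{4\pi^2}\Big\{\frac{\kappa_\infty^2}2\wp'(\delta)+\frac{\kappa_0^2}2\wp'\big(\delta+\tfrac12\big)+\frac{\kappa_1^2}2\wp'\big(\delta+\tfrac{\tau+1}2\big)+\frac{\kappa_t^2}2\wp'\big(\delta+\tfrac\tau2\big)\Big\}.$$ Let $C_1,C_3\in\mathbb C$ be constants, $\omega=C_1\omega_3-C_3\omega_1$, $\eta=C_1\eta_3-C_3\eta_1$, and $$b_1(\tau)=\wp(\omega)+\frac{\wp'(\omega)}{2(\zeta(\omega)-\eta)}.$$ Let $D\subset\mathbb H$ be the set of $\tau$ with $\omega\notin\mathbb Z+\mathbb Z\tau$, $\zeta(\omega)\ne\eta$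 and $b_1\ne e_1,e_2,e_3$. Then: (1) If $V\subset D$ is open and $\delta_1:V\to\mathbb C$ is a continuous function with $\delta_1(\tau)\notin\mathbb Z+\mathbb Z\tau$ and $\wp(\delta_1(\tau))=b_1(\tau)$ for all $\tau\in V$, then $\delta_1$ is holomorphic, $2\delta_1(\tau)\notin\mathbb Z+\mathbb Z\tau$, and $\delta_1$ solves the elliptic sixth Painlevé equation on $V$ for $(\kappa_0,\kappa_1,\kappa_t,\kappa_\infty)=(\frac12,\frac12,\frac12,\frac12)$. (2) Every $\tau_0\in D$ has an open neighbourhood $V\subset D$ on which such a $\delta_1$ exists. If $C_1,C_3$ are not both integers, $D$ is dense in $\mathbb H$. (3) For every $\tau\in D$ put $\alpha=-\omega$ and $\kappa=\zeta(\omega)-\eta$. There is $\mu_1\neq0$ such that $Q=2\mu_1\prod_{i=1}^3(2\mu_1(e_i-b_1)+1)$ is nonzero and, for one choice of $\sqrt{-Q}$, $$\wp(\alpha)=b_1-\frac1{2\mu_1},\qquad \wp'(\alpha)=-\frac{\sqrt{-Q}}{2\mu_1^2},\qquad \kappa=\frac{\sqrt{-Q}}{2\mu_1}.$$ The Hermite–Krichever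 function $\Lambda(x)=e^{\kappa x}\,\frac{\sigma(x-\alpha)}{\sigma(x)}\,e^{\zeta(\alpha)x}$ solves $$-f''+\frac{\wp'(x)}{\wp(x)-b_1}f'-\frac{\mu_1(4b_1^3-g_2b_1-g_3)}{\wp(x)-b_1}f-pf=0,\qquad p=-(4b_1^3-g_2b_1-g_3)\mu_1^2+\Big(6b_1^2-\frac{g_2}2\Big)\mu_1,$$ at all $x\notin\mathbb Z+\mathbb Z\tau$ with $\wp(x)\ne b_1$, and its multipliers are independent of $\tau$: $\Lambda(x+2\omega_k)=e^{\pi\sqrt{-1}\,C_k}\Lambda(x)$ for $k=1,3$ and $x\notin\mathbb Z+\mathbb Z\tau$. -/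

import Mathlib

open scoped UpperHalfPlane

noncomputable section

namespace EllipticPVI

/-- The Weierstrass zeta function
`ζ(z) = 1/z + ∑_{l ≠ 0} (1/(z - l) + 1/l + z/l²)` of the lattice `L`.
Since `1 / 0 = 0`, the summand at `l = 0` is `1/z`. -/
def weierstrassZeta (L : PeriodPair) (z : ℂ) : ℂ :=
  ∑' l : L.lattice, (1 / (z - l) + 1 / (l : ℂ) + z / (l : ℂ) ^ 2)

/-- The Weierstrass sigma function
`σ(z) = z ∏_{l ≠ 0} (1 - z/l) exp (z/l + z²/(2l²))` of the lattice `L`.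
Since `z / 0 = 0`, the factor at `l = 0` is `1`. -/
def weierstrassSigma (L : PeriodPair) (z : ℂ) : ℂ :=
  z * ∏' l : L.lattice, ((1 - z / l) * Complex.exp (z / l + z ^ 2 / (2 * (l : ℂ) ^ 2)))

/-- The pair of periods `(2ω₁, 2ω₃) = (1, τ)`. -/
def periods (τ : ℍ) : PeriodPair where
  ω₁ := 1
  ω₂ := τ
  indep := by
    rw [LinearIndependent.pair_iff]
    intro s t h
    have him := congrArg Complex.im h
    have hre := congrArg Complex.re h
    simp only [Complex.real_smul, Complex.add_im, Complex.mul_im, Complex.ofReal_re,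
      Complex.ofReal_im, Complex.zero_im, Complex.add_re,
      Complex.mul_re, Complex.zero_re, zero_mul, mul_one, add_zero, sub_zero,
      zero_add] at him hre
    have ht : t = 0 := (mul_eq_zero.mp him).resolve_right τ.im_pos.ne'
    subst ht
    exact ⟨by simpa using hre, rfl⟩

/-- The half periods `ω₁ = 1/2`, `ω₂ = -ω₁ - ω₃`, `ω₃ = τ/2` (indexed by `0, 1, 2`). -/
def halfPeriod (τ : ℍ) : Fin 3 → ℂ := ![1 / 2, -(1 / 2) - τ / 2, τ / 2]

/-- The Weierstrass `℘`-function with periods `1, τ`. -/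
def wp (τ : ℍ) (z : ℂ) : ℂ := (periods τ).weierstrassP z

/-- The derivative `℘'` of `℘` in `z`. -/
def wp' (τ : ℍ) (z : ℂ) : ℂ := (periods τ).derivWeierstrassP z

/-- `eᵢ = ℘(ωᵢ)`, for `i = 1, 2, 3` (indexed by `0, 1, 2`). -/
def e (τ : ℍ) (i : Fin 3) : ℂ := wp τ (halfPeriod τ i)

/-- `η₁ = ζ(ω₁)`. -/
def eta₁ (τ : ℍ) : ℂ := weierstrassZeta (periods τ) (1 / 2)

/-- `η₃ = ζ(ω₃)`. -/
def eta₃ (τ : ℍ) : ℂ := weierstrassZeta (periods τ) (τ / 2)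

/-- The holomorphic function `δ` solves, on the subset `V` of the upper half plane, the elliptic
form of the sixth Painlevé equation with parameters `(κ₀, κ₁, κₜ, κ_∞)`. The condition
`2 δ(τ) ∉ ℤ + ℤτ` says that none of the four values of `℘'` is taken at a pole. -/
def IsSolutionOn (κ₀ κ₁ κₜ κinf : ℂ) (V : Set ℂ) (δ : ℂ → ℂ) : Prop :=
  DifferentiableOn ℂ δ V ∧
  ∀ τ : ℍ, (τ : ℂ) ∈ V →
    2 * δ τ ∉ (periods τ).lattice ∧
    deriv (deriv δ) τ = -(1 / (4 * (Real.pi : ℂ) ^ 2)) *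
      (κinf ^ 2 / 2 * wp' τ (δ τ) + κ₀ ^ 2 / 2 * wp' τ (δ τ + 1 / 2)
        + κ₁ ^ 2 / 2 * wp' τ (δ τ + (τ + 1) / 2) + κₜ ^ 2 / 2 * wp' τ (δ τ + τ / 2))

/-- `ω = C₁ ω₃ - C₃ ω₁`. -/
def omega (C₁ C₃ : ℂ) (τ : ℍ) : ℂ := C₁ * (τ / 2) - C₃ * (1 / 2)

/-- `η = C₁ η₃ - C₃ η₁`. -/
def eta (C₁ C₃ : ℂ) (τ : ℍ) : ℂ := C₁ * eta₃ τ - C₃ * eta₁ τ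

/-- `ζ(ω) - η`. -/
def kappa (C₁ C₃ : ℂ) (τ : ℍ) : ℂ :=
  weierstrassZeta (periods τ) (omega C₁ C₃ τ) - eta C₁ C₃ τ

/-- `b₁ = ℘(ω) + ℘'(ω) / (2 (ζ(ω) - η))`. -/
def b₁ (C₁ C₃ : ℂ) (τ : ℍ) : ℂ :=
  wp τ (omega C₁ C₃ τ) + wp' τ (omega C₁ C₃ τ) / (2 * kappa C₁ C₃ τ)

/-- The set of `τ` at which the formula for `b₁` makes sense and `b₁ ≠ e₁, e₂, e₃`. -/
def domain (C₁ C₃ : ℂ) : Set ℍ :=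
  {τ | omega C₁ C₃ τ ∉ (periods τ).lattice ∧ kappa C₁ C₃ τ ≠ 0 ∧ ∀ i, b₁ C₁ C₃ τ ≠ e τ i}

/-- On the set `V`, which is contained in `domain C₁ C₃`, the function `δ` satisfies
`℘(δ(τ)) = b₁(τ)`. -/
def IsBranchOn (C₁ C₃ : ℂ) (V : Set ℂ) (δ : ℂ → ℂ) : Prop :=
  V ⊆ (fun τ : ℍ => (τ : ℂ)) '' domain C₁ C₃ ∧
  ∀ τ : ℍ, (τ : ℂ) ∈ V → δ τ ∉ (periods τ).lattice ∧ wp τ (δ τ) = b₁ C₁ C₃ τ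

/-- `Φ₀(x, α) = σ(x - α) / σ(x) · exp (ζ(α) x)`. -/
def Phi₀ (τ : ℍ) (x α : ℂ) : ℂ :=
  weierstrassSigma (periods τ) (x - α) / weierstrassSigma (periods τ) x *
    Complex.exp (weierstrassZeta (periods τ) α * x)

/-- `p = -(4b³ - g₂ b - g₃) μ² + (6b² - g₂/2) μ`. -/
def accessory (τ : ℍ) (b μ : ℂ) : ℂ :=
  -(4 * b ^ 3 - (periods τ).g₂ * b - (periods τ).g₃) * μ ^ 2
    + (6 * b ^ 2 - (periods τ).g₂ / 2) * μ

/-- `f` solves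
`-f'' + ℘'/(℘ - b) f' - μ (4b³ - g₂ b - g₃)/(℘ - b) f - p f = 0`,
with `p` given by `accessory`, at all points other than the singular ones. -/
def SolvesLinear (τ : ℍ) (b μ : ℂ) (f : ℂ → ℂ) : Prop :=
  ∀ x : ℂ, x ∉ (periods τ).lattice → wp τ x ≠ b →
    -deriv (deriv f) x + wp' τ x / (wp τ x - b) * deriv f x
      - μ * (4 * b ^ 3 - (periods τ).g₂ * b - (periods τ).g₃) / (wp τ x - b) * f x
      - accessory τ b μ * f x = 0

/-- `Q = 2μ ∏ᵢ (2μ (eᵢ - b) + 1)`. -/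
def Qval (τ : ℍ) (b μ : ℂ) : ℂ := 2 * μ * ∏ i, (2 * μ * (e τ i - b) + 1)

/-- The Hermite–Krichever data of the linear equation with parameters `(b, μ)`:
the pair `(α, κ)` is given by `℘(α) = b - 1/(2μ)`, `℘'(α) = -√(-Q)/(2μ²)`, `κ = √(-Q)/(2μ)` for
one choice of the square root `s = √(-Q)`, and `exp (κ x) Φ₀(x, α)` solves the equation. -/
def IsHermiteKrichever (τ : ℍ) (b μ α κ : ℂ) : Prop :=
  μ ≠ 0 ∧ Qval τ b μ ≠ 0 ∧ α ∉ (periods τ).lattice ∧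
  (∃ s : ℂ, s ^ 2 = -Qval τ b μ ∧ wp τ α = b - 1 / (2 * μ) ∧
    wp' τ α = -s / (2 * μ ^ 2) ∧ κ = s / (2 * μ)) ∧
  SolvesLinear τ b μ (fun x => Complex.exp (κ * x) * Phi₀ τ x α)

/-- `f` is multiplied by `exp (π i C₁)` under `x ↦ x + 2ω₁` and by `exp (π i C₃)` under
`x ↦ x + 2ω₃`. -/
def HasMultipliers (τ : ℍ) (C₁ C₃ : ℂ) (f : ℂ → ℂ) : Prop :=
  ∀ x : ℂ, x ∉ (periods τ).lattice →
    f (x + 1) = Complex.exp (Real.pi * Complex.I * C₁) * f x ∧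
    f (x + τ) = Complex.exp (Real.pi * Complex.I * C₃) * f x

end EllipticPVI

end

/-! The engine is the heat equation for the theta function. With `f = ζ(z) - 2η₁z`, the logarithmic
derivative of theta, it reads `4πi ∂f/∂τ = f'' + 2 f f'`. It is proved by Liouville's theorem: the
difference of the two sides is elliptic (Legendre's relation enters here), is `o(1/z)` at the
lattice points, and vanishes at `1/2`. Differentiating in `z` gives the `τ`-derivatives of `℘` and
`℘'`.

Along a curve `δ(τ)` the term from `δ'` merges with `ζ(δ) - 2η₁δ` into `k = ζ(δ) - 2η₁δ + 2πi δ'`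
(`curveKappa`), and `4πi d℘(δ)/dτ = 4℘² - 8η₁℘ - 2g₂/3 + 2k℘'`. For the linear curve `ω`, Legendre's
relation identifies `k` with `ζ(ω) - η`. This gives closed formulas for the derivatives of `b₁` and
of `u = b₁ - ℘(ω)` (`hasDerivAt_b₁Fun`, `hasDerivAt_gapFun`).

Now let `℘(δ) = b₁`, `w = ℘'(δ)`, `D = ℘''(δ)`. Comparing the two expressions for the derivative of
`b₁` yields `k = w/(2u) - D/(2w)`, an explicit formula for `δ'`. In the second derivative all terms
with `u` and `η₁` cancel, and what remains is `D(12b₁w² - D²)/(2w³) - 2w = 2℘'(2δ)`, which is a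
quarter of the sum of `℘'` at `δ` and its three translates by half periods. This is the Painlevé
equation with all parameters `1/2`.

Local existence, and holomorphy of a continuous branch, come from the implicit function theorem,
since `b₁ ≠ eᵢ` means `℘'(δ) ≠ 0`. Density holds because `ζ(ω) - η = 0` or `b₁ = eᵢ` on an open set
contradicts the derivative formulas. The linear equation is a rational identity once the logarithmic
derivative of the Hermite–Krichever function is known from the addition theorem of zeta; its
multipliers come from quasi-periodicity of sigma and Legendre's relation. -/

noncomputable section

namespace EllipticPVI

open Complex Filter Topology Metric Set PeriodPair

/-! ### Series of holomorphic functions of several variables -/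

section Series

variable {ι E G : Type} [NormedAddCommGroup E] [NormedSpace ℂ E]
  [NormedAddCommGroup G] [NormedSpace ℂ G]

/-- Cauchy estimate, locally uniform for a family of holomorphic functions. -/
lemma exists_ball_norm_fderiv_le {f : ι → E → G} {u : ι → ℝ} {U : Set E} (hU : IsOpen U)
    (hf : ∀ i, DifferentiableOn ℂ (f i) U) (hb : ∀ i, ∀ x ∈ U, ‖f i x‖ ≤ u i) {x : E}
    (hx : x ∈ U) :
    ∃ r > 0, ball x r ⊆ U ∧ ∀ i, ∀ y ∈ ball x r, ‖fderiv ℂ (f i) y‖ ≤ 2 * u i / r := by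
  obtain ⟨ε, hε, hεU⟩ := Metric.isOpen_iff.1 hU x hx
  refine ⟨ε / 2, by positivity, (ball_subset_ball (by linarith)).trans hεU, fun i y hy => ?_⟩
  have hsub : ball y (ε / 2) ⊆ U := by
    refine (ball_subset_ball' ?_).trans hεU
    rw [mem_ball] at hy
    linarith
  refine Complex.norm_fderiv_le_div_of_mapsTo_ball ((hf i).mono hsub) ?_ (by positivity)
  intro w hw
  rw [mem_closedBall, dist_eq_norm]
  have h1 := hb i w (hsub hw)
  have h2 := hb i y (hsub (mem_ball_self (by positivity)))
  exact (norm_sub_le _ _).trans (by linarith)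

lemma hasFDerivAt_tsum_of_norm_le [CompleteSpace G] {f : ι → E → G} {u : ι → ℝ} {U : Set E}
    (hU : IsOpen U) (hu : Summable u) (hf : ∀ i, DifferentiableOn ℂ (f i) U)
    (hb : ∀ i, ∀ x ∈ U, ‖f i x‖ ≤ u i) {x : E} (hx : x ∈ U) :
    HasFDerivAt (fun y => ∑' i, f i y) (∑' i, fderiv ℂ (f i) x) x := by
  obtain ⟨r, hr, hrU, hr'⟩ := exists_ball_norm_fderiv_le hU hf hb hx
  let _ : NormedSpace ℝ E := NormedSpace.restrictScalars ℝ ℂ _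
  exact hasFDerivAt_tsum_of_isPreconnected (u := fun i => 2 * u i / r)
    ((hu.mul_left 2).div_const r) isOpen_ball (convex_ball x r).isPreconnected
    (fun i y hy => ((hf i).differentiableAt (hU.mem_nhds (hrU hy))).hasFDerivAt) hr'
    (mem_ball_self hr) (.of_norm_bounded hu fun i => hb i x hx) (mem_ball_self hr)

/-- A locally normally convergent series of holomorphic functions of several variables is
smooth. -/
theorem contDiffOn_tsum_of_norm_le [CompleteSpace G] (n : ℕ) {f : ι → E → G} {u : ι → ℝ}
    {U : Set E} (hU : IsOpen U) (hu : Summable u) (hf : ∀ i, ContDiffOn ℂ (⊤ : ℕ∞) (f i) U)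
    (hb : ∀ i, ∀ x ∈ U, ‖f i x‖ ≤ u i) :
    ContDiffOn ℂ n (fun y => ∑' i, f i y) U := by
  -- The series of derivatives takes values in `E →L[ℂ] G` and is dominated, with another bound,
  -- only on a smaller ball; hence all three vary.
  induction n generalizing G u U with
  | zero =>
    rw [Nat.cast_zero, contDiffOn_zero]
    exact fun x hx => (hasFDerivAt_tsum_of_norm_le hU hu
      (fun i => (hf i).differentiableOn (by simp)) hb hx).continuousAt.continuousWithinAt
  | succ n ih =>
    have hd : ∀ i, DifferentiableOn ℂ (f i) U := fun i => (hf i).differentiableOn (by simp)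
    rw [Nat.cast_succ, contDiffOn_succ_iff_fderiv_of_isOpen hU]
    refine ⟨fun x hx => (hasFDerivAt_tsum_of_norm_le hU hu hd hb hx).differentiableAt.differentiableWithinAt,
      by simp, fun x hx => ?_⟩
    obtain ⟨r, hr, hrU, hr'⟩ := exists_ball_norm_fderiv_le hU hd hb hx
    have key : ContDiffOn ℂ n (fun y => ∑' i, fderiv ℂ (f i) y) (ball x r) :=
      ih isOpen_ball ((hu.mul_left 2).div_const r)
        (fun i => ((hf i).fderiv_of_isOpen hU (by simp)).mono hrU) hr'
    have heq : ∀ y ∈ ball x r, fderiv ℂ (fun y => ∑' i, f i y) y = ∑' i, fderiv ℂ (f i) y :=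
      fun y hy => (hasFDerivAt_tsum_of_norm_le hU hu hd hb (hrU hy)).fderiv
    exact ((key.congr heq).contDiffAt (isOpen_ball.mem_nhds (mem_ball_self hr))).contDiffWithinAt

end Series

/-! ### The Weierstrass zeta function -/

section Zeta

variable (L : PeriodPair)

/-- The regular part `ζ(z) - 1/z` of the zeta function at the origin. -/
def zetaReg (z : ℂ) : ℂ :=
  ∑' l : L.lattice, if (l : ℂ) = 0 then 0 else 1 / (z - l) + 1 / (l : ℂ) + z / (l : ℂ) ^ 2

/-- The three fractions combine to `z² / (l² (z - l))`, so the series converges like `∑ |l|⁻³`. -/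
lemma norm_zeta_summand_le {r : ℝ} {z l : ℂ} (hz : ‖z‖ < r) (h : 2 * r ≤ ‖l‖) :
    ‖1 / (z - l) + 1 / l + z / l ^ 2‖ ≤ 2 * r ^ 2 * ‖l‖ ^ (-3 : ℝ) := by
  have hr : 0 < r := (norm_nonneg z).trans_lt hz
  have hl : 0 < ‖l‖ := by linarith
  have hl0 : l ≠ 0 := norm_pos_iff.1 hl
  have hzl : ‖l‖ / 2 ≤ ‖z - l‖ := by
    rw [norm_sub_rev]
    exact .trans (by linarith) (norm_sub_norm_le l z)
  have hzl0 : z - l ≠ 0 := norm_pos_iff.1 (by linarith)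
  have : 1 / (z - l) + 1 / l + z / l ^ 2 = z ^ 2 / (l ^ 2 * (z - l)) := by
    field_simp
    ring
  rw [this, norm_div, norm_mul, norm_pow, norm_pow, Real.rpow_neg hl.le]
  calc ‖z‖ ^ 2 / (‖l‖ ^ 2 * ‖z - l‖) ≤ r ^ 2 / (‖l‖ ^ 2 * (‖l‖ / 2)) := by gcongr
    _ = 2 * r ^ 2 * (‖l‖ ^ 3)⁻¹ := by field_simp
    _ = _ := by norm_cast

lemma hasSumLocallyUniformly_zetaReg :
    HasSumLocallyUniformly (fun (l : L.lattice) (z : ℂ) =>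
      if (l : ℂ) = 0 then 0 else 1 / (z - l) + 1 / (l : ℂ) + z / (l : ℂ) ^ 2) (zetaReg L) := by
  refine L.hasSumLocallyUniformly_aux (u := (2 * · ^ 2 * ‖·‖ ^ (-3 : ℝ))) _
    (fun _ _ => (ZLattice.summable_norm_rpow _ _ (by simp; norm_num)).mul_left _) fun r hr =>
    Filter.eventually_atTop.mpr ⟨2 * r, ?_⟩
  rintro _ h s hs l rfl
  split_ifs
  · simpa using! show 0 ≤ 2 * r ^ 2 * (‖(l : ℂ)‖ ^ 3)⁻¹ by positivity
  · exact norm_zeta_summand_le hs h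

lemma hasSum_zetaReg (z : ℂ) :
    HasSum (fun l : L.lattice =>
      if (l : ℂ) = 0 then 0 else 1 / (z - l) + 1 / (l : ℂ) + z / (l : ℂ) ^ 2) (zetaReg L z) :=
  (hasSumLocallyUniformly_zetaReg L).hasSum

lemma weierstrassZeta_eq (z : ℂ) : weierstrassZeta L z = 1 / z + zetaReg L z := by
  have h := (hasSum_zetaReg L z).add (hasSum_ite_eq (0 : L.lattice) (1 / z))
  rw [weierstrassZeta, add_comm, ← h.tsum_eq]
  congr with l
  by_cases hl : l = 0
  · simp [hl]
  · simp [hl]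

lemma zetaReg_zero : zetaReg L 0 = 0 := by
  have h : ∀ l : L.lattice,
      (if (l : ℂ) = 0 then 0 else 1 / (0 - (l : ℂ)) + 1 / (l : ℂ) + 0 / (l : ℂ) ^ 2) = 0 := by
    intro l
    simp
  simp only [zetaReg, h, tsum_zero]

lemma zetaReg_neg (z : ℂ) : zetaReg L (-z) = -zetaReg L z := by
  rw [zetaReg, ← (Equiv.neg L.lattice).tsum_eq, zetaReg, ← tsum_neg]
  congr with l
  by_cases h : l = 0
  · simp [h]
  · have h1 : -z + (l : ℂ) = -(z - l) := by ring
    simp only [Equiv.neg_apply, NegMemClass.coe_neg, neg_eq_zero, ZeroMemClass.coe_eq_zero, h,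
      if_false, sub_neg_eq_add, h1, one_div, inv_neg, neg_sq, neg_div]
    ring

lemma weierstrassZeta_neg (z : ℂ) : weierstrassZeta L (-z) = -weierstrassZeta L z := by
  rw [weierstrassZeta_eq, weierstrassZeta_eq, zetaReg_neg, div_neg]
  ring

lemma hasDerivAt_zetaReg {z : ℂ} (hz : z ∈ ((L.lattice : Set ℂ) \ {0})ᶜ) :
    HasDerivAt (zetaReg L) (-L.weierstrassPExcept 0 z) z := by
  have hne : ∀ l : L.lattice, (l : ℂ) ≠ 0 → ∀ w ∈ ((L.lattice : Set ℂ) \ {0})ᶜ, w - l ≠ 0 := by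
    intro l hl w hw h
    obtain rfl := sub_eq_zero.mp h
    exact hw ⟨l.2, hl⟩
  have hd : ∀ l : L.lattice, ∀ w ∈ ((L.lattice : Set ℂ) \ {0})ᶜ, HasDerivAt (fun z : ℂ =>
      if (l : ℂ) = 0 then 0 else 1 / (z - l) + 1 / (l : ℂ) + z / (l : ℂ) ^ 2)
      (-(if (l : ℂ) = 0 then 0 else (1 / (w - l) ^ 2 - 1 / (l : ℂ) ^ 2))) w := by
    intro l w hw
    by_cases hl : (l : ℂ) = 0
    · simpa [hl] using hasDerivAt_const w (0 : ℂ)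
    · simp only [hl, if_false]
      have h := ((((hasDerivAt_id w).sub_const (l : ℂ)).fun_inv (hne l hl w hw)).add_const
        (1 / (l : ℂ))).fun_add ((hasDerivAt_id w).div_const ((l : ℂ) ^ 2))
      simp only [id, ← one_div] at h
      convert! h using 1
      ring
  have hdiff : DifferentiableOn ℂ (zetaReg L) ((L.lattice : Set ℂ) \ {0})ᶜ := by
    refine (hasSumLocallyUniformly_zetaReg L).tendstoLocallyUniformlyOn.differentiableOn
      (.of_forall fun s => .fun_sum fun i _ w hw => ?_) L.isOpen_compl_lattice_sdiff
    exact (hd i w hw).differentiableAt.differentiableWithinAt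
  have heq : Set.EqOn (deriv (zetaReg L)) (fun z => -L.weierstrassPExcept 0 z)
      ((L.lattice : Set ℂ) \ {0})ᶜ := by
    refine ((hasSumLocallyUniformly_zetaReg L).tendstoLocallyUniformlyOn.deriv
      (.of_forall fun s => .fun_sum fun i _ w hw =>
        (hd i w hw).differentiableAt.differentiableWithinAt) L.isOpen_compl_lattice_sdiff).unique ?_
    have h0 := (L.hasSumLocallyUniformly_weierstrassPExcept 0).tendstoLocallyUniformlyOn (s := ((L.lattice : Set ℂ) \ {0})ᶜ)
    have h1 := h0.neg
    refine h1.congr ?_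
    intro s w hw
    simp only [Function.comp_apply, Pi.neg_apply]
    rw [(HasDerivAt.fun_sum fun i _ => hd i w hw).deriv, Finset.sum_neg_distrib]
  have h := (hdiff.differentiableAt (L.isOpen_compl_lattice_sdiff.mem_nhds hz)).hasDerivAt
  rwa [heq hz] at h

lemma weierstrassPExcept_zero_eq (z : ℂ) :
    L.weierstrassPExcept 0 z = L.weierstrassP z - 1 / z ^ 2 := by
  have := L.weierstrassPExcept_def 0 z
  simpa [sub_eq_add_neg] using this

lemma ne_zero_of_notMem {z : ℂ} (hz : z ∉ L.lattice) : z ≠ 0 := fun h => hz (h ▸ zero_mem _)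

lemma hasDerivAt_weierstrassZeta {z : ℂ} (hz : z ∉ L.lattice) :
    HasDerivAt (weierstrassZeta L) (-L.weierstrassP z) z := by
  have h0 := ne_zero_of_notMem L hz
  have h1 := hasDerivAt_zetaReg L (z := z) (fun h => hz h.1)
  have h2 := (hasDerivAt_inv h0).add h1
  rw [show weierstrassZeta L = (fun z => z⁻¹) + zetaReg L from
    funext fun w => by simp [weierstrassZeta_eq]]
  convert! h2 using 1
  rw [weierstrassPExcept_zero_eq]
  ring

lemma isPreconnected_compl_lattice : IsPreconnected ((L.lattice : Set ℂ)ᶜ) := by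
  have hc : (L.lattice : Set ℂ).Countable := Set.countable_coe_iff.1
    (inferInstanceAs (Countable L.lattice))
  exact (hc.isPathConnected_compl_of_one_lt_rank (by simp)).isConnected.isPreconnected

lemma isOpen_compl_lattice : IsOpen ((L.lattice : Set ℂ)ᶜ) := L.isClosed_lattice.isOpen_compl

lemma eq_of_hasDerivAt_zero {f : ℂ → ℂ} (hf : ∀ z ∉ L.lattice, HasDerivAt f 0 z) {z w : ℂ}
    (hz : z ∉ L.lattice) (hw : w ∉ L.lattice) : f z = f w :=
  (isOpen_compl_lattice L).is_const_of_deriv_eq_zero (isPreconnected_compl_lattice L)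
    (fun z hz => (hf z hz).differentiableAt.differentiableWithinAt) (fun z hz => (hf z hz).deriv)
    hz hw

lemma add_mem_lattice_iff {z l : ℂ} (hl : l ∈ L.lattice) : z + l ∈ L.lattice ↔ z ∈ L.lattice :=
  Submodule.add_mem_iff_left _ hl

/-- Quasi-periodicity of the zeta function. -/
lemma weierstrassZeta_add {z l : ℂ} (hl : l ∈ L.lattice) (hl2 : l / 2 ∉ L.lattice)
    (hz : z ∉ L.lattice) :
    weierstrassZeta L (z + l) = weierstrassZeta L z + 2 * weierstrassZeta L (l / 2) := by
  have h : ∀ w ∉ L.lattice,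
      HasDerivAt (fun w => weierstrassZeta L (w + l) - weierstrassZeta L w) 0 w := by
    intro w hw
    have h1 := hasDerivAt_weierstrassZeta L (z := w + l) ((add_mem_lattice_iff L hl).not.2 hw)
    have h2 := (h1.comp_add_const w l).fun_sub (hasDerivAt_weierstrassZeta L hw)
    have := L.weierstrassP_add_coe w ⟨l, hl⟩
    simp only at this
    rwa [this, sub_self] at h2
  -- The point `-(l/2)` is moved to `l/2` by the period, so oddness determines the constant.
  have h1 := eq_of_hasDerivAt_zero L h hz (w := -(l / 2)) (by rwa [neg_mem_iff])
  rw [show -(l / 2) + l = l / 2 by ring, weierstrassZeta_neg] at h1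
  linear_combination h1

end Zeta

/-! ### The Weierstrass sigma function -/

section Sigma

variable (L : PeriodPair)

/-- The exponential cancels the Taylor polynomial of `log (1 - w)` up to order two, which leaves
`exp R` with `R = O(w³)`. -/
lemma norm_primary_factor_sub_one_le {w : ℂ} (hw : ‖w‖ ≤ 1 / 2) :
    ‖(1 - w) * exp (w + w ^ 2 / 2) - 1‖ ≤ 2 * ‖w‖ ^ 3 := by
  have hw1 : ‖-w‖ < 1 := by rw [norm_neg]; linarith
  have h := norm_log_sub_logTaylor_le 2 hw1
  have hne : 1 + -w ≠ 0 := by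
    intro h0
    have : w = 1 := by linear_combination -h0
    rw [this] at hw
    norm_num at hw
  have hT : logTaylor (2 + 1) (-w) = -w - w ^ 2 / 2 := by
    simp [logTaylor, Finset.sum_range_succ]
    ring
  rw [hT, norm_neg] at h
  set R := log (1 + -w) - (-w - w ^ 2 / 2) with hR
  have hRle : ‖R‖ ≤ ‖w‖ ^ 3 := by
    refine h.trans ?_
    have : (1 - ‖w‖)⁻¹ ≤ 2 := by
      rw [inv_le_comm₀ (by linarith) (by norm_num)]
      linarith
    have h3 : 0 ≤ ‖w‖ ^ 3 := by positivity
    norm_num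
    nlinarith
  have hexp : (1 - w) * exp (w + w ^ 2 / 2) = exp R := by
    rw [hR, show log (1 + -w) - (-w - w ^ 2 / 2) = log (1 + -w) + (w + w ^ 2 / 2) by ring,
      exp_add (log _), exp_log hne]
    ring
  have hR1 : ‖R‖ ≤ 1 := hRle.trans (pow_le_one₀ (norm_nonneg _) (by linarith))
  rw [hexp]
  exact (norm_exp_sub_one_le hR1).trans (by linarith)

/-- The factor of the sigma product belonging to the lattice point `l`. -/
def sigmaFactor (l z : ℂ) : ℂ := (1 - z / l) * exp (z / l + z ^ 2 / (2 * l ^ 2))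

/-- The quotient `σ(z) / z`. -/
def sigmaReg (z : ℂ) : ℂ := ∏' l : L.lattice, sigmaFactor l z

lemma weierstrassSigma_eq (z : ℂ) : weierstrassSigma L z = z * sigmaReg L z := rfl

lemma differentiable_sigmaFactor (l : ℂ) : Differentiable ℂ (sigmaFactor l) := by
  unfold sigmaFactor
  fun_prop

lemma summable_norm_rpow_neg_three : Summable fun l : L.lattice => ‖(l : ℂ)‖ ^ (-3 : ℝ) :=
  ZLattice.summable_norm_rpow _ _ (by simp; norm_num)

lemma eventually_norm_sigmaFactor_sub_one_le {r : ℝ} (hr : 0 < r) :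
    ∀ᶠ l : L.lattice in cofinite, ∀ z ∈ ball (0 : ℂ) r,
      ‖sigmaFactor l z - 1‖ ≤ 2 * r ^ 3 * ‖(l : ℂ)‖ ^ (-3 : ℝ) := by
  refine (isCompact_iff_finite.mp (isCompact_closedBall (0 : L.lattice) (2 * r))).subset ?_
  intro l hl
  by_contra hl'
  rw [mem_closedBall, dist_zero_right, not_le] at hl'
  refine hl fun z hz => ?_
  have hl'' : 2 * r < ‖(l : ℂ)‖ := hl'
  have hz' : ‖z‖ < r := by simpa using hz
  have hlpos : 0 < ‖(l : ℂ)‖ := by linarith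
  have hw : ‖z / (l : ℂ)‖ ≤ 1 / 2 := by
    rw [norm_div, div_le_iff₀ hlpos]
    linarith
  have h := norm_primary_factor_sub_one_le hw
  have he : sigmaFactor l z = (1 - z / l) * exp (z / l + (z / l) ^ 2 / 2) := by
    rw [sigmaFactor, div_pow, mul_comm (2 : ℂ), div_div]
  rw [he]
  refine h.trans ?_
  rw [norm_div, div_pow, Real.rpow_neg hlpos.le, mul_assoc]
  norm_cast
  rw [← div_eq_mul_inv]
  gcongr

lemma multipliableLocallyUniformlyOn_sigmaFactor {r : ℝ} (hr : 0 < r) :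
    MultipliableLocallyUniformlyOn (fun (l : L.lattice) z => sigmaFactor l z) (ball 0 r) := by
  have h := Summable.multipliableLocallyUniformlyOn_one_add (K := ball (0 : ℂ) r)
    (f := fun (l : L.lattice) z => sigmaFactor l z - 1) isOpen_ball
    ((summable_norm_rpow_neg_three L).mul_left (2 * r ^ 3))
    (eventually_norm_sigmaFactor_sub_one_le L hr)
    fun l => ((differentiable_sigmaFactor l).sub_const 1).continuous.continuousOn
  simpa using h

lemma differentiable_sigmaReg : Differentiable ℂ (sigmaReg L) := by
  intro z
  have hr : 0 < ‖z‖ + 1 := by positivity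
  have h := (multipliableLocallyUniformlyOn_sigmaFactor L hr).hasProdLocallyUniformlyOn
  have h2 := (hasProdLocallyUniformlyOn_iff_tendstoLocallyUniformlyOn.1 h).differentiableOn (.of_forall fun s =>
    DifferentiableOn.fun_finsetProd fun i _ => (differentiable_sigmaFactor i).differentiableOn)
    isOpen_ball
  exact h2.differentiableAt (isOpen_ball.mem_nhds (by simp))

lemma sigmaFactor_zero_left (z : ℂ) : sigmaFactor 0 z = 1 := by simp [sigmaFactor]

lemma sigmaFactor_ne_zero {l z : ℂ} (h : l = 0 ∨ z ≠ l) : sigmaFactor l z ≠ 0 := by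
  by_cases hl : l = 0
  · simp [hl, sigmaFactor_zero_left]
  · refine mul_ne_zero (fun h0 => ?_) (exp_ne_zero _)
    have := h.resolve_left hl
    field_simp at h0
    exact this (by linear_combination -h0)

lemma logDeriv_sigmaFactor {l z : ℂ} (h : l = 0 ∨ z ≠ l) :
    logDeriv (sigmaFactor l) z =
      if l = 0 then 0 else 1 / (z - l) + 1 / l + z / l ^ 2 := by
  by_cases hl : l = 0
  · subst hl
    have : sigmaFactor 0 = fun _ => 1 := funext sigmaFactor_zero_left
    simp [this, logDeriv]
  · have hzl := h.resolve_left hl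
    have h1 : HasDerivAt (fun z : ℂ => 1 - z / l) (-(1 / l)) z :=
      ((hasDerivAt_id z).div_const l).const_sub 1
    have h2 : HasDerivAt (fun z : ℂ => exp (z / l + z ^ 2 / (2 * l ^ 2)))
        (exp (z / l + z ^ 2 / (2 * l ^ 2)) * (1 / l + 2 * z / (2 * l ^ 2))) z := by
      have h3 := ((hasDerivAt_id z).div_const l).fun_add
        ((hasDerivAt_pow 2 z).div_const (2 * l ^ 2))
      simpa using h3.cexp
    have h3 : HasDerivAt (sigmaFactor l) _ z := h1.fun_mul h2
    have hzl' : z - l ≠ 0 := sub_ne_zero.2 hzl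
    have hlz : l - z ≠ 0 := sub_ne_zero.2 hzl.symm
    have h1z : 1 - z / l ≠ 0 := by
      rw [one_sub_div hl]
      exact div_ne_zero hlz hl
    rw [logDeriv_apply, h3.deriv, sigmaFactor, if_neg hl]
    have he := exp_ne_zero (z / l + z ^ 2 / (2 * l ^ 2))
    generalize exp (z / l + z ^ 2 / (2 * l ^ 2)) = E at he
    have : 1 - z / l = -(z - l) / l := by field_simp; ring
    rw [this]
    field_simp
    ring

lemma sigmaReg_ne_zero {z : ℂ} (hz : z ∈ ((L.lattice : Set ℂ) \ {0})ᶜ) : sigmaReg L z ≠ 0 := by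
  have hr : 0 < ‖z‖ + 1 := by positivity
  have h := tprod_one_add_ne_zero_of_summable (f := fun l : L.lattice => sigmaFactor l z - 1)
    (fun l => by
      rw [add_sub_cancel]
      refine sigmaFactor_ne_zero ?_
      by_contra! hcon
      exact hz ⟨hcon.2 ▸ l.2, hcon.2 ▸ hcon.1⟩) ?_
  · simpa [sigmaReg] using h
  · refine ((summable_norm_rpow_neg_three L).mul_left
      (2 * (‖z‖ + 1) ^ 3)).of_norm_bounded_eventually ?_
    filter_upwards [eventually_norm_sigmaFactor_sub_one_le L hr] with l hl
    simpa using hl z (by simp)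

lemma hasDerivAt_sigmaReg {z : ℂ} (hz : z ∈ ((L.lattice : Set ℂ) \ {0})ᶜ) :
    HasDerivAt (sigmaReg L) (sigmaReg L z * zetaReg L z) z := by
  have hr : 0 < ‖z‖ + 1 := by positivity
  have hl : ∀ l : L.lattice, (l : ℂ) = 0 ∨ z ≠ l := by
    intro l
    by_contra! hcon
    exact hz ⟨hcon.2 ▸ l.2, hcon.2 ▸ hcon.1⟩
  have h := logDeriv_tprod_eq_tsum (f := fun (l : L.lattice) z => sigmaFactor l z) (x := z)
    isOpen_ball (by simp) (fun l => sigmaFactor_ne_zero (hl l))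
    (fun l => (differentiable_sigmaFactor l).differentiableOn)
    (by
      simp_rw [show ∀ l : L.lattice, logDeriv (fun z => sigmaFactor l z) z = _ from
        fun l => logDeriv_sigmaFactor (hl l)]
      exact (hasSum_zetaReg L z).summable)
    (multipliableLocallyUniformlyOn_sigmaFactor L hr) (sigmaReg_ne_zero L hz)
  simp_rw [show ∀ l : L.lattice, logDeriv (fun z => sigmaFactor l z) z = _ from
        fun l => logDeriv_sigmaFactor (hl l)] at h
  have h2 : deriv (sigmaReg L) z / sigmaReg L z = zetaReg L z := h
  rw [div_eq_iff (sigmaReg_ne_zero L hz)] at h2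
  rw [mul_comm, ← h2]
  exact (differentiable_sigmaReg L z).hasDerivAt

lemma sigmaReg_zero : sigmaReg L 0 = 1 := by
  simp [sigmaReg, sigmaFactor]

lemma sigmaReg_neg (z : ℂ) : sigmaReg L (-z) = sigmaReg L z := by
  rw [sigmaReg, ← (Equiv.neg L.lattice).tprod_eq, sigmaReg]
  congr with l
  simp [sigmaFactor, neg_div_neg_eq]

lemma sigmaReg_eq_zero {z : ℂ} (hz : z ∈ L.lattice) (h0 : z ≠ 0) : sigmaReg L z = 0 :=
  tprod_of_exists_eq_zero ⟨⟨z, hz⟩, by simp [sigmaFactor, div_self h0]⟩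

lemma weierstrassSigma_neg (z : ℂ) : weierstrassSigma L (-z) = -weierstrassSigma L z := by
  rw [weierstrassSigma_eq, weierstrassSigma_eq, sigmaReg_neg, neg_mul]

lemma differentiable_weierstrassSigma : Differentiable ℂ (weierstrassSigma L) :=
  differentiable_id.mul (differentiable_sigmaReg L)

lemma weierstrassSigma_eq_zero {z : ℂ} (hz : z ∈ L.lattice) : weierstrassSigma L z = 0 := by
  by_cases h0 : z = 0
  · simp [weierstrassSigma_eq, h0]
  · rw [weierstrassSigma_eq, sigmaReg_eq_zero L hz h0, mul_zero]

lemma weierstrassSigma_ne_zero {z : ℂ} (hz : z ∉ L.lattice) : weierstrassSigma L z ≠ 0 :=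
  mul_ne_zero (ne_zero_of_notMem L hz) (sigmaReg_ne_zero L fun h => hz h.1)

lemma hasDerivAt_weierstrassSigma {z : ℂ} (hz : z ∉ L.lattice) :
    HasDerivAt (weierstrassSigma L) (weierstrassSigma L z * weierstrassZeta L z) z := by
  have h := (hasDerivAt_id z).mul (hasDerivAt_sigmaReg L (z := z) fun h => hz h.1)
  refine h.congr_deriv ?_
  have := ne_zero_of_notMem L hz
  rw [weierstrassSigma_eq, weierstrassZeta_eq, id]
  field_simp

/-- Quasi-periodicity of the sigma function. -/
lemma weierstrassSigma_add {l : ℂ} (hl : l ∈ L.lattice) (hl2 : l / 2 ∉ L.lattice) (z : ℂ) :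
    weierstrassSigma L (z + l) =
      -exp (2 * weierstrassZeta L (l / 2) * (z + l / 2)) * weierstrassSigma L z := by
  by_cases hz : z ∈ L.lattice
  · rw [weierstrassSigma_eq_zero L hz, weierstrassSigma_eq_zero L (add_mem hz hl), mul_zero]
  set η := weierstrassZeta L (l / 2)
  -- Quasi-periodicity of zeta makes the logarithmic derivative of this quotient zero. Its value at
  -- `-(l/2)`, where oddness of sigma applies, is `-1`.
  have h : ∀ w ∉ L.lattice, HasDerivAt (fun w => weierstrassSigma L (w + l) /
      weierstrassSigma L w * exp (-(2 * η * (w + l / 2)))) 0 w := by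
    intro w hw
    have h1 := (hasDerivAt_weierstrassSigma L (z := w + l)
      ((add_mem_lattice_iff L hl).not.2 hw)).comp_add_const w l
    have h2 := h1.fun_div (hasDerivAt_weierstrassSigma L hw) (weierstrassSigma_ne_zero L hw)
    have h3 : HasDerivAt (fun w => exp (-(2 * η * (w + l / 2))))
        (exp (-(2 * η * (w + l / 2))) * (-(2 * η * 1))) w :=
      ((((hasDerivAt_id w).add_const (l / 2)).const_mul (2 * η)).fun_neg).cexp
    refine (h2.fun_mul h3).congr_deriv ?_
    rw [weierstrassZeta_add L hl hl2 hw]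
    have := weierstrassSigma_ne_zero L hw
    field_simp
    ring
  have hl2' : -(l / 2) ∉ L.lattice := by rwa [neg_mem_iff]
  have h1 := eq_of_hasDerivAt_zero L h hz hl2'
  have hs := weierstrassSigma_ne_zero L hl2
  rw [show -(l / 2) + l = l / 2 by ring, weierstrassSigma_neg, show -(l / 2) + l / 2 = 0 by ring,
    mul_zero, neg_zero, exp_zero, mul_one, div_neg, div_self hs, exp_neg] at h1
  have hs' := weierstrassSigma_ne_zero L hz
  have he := exp_ne_zero (2 * η * (z + l / 2))
  rw [div_mul_eq_mul_div, div_eq_iff hs', mul_inv_eq_iff_eq_mul₀ he] at h1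
  linear_combination h1

end Sigma

/-! ### Liouville's theorem for elliptic functions -/

section Liouville

variable (L : PeriodPair)

/-- An elliptic function whose singularity at the lattice points is removable is constant. -/
theorem elliptic_eq_of_tendsto {f : ℂ → ℂ} {c : ℂ}
    (hf : ∀ z ∉ L.lattice, DifferentiableAt ℂ f z)
    (hper : ∀ l ∈ L.lattice, ∀ z ∉ L.lattice, f (z + l) = f z)
    (hc : Tendsto f (𝓝[≠] 0) (𝓝 c)) {z : ℂ} (hz : z ∉ L.lattice) : f z = c := by
  classical
  set g : ℂ → ℂ := fun z => if z ∈ L.lattice then c else f z with hg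
  have hgper : ∀ z, ∀ l ∈ L.lattice, g (z + l) = g z := by
    intro z l hl
    simp only [hg, add_mem_lattice_iff L hl]
    split_ifs with h
    · rfl
    · exact hper l hl z h
  have hgout : ∀ z ∉ L.lattice, DifferentiableAt ℂ g z := by
    intro z hz
    refine (hf z hz).congr_of_eventuallyEq ?_
    filter_upwards [(isOpen_compl_lattice L).mem_nhds hz] with w hw
    exact if_neg hw
  have hnear : ∀ᶠ w in 𝓝[≠] (0 : ℂ), w ∉ L.lattice := by
    rw [eventually_nhdsWithin_iff]
    filter_upwards [L.compl_lattice_sdiff_singleton_mem_nhds 0] with w hw hw0 hwL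
    exact hw ⟨hwL, hw0⟩
  have hg0 : DifferentiableAt ℂ g 0 := by
    refine (analyticAt_of_differentiable_on_punctured_nhds_of_continuousAt ?_ ?_).differentiableAt
    · filter_upwards [hnear] with w hw using hgout w hw
    · rw [continuousAt_iff_punctured_nhds]
      have h0 : g 0 = c := if_pos (zero_mem _)
      rw [h0]
      refine hc.congr' ?_
      filter_upwards [hnear] with w hw
      exact (if_neg hw).symm
  have hgd : Differentiable ℂ g := by
    intro z
    by_cases hz : z ∈ L.lattice
    · have h1 : g = fun w => g (w + -z) := funext fun w => (hgper w _ (neg_mem hz)).symm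
      rw [h1]
      have : DifferentiableAt ℂ g (z + -z) := by simpa using hg0
      exact differentiableAt_comp_add_const.2 this
    · exact hgout z hz
  have hb := (IsZLattice.isCompact_range_of_periodic L.lattice g hgd.continuous hgper).isBounded
  have h := hgd.apply_eq_apply_of_bounded hb z 0
  simpa [hg, hz] using h

/-- An elliptic function which is `o(1/z)` at the lattice points is constant. -/
theorem elliptic_eq_of_mul_tendsto_zero {f : ℂ → ℂ}
    (hf : ∀ z ∉ L.lattice, DifferentiableAt ℂ f z)
    (hper : ∀ l ∈ L.lattice, ∀ z ∉ L.lattice, f (z + l) = f z)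
    (h0 : Tendsto (fun z => z * f z) (𝓝[≠] 0) (𝓝 0)) {z w : ℂ} (hz : z ∉ L.lattice)
    (hw : w ∉ L.lattice) : f z = f w := by
  have hnear : ∀ᶠ w in 𝓝[≠] (0 : ℂ), w ∉ L.lattice := by
    rw [eventually_nhdsWithin_iff]
    filter_upwards [L.compl_lattice_sdiff_singleton_mem_nhds 0] with w hw hw0 hwL
    exact hw ⟨hwL, hw0⟩
  -- The value `f 0` has no meaning here; a constant does not affect `o(1/z)`, and the removable
  -- singularity theorem takes this form.
  have ho : (fun z => f z - f 0) =o[𝓝[≠] 0] fun z => (z - 0)⁻¹ := by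
    rw [Asymptotics.isLittleO_iff_tendsto']
    · have h1 : Tendsto (fun z : ℂ => z * f z - z * f 0) (𝓝[≠] 0) (𝓝 (0 - 0 * f 0)) :=
        h0.sub ((tendsto_id.mono_left nhdsWithin_le_nhds).mul_const _)
      simp only [zero_mul, sub_zero] at h1
      refine h1.congr fun z => ?_
      rw [sub_zero, div_inv_eq_mul]
      ring
    · filter_upwards [self_mem_nhdsWithin] with z hz h
      exact absurd h (by simpa using hz)
  have hlim := tendsto_limUnder_of_differentiable_on_punctured_nhds_of_isLittleO
    (hnear.mono hf) ho
  rw [elliptic_eq_of_tendsto L hf hper hlim hz, elliptic_eq_of_tendsto L hf hper hlim hw]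

lemma periodic_of_generators {f : ℂ → ℂ}
    (h1 : ∀ z ∉ L.lattice, f (z + L.ω₁) = f z) (h2 : ∀ z ∉ L.lattice, f (z + L.ω₂) = f z) :
    ∀ l ∈ L.lattice, ∀ z ∉ L.lattice, f (z + l) = f z := by
  have key : ∀ l ∈ L.lattice, (∀ z ∉ L.lattice, f (z + l) = f z) →
      ∀ n : ℤ, ∀ z ∉ L.lattice, f (z + n * l) = f z := by
    intro l hl h n
    induction n using Int.induction_on with
    | zero => simp
    | succ n ih =>
      intro z hz
      rw [show z + ((n + 1 : ℤ) : ℂ) * l = z + l + (n : ℤ) * l by push_cast; ring,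
        ih _ ((add_mem_lattice_iff L hl).not.2 hz), h z hz]
    | pred n ih =>
      intro z hz
      have hz' : z + -l ∉ L.lattice := (add_mem_lattice_iff L (neg_mem hl)).not.2 hz
      rw [show z + ((-n - 1 : ℤ) : ℂ) * l = z + -l + (-n : ℤ) * l by push_cast; ring, ih _ hz',
        ← h _ hz', neg_add_cancel_right]
  intro l hl z hz
  obtain ⟨m, n, rfl⟩ := PeriodPair.mem_lattice.1 hl
  have hm : (m : ℂ) * L.ω₁ ∈ L.lattice := by
    simpa using L.lattice.smul_mem m L.ω₁_mem_lattice
  rw [← add_assoc, key _ L.ω₂_mem_lattice h2 n _ ((add_mem_lattice_iff L hm).not.2 hz),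
    key _ L.ω₁_mem_lattice h1 m z hz]

end Liouville

/-! ### The sigma product formula, the addition theorem of zeta and half-period translations -/

section SigmaFormula

variable (L : PeriodPair)

lemma hasDerivAt_weierstrassP {z : ℂ} (hz : z ∉ L.lattice) :
    HasDerivAt L.weierstrassP (L.derivWeierstrassP z) z := by
  have h := (L.differentiableOn_weierstrassP.differentiableAt
    ((isOpen_compl_lattice L).mem_nhds hz)).hasDerivAt
  rwa [L.deriv_weierstrassP] at h

lemma weierstrassP_add {z l : ℂ} (hl : l ∈ L.lattice) :
    L.weierstrassP (z + l) = L.weierstrassP z := L.weierstrassP_add_coe z ⟨l, hl⟩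

lemma derivWeierstrassP_add {z l : ℂ} (hl : l ∈ L.lattice) :
    L.derivWeierstrassP (z + l) = L.derivWeierstrassP z := L.derivWeierstrassP_add_coe z ⟨l, hl⟩

lemma eventually_notMem_lattice : ∀ᶠ w in 𝓝[≠] (0 : ℂ), w ∉ L.lattice := by
  rw [eventually_nhdsWithin_iff]
  filter_upwards [L.compl_lattice_sdiff_singleton_mem_nhds 0] with w hw hw0 hwL
  exact hw ⟨hwL, hw0⟩

/-- The derivative of an even function vanishes at the origin. -/
lemma tendsto_div_self_of_even {N : ℂ → ℂ} (hN : DifferentiableAt ℂ N 0) (h0 : N 0 = 0)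
    (heven : ∀ z, N (-z) = N z) : Tendsto (fun z => N z / z) (𝓝[≠] 0) (𝓝 0) := by
  have h1 := hN.hasDerivAt
  have h2 : HasDerivAt N (-deriv N 0) 0 := by
    have h3 : HasDerivAt (fun z => N (-z)) (-deriv N 0) 0 := by
      have h1' : HasDerivAt N (deriv N 0) (-0) := by simpa using h1
      have h := h1'.scomp (0 : ℂ) (hasDerivAt_neg (0 : ℂ))
      rwa [neg_one_smul] at h
    simpa only [heven] using h3
  have h4 : deriv N 0 = 0 := self_eq_neg.1 (h1.unique h2)
  rw [h4, hasDerivAt_iff_tendsto_slope_zero] at h1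
  refine h1.congr fun z => ?_
  rw [zero_add, h0, sub_zero, smul_eq_mul, div_eq_inv_mul]

/-- `℘(z) - ℘(a) = -σ(z - a) σ(z + a) / (σ(z)² σ(a)²)`. -/
theorem weierstrassSigma_sub_mul_add {z a : ℂ} (hz : z ∉ L.lattice) (ha : a ∉ L.lattice) :
    weierstrassSigma L (z - a) * weierstrassSigma L (z + a) =
      -(weierstrassSigma L a ^ 2 * weierstrassSigma L z ^ 2 *
        (L.weierstrassP z - L.weierstrassP a)) := by
  set f : ℂ → ℂ := fun z => weierstrassSigma L (z - a) * weierstrassSigma L (z + a) /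
    weierstrassSigma L z ^ 2 + weierstrassSigma L a ^ 2 * (L.weierstrassP z - L.weierstrassP a)
    with hf
  -- Off the lattice this is `z² f(z)`, written with the regular parts of sigma and `℘` so that it
  -- is holomorphic at `0`. It is even and vanishes there, hence `z f(z) = N(z)/z` tends to `0`.
  set N : ℂ → ℂ := fun z => weierstrassSigma L (z - a) * weierstrassSigma L (z + a) /
    sigmaReg L z ^ 2 + weierstrassSigma L a ^ 2 *
      (1 + z ^ 2 * (L.weierstrassPExcept 0 z - L.weierstrassP a)) with hN
  have hper1 : ∀ l ∈ L.lattice, l / 2 ∉ L.lattice → ∀ z ∉ L.lattice, f (z + l) = f z := by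
    intro l hl hl2 z hz
    have hs := weierstrassSigma_ne_zero L hz
    have hE : exp (2 * weierstrassZeta L (l / 2) * (z - a + l / 2)) *
        exp (2 * weierstrassZeta L (l / 2) * (z + a + l / 2)) =
        exp (2 * weierstrassZeta L (l / 2) * (z + l / 2)) ^ 2 := by
      rw [← exp_add, ← exp_nat_mul]
      congr 1
      push_cast
      ring
    have he := exp_ne_zero (2 * weierstrassZeta L (l / 2) * (z + l / 2))
    simp only [hf]
    rw [show z + l - a = z - a + l by ring, show z + l + a = z + a + l by ring,
      weierstrassSigma_add L hl hl2, weierstrassSigma_add L hl hl2, weierstrassSigma_add L hl hl2,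
      weierstrassP_add L hl]
    congr 1
    rw [div_eq_div_iff (by simp [he, hs]) (by simp [hs])]
    linear_combination (weierstrassSigma L (z - a) * weierstrassSigma L (z + a) *
      weierstrassSigma L z ^ 2) * hE
  have hper := periodic_of_generators L (f := f)
    (hper1 _ L.ω₁_mem_lattice L.ω₁_div_two_notMem_lattice)
    (hper1 _ L.ω₂_mem_lattice L.ω₂_div_two_notMem_lattice)
  have hσ := differentiable_weierstrassSigma L
  have hdiff : ∀ z ∉ L.lattice, DifferentiableAt ℂ f z := by
    intro z hz
    have h1 := (hasDerivAt_weierstrassP L hz).differentiableAt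
    have h2 : DifferentiableAt ℂ (fun z => weierstrassSigma L (z - a)) z := by fun_prop
    have h3 : DifferentiableAt ℂ (fun z => weierstrassSigma L (z + a)) z := by fun_prop
    exact ((h2.mul h3).fun_div ((hσ z).pow 2) (pow_ne_zero 2 (weierstrassSigma_ne_zero L hz))).add
      ((h1.sub_const _).const_mul _)
  have hNd : DifferentiableAt ℂ N 0 := by
    have h1 : DifferentiableAt ℂ (L.weierstrassPExcept 0) 0 :=
      (L.differentiableOn_weierstrassPExcept 0).differentiableAt
        (L.compl_lattice_sdiff_singleton_mem_nhds 0)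
    have h2 : DifferentiableAt ℂ (fun z => weierstrassSigma L (z - a)) 0 := by fun_prop
    have h3 : DifferentiableAt ℂ (fun z => weierstrassSigma L (z + a)) 0 := by fun_prop
    have h4 : DifferentiableAt ℂ (sigmaReg L) 0 := differentiable_sigmaReg L 0
    refine ((h2.mul h3).fun_div (h4.pow 2) (by simp [sigmaReg_zero])).add ?_
    fun_prop
  have hN0 : N 0 = 0 := by
    simp only [hN]
    rw [zero_sub, zero_add, weierstrassSigma_neg, sigmaReg_zero]
    ring
  have hNe : ∀ z, N (-z) = N z := by
    intro z
    simp only [hN]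
    rw [show -z - a = -(z + a) by ring, show -z + a = -(z - a) by ring, weierstrassSigma_neg,
      weierstrassSigma_neg, sigmaReg_neg, L.weierstrassPExcept_neg, neg_zero]
    ring
  have hlim : Tendsto (fun z => z * f z) (𝓝[≠] 0) (𝓝 0) := by
    refine (tendsto_div_self_of_even hNd hN0 hNe).congr' ?_
    filter_upwards [eventually_notMem_lattice L] with w hw
    have hw0 := ne_zero_of_notMem L hw
    have hs : sigmaReg L w ≠ 0 := sigmaReg_ne_zero L fun h => hw h.1
    simp only [hN, hf]
    rw [weierstrassPExcept_zero_eq, weierstrassSigma_eq L w]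
    field_simp
    ring
  -- The constant is read off at `z = a`, where both summands of `f` vanish.
  have h := elliptic_eq_of_mul_tendsto_zero L hdiff hper hlim hz ha
  have hs := weierstrassSigma_ne_zero L hz
  simp only [hf, sub_self, weierstrassSigma_eq_zero L (zero_mem _), zero_mul, zero_div, mul_zero,
    add_zero] at h
  field_simp at h
  linear_combination h

lemma notMem_of_weierstrassP_ne {z a : ℂ} (hz : z ∉ L.lattice) (ha : a ∉ L.lattice)
    (h : L.weierstrassP z ≠ L.weierstrassP a) : z - a ∉ L.lattice ∧ z + a ∉ L.lattice := by
  have h1 := weierstrassSigma_sub_mul_add L hz ha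
  have h2 : weierstrassSigma L (z - a) * weierstrassSigma L (z + a) ≠ 0 := by
    rw [h1]
    have h3 := weierstrassSigma_ne_zero L hz
    have h4 := weierstrassSigma_ne_zero L ha
    have h5 := sub_ne_zero.2 h
    simp [h3, h4, h5]
  exact ⟨fun h => h2 (by simp [weierstrassSigma_eq_zero L h]),
    fun h => h2 (by simp [weierstrassSigma_eq_zero L h])⟩

/-- This is the logarithmic derivative in `z` of the sigma product formula. -/
lemma weierstrassZeta_sub_add_add {z a : ℂ} (hz : z ∉ L.lattice) (ha : a ∉ L.lattice)
    (h : L.weierstrassP z ≠ L.weierstrassP a) :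
    weierstrassZeta L (z - a) + weierstrassZeta L (z + a) =
      2 * weierstrassZeta L z +
        L.derivWeierstrassP z / (L.weierstrassP z - L.weierstrassP a) := by
  obtain ⟨h1, h2⟩ := notMem_of_weierstrassP_ne L hz ha h
  have hd1 := ((hasDerivAt_weierstrassSigma L h1).comp_sub_const z a).fun_mul
    ((hasDerivAt_weierstrassSigma L h2).comp_add_const z a)
  have hd2 := ((((hasDerivAt_weierstrassSigma L hz).fun_pow 2).const_mul
    (weierstrassSigma L a ^ 2)).fun_mul
    ((hasDerivAt_weierstrassP L hz).sub_const (L.weierstrassP a))).fun_neg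
  have heq := (hd1.congr_of_eventuallyEq (f₁ := fun z => -(weierstrassSigma L a ^ 2 *
    weierstrassSigma L z ^ 2 * (L.weierstrassP z - L.weierstrassP a))) ?_).unique hd2
  · have h3 := weierstrassSigma_ne_zero L hz
    have h4 := weierstrassSigma_ne_zero L ha
    have h5 := sub_ne_zero.2 h
    have h6 := weierstrassSigma_sub_mul_add L hz ha
    have h7 : weierstrassSigma L a ^ 2 * weierstrassSigma L z ^ 2 *
        (L.weierstrassP z - L.weierstrassP a) ≠ 0 := by simp [h3, h4, h5]
    have h8 : weierstrassSigma L a ^ 2 * weierstrassSigma L z ^ 2 *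
        (L.weierstrassP z - L.weierstrassP a) * (weierstrassZeta L (z - a) +
          weierstrassZeta L (z + a)) = weierstrassSigma L a ^ 2 * weierstrassSigma L z ^ 2 *
        (L.weierstrassP z - L.weierstrassP a) * (2 * weierstrassZeta L z +
        L.derivWeierstrassP z / (L.weierstrassP z - L.weierstrassP a)) := by
      have hq := div_mul_cancel₀ (L.derivWeierstrassP z) h5
      norm_num at heq
      linear_combination -heq - weierstrassSigma L a ^ 2 * weierstrassSigma L z ^ 2 * hq + (weierstrassZeta L (z - a) + weierstrassZeta L (z + a)) * h6
    exact mul_left_cancel₀ h7 h8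
  · filter_upwards [(isOpen_compl_lattice L).mem_nhds hz] with w hw
    exact (weierstrassSigma_sub_mul_add L hw ha).symm

/-- Addition theorem of the zeta function. -/
theorem weierstrassZeta_sub {z a : ℂ} (hz : z ∉ L.lattice) (ha : a ∉ L.lattice)
    (h : L.weierstrassP z ≠ L.weierstrassP a) :
    weierstrassZeta L (z - a) - weierstrassZeta L z + weierstrassZeta L a =
      (L.derivWeierstrassP z + L.derivWeierstrassP a) /
        (2 * (L.weierstrassP z - L.weierstrassP a)) := by
  have h1 := weierstrassZeta_sub_add_add L hz ha h
  -- Exchanging `z` and `a` keeps `ζ(z + a)` and changes the sign of `ζ(z - a)`; half the difference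
  -- of the two relations is the claim.
  have h2 := weierstrassZeta_sub_add_add L ha hz h.symm
  have h5 := sub_ne_zero.2 h
  rw [show a - z = -(z - a) by ring, weierstrassZeta_neg, add_comm a z,
    ← neg_sub (L.weierstrassP z), div_neg] at h2
  rw [mul_comm 2, ← div_div, add_div]
  linear_combination (h1 - h2) / 2

lemma derivWeierstrassP_half {h : ℂ} (hl : 2 * h ∈ L.lattice) : L.derivWeierstrassP h = 0 := by
  have h1 := derivWeierstrassP_add L (z := -h) hl
  rw [show -h + 2 * h = h by ring, L.derivWeierstrassP_neg] at h1
  exact self_eq_neg.1 h1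

/-- The constant `(e_i - e_j) (e_i - e_k)` for the half period `h = ω_i`. -/
def halfShift (h : ℂ) : ℂ := exp (2 * weierstrassZeta L h * h) / weierstrassSigma L h ^ 4

lemma halfShift_ne_zero {h : ℂ} (hh : h ∉ L.lattice) : halfShift L h ≠ 0 :=
  div_ne_zero (exp_ne_zero _) (pow_ne_zero _ (weierstrassSigma_ne_zero L hh))

/-- Translation of `℘` by a half period. -/
theorem weierstrassP_add_half {h z : ℂ} (hl : 2 * h ∈ L.lattice) (hh : h ∉ L.lattice)
    (hz : z ∉ L.lattice) (hzh : z + h ∉ L.lattice) :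
    (L.weierstrassP z - L.weierstrassP h) * (L.weierstrassP (z + h) - L.weierstrassP h) =
      halfShift L h := by
  have hl2 : 2 * h / 2 ∉ L.lattice := by rwa [mul_div_cancel_left₀ h two_ne_zero]
  -- The product formula is used at `z` and at `z + h`. Quasi-periodicity of sigma under `2h`
  -- expresses `σ(z + 2h)` by `σ(z)` and `σ(z + h)` by `σ(z - h)`, after which all values of sigma
  -- except `σ(h)` cancel.
  have h1 := weierstrassSigma_sub_mul_add L hz hh
  have h2 := weierstrassSigma_sub_mul_add L hzh hh
  have h3 := weierstrassSigma_add L hl hl2 z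
  have h4 := weierstrassSigma_add L hl hl2 (z - h)
  rw [mul_div_cancel_left₀ h two_ne_zero] at h3 h4
  rw [show z + h - h = z by ring, show z + h + h = z + 2 * h by ring, h3] at h2
  rw [show z - h + 2 * h = z + h by ring, show z - h + h = z by ring] at h4
  have hE : exp (2 * weierstrassZeta L h * (z + h)) =
      exp (2 * weierstrassZeta L h * z) * exp (2 * weierstrassZeta L h * h) := by
    rw [← exp_add]
    ring_nf
  have s1 := weierstrassSigma_ne_zero L hz
  have s2 := weierstrassSigma_ne_zero L hh
  have s3 := weierstrassSigma_ne_zero L hzh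
  rw [hE] at h2
  have e1 := exp_ne_zero (2 * weierstrassZeta L h * z)
  generalize exp (2 * weierstrassZeta L h * z) = E at *
  rw [halfShift, eq_div_iff (pow_ne_zero _ s2)]
  have key : (weierstrassSigma L z ^ 2 * weierstrassSigma L (z + h) ^ 2) *
      ((L.weierstrassP z - L.weierstrassP h) * (L.weierstrassP (z + h) - L.weierstrassP h) *
        weierstrassSigma L h ^ 4) = (weierstrassSigma L z ^ 2 * weierstrassSigma L (z + h) ^ 2) *
      exp (2 * weierstrassZeta L h * h) := by
    generalize exp (2 * weierstrassZeta L h * h) = F at *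
    linear_combination (weierstrassSigma L h ^ 2 * weierstrassSigma L (z + h) ^ 2 *
      (L.weierstrassP (z + h) - L.weierstrassP h)) * h1 - weierstrassSigma L (z - h) *
        weierstrassSigma L (z + h) * h2 -
        F * weierstrassSigma L z ^ 2 * weierstrassSigma L (z + h) * h4
  exact mul_left_cancel₀ (by simp [s1, s3]) key

end SigmaFormula

/-! ### Half periods, the values `eᵢ` and the differential equations of `℘` -/

section HalfPeriods

variable (τ : ℍ)

lemma rat_mem_periods (a b : ℚ) :
    (a : ℂ) + b * τ ∈ (periods τ).lattice ↔ a.den = 1 ∧ b.den = 1 := by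
  have h := mul_ω₁_add_mul_ω₂_mem_lattice (L := periods τ) (α := a) (β := b)
  simpa [periods] using h

lemma mem_periods {z : ℂ} : z ∈ (periods τ).lattice ↔ ∃ m n : ℤ, (m : ℂ) + n * τ = z := by
  have h := mem_lattice (L := periods τ) (x := z)
  simpa [periods] using h

lemma one_mem_periods : (1 : ℂ) ∈ (periods τ).lattice := (periods τ).ω₁_mem_lattice

lemma coe_mem_periods : (τ : ℂ) ∈ (periods τ).lattice := (periods τ).ω₂_mem_lattice

lemma half_notMem_periods : (1 / 2 : ℂ) ∉ (periods τ).lattice :=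
  (periods τ).ω₁_div_two_notMem_lattice

lemma coe_div_two_notMem_periods : (τ / 2 : ℂ) ∉ (periods τ).lattice :=
  (periods τ).ω₂_div_two_notMem_lattice

lemma halfPeriod_notMem (i : Fin 3) : halfPeriod τ i ∉ (periods τ).lattice := by
  fin_cases i
  · exact half_notMem_periods τ
  · have h := (rat_mem_periods τ (-(1 / 2)) (-(1 / 2))).not.2 (by norm_num)
    convert h using 2
    simp [halfPeriod]
    ring
  · exact coe_div_two_notMem_periods τ

lemma two_mul_halfPeriod_mem (i : Fin 3) : 2 * halfPeriod τ i ∈ (periods τ).lattice := by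
  fin_cases i
  · simpa [halfPeriod] using one_mem_periods τ
  · have h := (rat_mem_periods τ (-1) (-1)).2 (by norm_num)
    convert h using 1
    simp [halfPeriod]
    ring
  · simpa [halfPeriod, mul_div_cancel₀] using coe_mem_periods τ

lemma halfPeriod_add_halfPeriod {i j k : Fin 3} (hij : i ≠ j) (hik : i ≠ k) (hjk : j ≠ k) :
    halfPeriod τ i + halfPeriod τ j = -halfPeriod τ k := by
  have h0 : halfPeriod τ 0 = 1 / 2 := rfl
  have h1 : halfPeriod τ 1 = -(1 / 2) - τ / 2 := rfl
  have h2 : halfPeriod τ 2 = τ / 2 := rfl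
  fin_cases i <;> fin_cases j <;> fin_cases k <;> simp_all
  all_goals ring

/-- Translation by `ωᵢ` sends `ωⱼ` to `-ωₖ`. The right side is an exponential over a power of sigma,
visibly non-zero, so the `eᵢ` are distinct without counting zeros of `℘'`. -/
lemma e_sub_mul_e_sub {i j k : Fin 3} (hij : i ≠ j) (hik : i ≠ k) (hjk : j ≠ k) :
    (e τ j - e τ i) * (e τ k - e τ i) = halfShift (periods τ) (halfPeriod τ i) := by
  have hs : halfPeriod τ j + halfPeriod τ i = -halfPeriod τ k :=
    halfPeriod_add_halfPeriod τ hij.symm hjk hik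
  have h := weierstrassP_add_half (periods τ) (two_mul_halfPeriod_mem τ i) (halfPeriod_notMem τ i)
    (halfPeriod_notMem τ j) (by rw [hs, neg_mem_iff]; exact halfPeriod_notMem τ k)
  rwa [hs, weierstrassP_neg] at h

lemma exists_third {i j : Fin 3} (hij : i ≠ j) : ∃ k, i ≠ k ∧ j ≠ k := by
  revert i j
  decide

lemma e_injective : Function.Injective (e τ) := by
  intro i j h
  by_contra hij
  obtain ⟨k, hik, hjk⟩ := exists_third hij
  have h1 := e_sub_mul_e_sub τ hij hik hjk
  rw [h, sub_self, zero_mul] at h1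
  exact halfShift_ne_zero _ (halfPeriod_notMem τ i) h1.symm

lemma wp'_sq {z : ℂ} (hz : z ∉ (periods τ).lattice) :
    wp' τ z ^ 2 = 4 * wp τ z ^ 3 - (periods τ).g₂ * wp τ z - (periods τ).g₃ :=
  (periods τ).derivWeierstrassP_sq z hz

lemma cubic_e (i : Fin 3) : 4 * e τ i ^ 3 - (periods τ).g₂ * e τ i - (periods τ).g₃ = 0 := by
  have h := wp'_sq τ (halfPeriod_notMem τ i)
  rw [wp', derivWeierstrassP_half _ (two_mul_halfPeriod_mem τ i)] at h
  rw [e, ← h]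
  ring

/-- The `eᵢ` are three distinct roots of a cubic without quadratic term. -/
lemma sum_e : e τ 0 + e τ 1 + e τ 2 = 0 := by
  have h0 := cubic_e τ 0
  have h1 := cubic_e τ 1
  have h2 := cubic_e τ 2
  have h01 : e τ 0 - e τ 1 ≠ 0 := sub_ne_zero.2 ((e_injective τ).ne (by decide))
  have h02 : e τ 0 - e τ 2 ≠ 0 := sub_ne_zero.2 ((e_injective τ).ne (by decide))
  have h12 : e τ 1 - e τ 2 ≠ 0 := sub_ne_zero.2 ((e_injective τ).ne (by decide))
  have a : 4 * (e τ 0 ^ 2 + e τ 0 * e τ 1 + e τ 1 ^ 2) = (periods τ).g₂ :=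
    mul_left_cancel₀ h01 (by linear_combination h0 - h1)
  have b : 4 * (e τ 0 ^ 2 + e τ 0 * e τ 2 + e τ 2 ^ 2) = (periods τ).g₂ :=
    mul_left_cancel₀ h02 (by linear_combination h0 - h2)
  exact mul_left_cancel₀ h12 (by linear_combination (a - b) / 4)

lemma g₂_eq : (periods τ).g₂ = 4 * (e τ 0 ^ 2 + e τ 0 * e τ 1 + e τ 1 ^ 2) := by
  have h01 : e τ 0 - e τ 1 ≠ 0 := sub_ne_zero.2 ((e_injective τ).ne (by decide))
  exact (mul_left_cancel₀ h01 (by linear_combination cubic_e τ 0 - cubic_e τ 1)).symm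

lemma g₃_eq : (periods τ).g₃ = 4 * (e τ 0 * e τ 1 * e τ 2) := by
  have h2 : e τ 2 = -e τ 0 - e τ 1 := by linear_combination sum_e τ
  have h := cubic_e τ 0
  rw [g₂_eq] at h
  rw [h2]
  linear_combination -h

lemma cubic_eq (X : ℂ) : 4 * X ^ 3 - (periods τ).g₂ * X - (periods τ).g₃ =
    4 * ((X - e τ 0) * (X - e τ 1) * (X - e τ 2)) := by
  have h2 : e τ 2 = -e τ 0 - e τ 1 := by linear_combination sum_e τ
  rw [g₃_eq, g₂_eq, h2]
  ring

lemma halfShift_eq (i : Fin 3) :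
    halfShift (periods τ) (halfPeriod τ i) = 3 * e τ i ^ 2 - (periods τ).g₂ / 4 := by
  have h2 : e τ 2 = -e τ 0 - e τ 1 := by linear_combination sum_e τ
  fin_cases i <;> simp only [Fin.zero_eta, Fin.mk_one, Fin.reduceFinMk]
  · rw [← e_sub_mul_e_sub τ (i := 0) (j := 1) (k := 2) (by decide) (by decide) (by decide), g₂_eq]
    simp [h2]
    ring
  · rw [← e_sub_mul_e_sub τ (i := 1) (j := 0) (k := 2) (by decide) (by decide) (by decide), g₂_eq]
    simp [h2]
    ring
  · rw [← e_sub_mul_e_sub τ (i := 2) (j := 0) (k := 1) (by decide) (by decide) (by decide), g₂_eq]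
    simp [h2]
    ring

lemma wp'_ne_zero {z : ℂ} (hz : z ∉ (periods τ).lattice) (h : ∀ i, wp τ z ≠ e τ i) :
    wp' τ z ≠ 0 := by
  intro h0
  have h1 := wp'_sq τ hz
  rw [h0, cubic_eq] at h1
  have := sub_ne_zero.2 (h 0)
  have := sub_ne_zero.2 (h 1)
  have := sub_ne_zero.2 (h 2)
  simp_all

lemma exists_wp_eq_e {z : ℂ} (hz : z ∉ (periods τ).lattice) (h : wp' τ z = 0) :
    ∃ i, wp τ z = e τ i := by
  by_contra! hcon
  exact wp'_ne_zero τ hz hcon h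

lemma analyticOnNhd_wp : AnalyticOnNhd ℂ (wp τ) ((periods τ).lattice : Set ℂ)ᶜ :=
  (periods τ).analyticOnNhd_weierstrassP

lemma analyticOnNhd_wp' : AnalyticOnNhd ℂ (wp' τ) ((periods τ).lattice : Set ℂ)ᶜ :=
  (periods τ).analyticOnNhd_derivWeierstrassP

lemma eventually_ne_of_analyticOnNhd {L : PeriodPair} {f : ℂ → ℂ}
    (hf : AnalyticOnNhd ℂ f (L.lattice : Set ℂ)ᶜ) {a : ℂ} (ha : a ∉ L.lattice) (hfa : f a ≠ 0)
    {z : ℂ} (hz : z ∉ L.lattice) : ∀ᶠ w in 𝓝[≠] z, f w ≠ 0 := by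
  refine (hf z hz).eventually_eq_zero_or_eventually_ne_zero.resolve_left fun h => hfa ?_
  exact hf.eqOn_zero_of_preconnected_of_eventuallyEq_zero (isPreconnected_compl_lattice L) hz h ha

lemma eventually_wp_ne (c : ℂ) {z : ℂ} (hz : z ∉ (periods τ).lattice) :
    ∀ᶠ w in 𝓝[≠] z, wp τ w ≠ c := by
  have hf : AnalyticOnNhd ℂ (fun w => wp τ w - c) ((periods τ).lattice : Set ℂ)ᶜ :=
    (analyticOnNhd_wp τ).sub analyticOnNhd_const
  have h01 : e τ 0 ≠ e τ 1 := (e_injective τ).ne (by decide)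
  have : ∃ i, e τ i ≠ c := by
    by_contra! h
    exact h01 ((h 0).trans (h 1).symm)
  obtain ⟨i, hi⟩ := this
  exact (eventually_ne_of_analyticOnNhd hf (halfPeriod_notMem τ i) (sub_ne_zero.2 hi) hz).mono
    fun w hw => sub_ne_zero.1 hw

lemma hasDerivAt_wp {z : ℂ} (hz : z ∉ (periods τ).lattice) : HasDerivAt (wp τ) (wp' τ z) z :=
  hasDerivAt_weierstrassP (periods τ) hz

lemma eventually_wp'_ne_zero {z : ℂ} (hz : z ∉ (periods τ).lattice) :
    ∀ᶠ w in 𝓝[≠] z, wp' τ w ≠ 0 := by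
  have : ∃ a, a ∉ (periods τ).lattice ∧ wp' τ a ≠ 0 := by
    by_contra! h
    have h1 := eq_of_hasDerivAt_zero (periods τ) (f := wp τ)
      (fun z hz => h z hz ▸ hasDerivAt_wp τ hz) (halfPeriod_notMem τ 0) (halfPeriod_notMem τ 1)
    exact (e_injective τ).ne (show (0 : Fin 3) ≠ 1 by decide) h1
  obtain ⟨a, ha, ha'⟩ := this
  exact eventually_ne_of_analyticOnNhd (analyticOnNhd_wp' τ) ha ha' hz

/-- `℘'' = 6 ℘² - g₂ / 2`. -/
lemma hasDerivAt_wp' {z : ℂ} (hz : z ∉ (periods τ).lattice) :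
    HasDerivAt (wp' τ) (6 * wp τ z ^ 2 - (periods τ).g₂ / 2) z := by
  have hd : ∀ w ∉ (periods τ).lattice, HasDerivAt (wp' τ) (deriv (wp' τ) w) w := fun w hw =>
    (analyticOnNhd_wp' τ w hw).differentiableAt.hasDerivAt
  have hmul : ∀ w ∉ (periods τ).lattice, wp' τ w ≠ 0 →
      deriv (wp' τ) w = 6 * wp τ w ^ 2 - (periods τ).g₂ / 2 := by
    intro w hw hw0
    have h1 := (hd w hw).fun_pow 2
    have h2 := ((((hasDerivAt_wp τ hw).fun_pow 3).const_mul 4).fun_sub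
      ((hasDerivAt_wp τ hw).const_mul (periods τ).g₂)).sub_const (periods τ).g₃
    have h3 := (h1.congr_of_eventuallyEq (f₁ := fun z => 4 * wp τ z ^ 3 - (periods τ).g₂ * wp τ z -
      (periods τ).g₃) (by
        filter_upwards [(isOpen_compl_lattice (periods τ)).mem_nhds hw] with v hv
        exact (wp'_sq τ hv).symm)).unique h2
    norm_num at h3
    exact mul_left_cancel₀ hw0 (by linear_combination h3 / 2)
  -- Differentiating the cubic relation permits division by `℘'` only where it is non-zero. Its
  -- zeros are isolated, so continuity covers the rest.
  have hcont : ContinuousAt (fun w => deriv (wp' τ) w - (6 * wp τ w ^ 2 - (periods τ).g₂ / 2)) z := by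
    have h1 := (analyticOnNhd_wp' τ z hz).deriv.continuousAt
    have h2 := (analyticOnNhd_wp τ z hz).continuousAt
    fun_prop
  have h0 : deriv (wp' τ) z - (6 * wp τ z ^ 2 - (periods τ).g₂ / 2) = 0 := by
    refine tendsto_nhds_unique (hcont.tendsto.mono_left nhdsWithin_le_nhds)
      ((tendsto_const_nhds (f := 𝓝[≠] z)).congr' ?_)
    filter_upwards [eventually_wp'_ne_zero τ hz,
      nhdsWithin_le_nhds ((isOpen_compl_lattice (periods τ)).mem_nhds hz)] with w hw hw'
    rw [hmul w hw' hw, sub_self]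
  rw [← sub_eq_zero.1 h0]
  exact hd z hz

/-- `℘` takes every value. -/
lemma exists_wp_eq (c : ℂ) : ∃ z ∉ (periods τ).lattice, wp τ z = c := by
  by_contra! hcon
  -- If the value `c` were omitted, `1/(℘ - c)` would be elliptic with limit `0` at the lattice
  -- points, hence identically zero.
  have hlim : Tendsto (fun z => (wp τ z - c)⁻¹) (𝓝[≠] 0) (𝓝 0) := by
    have h1 : ContinuousAt (fun z => z ^ 2 / (1 + z ^ 2 * ((periods τ).weierstrassPExcept 0 z - c)))
        0 := by
      have h2 : ContinuousAt ((periods τ).weierstrassPExcept 0) 0 :=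
        ((periods τ).analyticAt_weierstrassPExcept 0).continuousAt
      exact ContinuousAt.div₀ (by fun_prop) (by fun_prop) (by simp)
    have h3 := h1.tendsto.mono_left (nhdsWithin_le_nhds (s := {0}ᶜ))
    simp only [ne_eq, OfNat.ofNat_ne_zero, not_false_eq_true, zero_pow, zero_mul, add_zero,
      div_one] at h3
    refine h3.congr' ?_
    filter_upwards [self_mem_nhdsWithin] with z hz
    have hz0 : z ≠ 0 := hz
    rw [weierstrassPExcept_zero_eq, wp]
    have : 1 + z ^ 2 * ((periods τ).weierstrassP z - 1 / z ^ 2 - c) =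
        z ^ 2 * ((periods τ).weierstrassP z - c) := by
      field_simp
      ring
    rw [this, ← div_div, div_self (pow_ne_zero 2 hz0), one_div]
  have h := elliptic_eq_of_tendsto (periods τ) (fun z hz =>
    ((hasDerivAt_wp τ hz).differentiableAt.sub_const c).fun_inv (sub_ne_zero.2 (hcon z hz)))
    (fun l hl z _ => by simp only [wp]; rw [weierstrassP_add _ hl]) hlim (half_notMem_periods τ)
  exact inv_ne_zero (sub_ne_zero.2 (hcon _ (half_notMem_periods τ))) h

/-- Translation of `℘'` by a half period. -/
lemma wp'_add_halfPeriod {z : ℂ} (hz : z ∉ (periods τ).lattice) (i : Fin 3)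
    (hzi : wp τ z ≠ e τ i) :
    wp' τ (z + halfPeriod τ i) =
      -(3 * e τ i ^ 2 - (periods τ).g₂ / 4) * wp' τ z / (wp τ z - e τ i) ^ 2 := by
  have hL := isOpen_compl_lattice (periods τ)
  have hzh : z + halfPeriod τ i ∉ (periods τ).lattice :=
    (notMem_of_weierstrassP_ne (periods τ) hz (halfPeriod_notMem τ i) hzi).2
  have hrel := fun w h1 h2 => weierstrassP_add_half (periods τ) (z := w)
    (two_mul_halfPeriod_mem τ i) (halfPeriod_notMem τ i) h1 h2
  have h1 := ((hasDerivAt_wp τ hz).sub_const (e τ i)).fun_mul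
    (((hasDerivAt_wp τ hzh).comp_add_const z (halfPeriod τ i)).sub_const (e τ i))
  have h2 := (h1.congr_of_eventuallyEq (f₁ := fun _ => halfShift (periods τ) (halfPeriod τ i)) (by
    have hc : ContinuousAt (fun w => w + halfPeriod τ i) z := by fun_prop
    filter_upwards [hL.mem_nhds hz, hc.preimage_mem_nhds (hL.mem_nhds hzh)] with w hw hw'
    exact (hrel w hw hw').symm)).unique (hasDerivAt_const _ _)
  have h3 := hrel z hz hzh
  rw [halfShift_eq] at h3
  have h4 := sub_ne_zero.2 hzi
  rw [eq_div_iff (pow_ne_zero 2 h4), ← h3]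
  simp only [wp, e] at h2 h4 ⊢
  linear_combination ((periods τ).weierstrassP z - (periods τ).weierstrassP (halfPeriod τ i)) * h2

end HalfPeriods

/-! ### Legendre's relation modulo `πi`, and at `τ = i` -/

section Legendre

open scoped Interval

variable (τ : ℍ)

lemma weierstrassZeta_add_one {z : ℂ} (hz : z ∉ (periods τ).lattice) :
    weierstrassZeta (periods τ) (z + 1) = weierstrassZeta (periods τ) z + 2 * eta₁ τ :=
  weierstrassZeta_add _ (one_mem_periods τ) (half_notMem_periods τ) hz

lemma weierstrassZeta_add_coe {z : ℂ} (hz : z ∉ (periods τ).lattice) :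
    weierstrassZeta (periods τ) (z + τ) = weierstrassZeta (periods τ) z + 2 * eta₃ τ :=
  weierstrassZeta_add _ (coe_mem_periods τ) (coe_div_two_notMem_periods τ) hz

lemma weierstrassSigma_add_one (z : ℂ) : weierstrassSigma (periods τ) (z + 1) =
    -exp (2 * eta₁ τ * (z + 1 / 2)) * weierstrassSigma (periods τ) z :=
  weierstrassSigma_add _ (one_mem_periods τ) (half_notMem_periods τ) z

lemma weierstrassSigma_add_coe (z : ℂ) : weierstrassSigma (periods τ) (z + τ) =
    -exp (2 * eta₃ τ * (z + τ / 2)) * weierstrassSigma (periods τ) z :=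
  weierstrassSigma_add _ (coe_mem_periods τ) (coe_div_two_notMem_periods τ) z

/-- The two orders of adding the periods `1` and `τ` to the argument `1/2` of sigma must agree. This
is Legendre's relation up to an integer multiple of `πi`. -/
lemma exp_legendre : exp (2 * (eta₁ τ * τ - eta₃ τ)) = 1 := by
  have h1 := weierstrassSigma_add_coe τ (1 / 2 + 1)
  have h2 := weierstrassSigma_add_one τ (1 / 2 + τ)
  rw [weierstrassSigma_add_one] at h1
  rw [weierstrassSigma_add_coe, show (1 / 2 + τ + 1 : ℂ) = 1 / 2 + 1 + τ by ring, h1] at h2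
  have hs := weierstrassSigma_ne_zero _ (half_notMem_periods τ)
  have h3 : exp (2 * eta₃ τ * (1 / 2 + 1 + τ / 2)) * exp (2 * eta₁ τ * (1 / 2 + 1 / 2)) =
      exp (2 * eta₁ τ * (1 / 2 + τ + 1 / 2)) * exp (2 * eta₃ τ * (1 / 2 + τ / 2)) :=
    mul_right_cancel₀ hs (by linear_combination h2)
  rw [← exp_add, ← exp_add] at h3
  have h4 : exp (2 * (eta₁ τ * τ - eta₃ τ)) =
      exp (2 * eta₁ τ * (1 / 2 + τ + 1 / 2) + 2 * eta₃ τ * (1 / 2 + τ / 2)) /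
      exp (2 * eta₃ τ * (1 / 2 + 1 + τ / 2) + 2 * eta₁ τ * (1 / 2 + 1 / 2)) := by
    rw [← exp_sub]
    ring_nf
  rw [h4, h3, div_self (exp_ne_zero _)]

lemma integral_one_div_sq_add :
    ∫ x : ℝ in (-(1 / 2))..(1 / 2), (1 / ((x : ℂ) ^ 2 + 1 / 4) : ℂ) = (Real.pi : ℂ) := by
  have h : ∫ x : ℝ in (-(1 / 2))..(1 / 2), (1 / (x ^ 2 + 1 / 4)) = Real.pi := by
    have hd : ∀ x : ℝ, HasDerivAt (fun x => 2 * Real.arctan (2 * x)) (1 / (x ^ 2 + 1 / 4)) x := by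
      intro x
      have h1 := ((Real.hasDerivAt_arctan (2 * x)).comp x
        ((hasDerivAt_id x).const_mul 2)).const_mul 2
      refine h1.congr_deriv ?_
      have : 0 < x ^ 2 + 1 / 4 := by positivity
      have : 0 < 1 + (2 * x) ^ 2 := by positivity
      field_simp
      ring
    rw [intervalIntegral.integral_eq_sub_of_hasDerivAt (fun x _ => hd x)]
    · norm_num [Real.arctan_one, Real.arctan_neg]
      ring
    · refine Continuous.intervalIntegrable (continuous_const.div (by fun_prop) fun x => ?_) _ _
      positivity
  rw [← h, ← intervalIntegral.integral_ofReal]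
  congr with x
  push_cast
  ring

/-- Cauchy's theorem for `ζ(z) - 1/z` on the unit square centred at `0` replaces the residue theorem
for zeta. On opposite sides zeta differs by `2η₃` or `2η₁`, and the differences of `1/z` integrate
to multiples of `∫ dx/(x² + 1/4) = π`. -/
lemma legendre_I : eta₁ UpperHalfPlane.I * I - eta₃ UpperHalfPlane.I = Real.pi * I := by
  set L := periods UpperHalfPlane.I with hL
  have hmem : ∀ z : ℂ, z ∈ L.lattice ↔ ∃ m n : ℤ, (m : ℂ) + n * I = z := fun z =>
    mem_periods UpperHalfPlane.I
  have hsq : ∀ z ∈ ([[-(1 / 2), 1 / 2]] ×ℂ [[-(1 / 2), 1 / 2]]),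
      z ∈ ((L.lattice : Set ℂ) \ {0})ᶜ := by
    rintro z hz ⟨hzL, hz0⟩
    obtain ⟨m, n, rfl⟩ := (hmem z).1 hzL
    rw [mem_reProdIm, uIcc_of_le (by norm_num)] at hz
    simp at hz
    obtain ⟨⟨h1, h2⟩, h3, h4⟩ := hz
    have hm : m = 0 := by
      have a : (-1 : ℝ) < m := by linarith
      have b : (m : ℝ) < 1 := by linarith
      norm_cast at a b
      omega
    have hn : n = 0 := by
      have a : (-1 : ℝ) < n := by linarith
      have b : (n : ℝ) < 1 := by linarith
      norm_cast at a b
      omega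
    exact hz0 (by simp [hm, hn])
  have hdiff : DifferentiableOn ℂ (zetaReg L) ([[-(1 / 2), 1 / 2]] ×ℂ [[-(1 / 2), 1 / 2]]) :=
    fun z hz => (hasDerivAt_zetaReg L (hsq z hz)).differentiableAt.differentiableWithinAt
  have hside : ∀ x : ℝ, x ∈ [[-(1 / 2 : ℝ), 1 / 2]] → ∀ y : ℝ, y ∈ [[-(1 / 2 : ℝ), 1 / 2]] →
      (x : ℂ) + y * I ∈ ([[-(1 / 2), 1 / 2]] ×ℂ [[-(1 / 2), 1 / 2]]) := by
    intro x hx y hy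
    have h1 : ((x : ℂ) + y * I).re = x := by simp
    have h2 : ((x : ℂ) + y * I).im = y := by simp
    rw [mem_reProdIm, h1, h2]
    exact ⟨hx, hy⟩
  have hR := integral_boundary_rect_eq_zero_of_differentiableOn (zetaReg L)
    (-(1 / 2) + (-(1 / 2) : ℝ) * I) (1 / 2 + (1 / 2 : ℝ) * I) (by simpa using hdiff)
  have hm : (-(1 / 2) : ℝ) ∈ [[-(1 / 2 : ℝ), 1 / 2]] := left_mem_uIcc
  have hp : (1 / 2 : ℝ) ∈ [[-(1 / 2 : ℝ), 1 / 2]] := right_mem_uIcc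
  have hi1 : ∀ y : ℝ, y ∈ [[-(1 / 2 : ℝ), 1 / 2]] → IntervalIntegrable
      (fun x : ℝ => zetaReg L (x + y * I)) MeasureTheory.volume (-(1 / 2)) (1 / 2) := by
    intro y hy
    exact (hdiff.continuousOn.comp (by fun_prop) fun x hx => hside x hx y hy).intervalIntegrable
  have hi2 : ∀ x : ℝ, x ∈ [[-(1 / 2 : ℝ), 1 / 2]] → IntervalIntegrable
      (fun y : ℝ => zetaReg L (x + y * I)) MeasureTheory.volume (-(1 / 2)) (1 / 2) := by
    intro x hx
    exact (hdiff.continuousOn.comp (by fun_prop) fun y hy => hside x hx y hy).intervalIntegrable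
  have hz0 : ∀ x y : ℝ, (x : ℂ) + y * I ∈ L.lattice → x ∈ [[-(1 / 2 : ℝ), 1 / 2]] →
      y ∈ [[-(1 / 2 : ℝ), 1 / 2]] → (x : ℂ) + y * I = 0 := by
    intro x y h hx hy
    by_contra h0
    exact hsq _ (hside x hx y hy) ⟨h, h0⟩
  have hint : IntervalIntegrable (fun x : ℝ => 1 / ((x : ℂ) ^ 2 + 1 / 4)) MeasureTheory.volume
      (-(1 / 2)) (1 / 2) := by
    refine Continuous.intervalIntegrable (continuous_const.div (by fun_prop) fun x => ?_) _ _
    have : (0 : ℝ) < x ^ 2 + 1 / 4 := by positivity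
    have h0 : ((x ^ 2 + 1 / 4 : ℝ) : ℂ) ≠ 0 := ofReal_ne_zero.2 this.ne'
    push_cast at h0
    exact h0
  have h1 : (∫ x : ℝ in (-(1 / 2))..(1 / 2), zetaReg L (x + (-(1 / 2) : ℝ) * I)) -
      (∫ x : ℝ in (-(1 / 2))..(1 / 2), zetaReg L (x + (1 / 2 : ℝ) * I)) =
      -2 * eta₃ UpperHalfPlane.I - I * Real.pi := by
    rw [← intervalIntegral.integral_sub (hi1 _ hm) (hi1 _ hp), ← integral_one_div_sq_add,
      ← intervalIntegral.integral_const_mul]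
    have : (-2 * eta₃ UpperHalfPlane.I : ℂ) =
        ∫ x : ℝ in (-(1 / 2))..(1 / 2), (-2 * eta₃ UpperHalfPlane.I : ℂ) := by
      rw [intervalIntegral.integral_const]
      norm_num
    rw [this, ← intervalIntegral.integral_sub (by simp) (hint.const_mul I)]
    refine intervalIntegral.integral_congr fun x hx => ?_
    have hne : ((x : ℂ) + (-(1 / 2) : ℝ) * I) ≠ 0 := by
      intro h
      have := congrArg Complex.im h
      simp at this
    have hne' : ((x : ℂ) + (1 / 2 : ℝ) * I) ≠ 0 := by
      intro h
      have := congrArg Complex.im h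
      simp at this
    have h := weierstrassZeta_add_coe UpperHalfPlane.I (z := x + (-(1 / 2) : ℝ) * I)
      (fun h => hne (hz0 _ _ h hx hm))
    have hI : ((x : ℂ) + (-(1 / 2) : ℝ) * I) + (UpperHalfPlane.I : ℂ) = x + (1 / 2 : ℝ) * I := by
      rw [UpperHalfPlane.coe_I]
      push_cast
      ring
    rw [hI, weierstrassZeta_eq, weierstrassZeta_eq] at h
    have hq : 1 / ((x : ℂ) + (-(1 / 2) : ℝ) * I) - 1 / (x + (1 / 2 : ℝ) * I) =
        I * (1 / ((x : ℂ) ^ 2 + 1 / 4)) := by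
      have h3 : (x : ℂ) ^ 2 + 1 / 4 = (x + (-(1 / 2) : ℝ) * I) * (x + (1 / 2 : ℝ) * I) := by
        push_cast
        linear_combination (1 / 4 : ℂ) * I_sq
      rw [h3, div_sub_div _ _ hne hne', ← mul_div_assoc, mul_one]
      congr 1
      push_cast
      ring
    linear_combination -h - hq
  have h2 : (∫ y : ℝ in (-(1 / 2))..(1 / 2), zetaReg L ((1 / 2 : ℝ) + y * I)) -
      (∫ y : ℝ in (-(1 / 2))..(1 / 2), zetaReg L ((-(1 / 2) : ℝ) + y * I)) =
      2 * eta₁ UpperHalfPlane.I - Real.pi := by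
    rw [← intervalIntegral.integral_sub (hi2 _ hp) (hi2 _ hm), ← integral_one_div_sq_add]
    have : (2 * eta₁ UpperHalfPlane.I : ℂ) =
        ∫ x : ℝ in (-(1 / 2))..(1 / 2), (2 * eta₁ UpperHalfPlane.I : ℂ) := by
      rw [intervalIntegral.integral_const]
      norm_num
    rw [this, ← intervalIntegral.integral_sub (by simp) hint]
    refine intervalIntegral.integral_congr fun x hx => ?_
    have hne : (((-(1 / 2) : ℝ) : ℂ) + x * I) ≠ 0 := by
      intro h
      have := congrArg Complex.re h
      simp at this
    have hne' : (((1 / 2 : ℝ) : ℂ) + x * I) ≠ 0 := by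
      intro h
      have := congrArg Complex.re h
      simp at this
    have h := weierstrassZeta_add_one UpperHalfPlane.I (z := (-(1 / 2) : ℝ) + x * I)
      (fun h => hne (hz0 _ _ h hm hx))
    have hI : (((-(1 / 2) : ℝ) : ℂ) + x * I) + 1 = (1 / 2 : ℝ) + x * I := by
      push_cast
      ring
    rw [hI, weierstrassZeta_eq, weierstrassZeta_eq] at h
    have hq : 1 / (((1 / 2 : ℝ) : ℂ) + x * I) - 1 / ((-(1 / 2) : ℝ) + x * I) =
        1 / ((x : ℂ) ^ 2 + 1 / 4) := by
      have h3 : (x : ℂ) ^ 2 + 1 / 4 = -(((1 / 2 : ℝ) + x * I) * ((-(1 / 2) : ℝ) + x * I)) := by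
        push_cast
        linear_combination (x : ℂ) ^ 2 * I_sq
      rw [h3, div_neg, div_sub_div _ _ hne' hne, ← neg_div]
      push_cast
      ring
    linear_combination h - hq
  have e1 : (-(1 / 2) + (-(1 / 2) : ℝ) * I : ℂ).re = -(1 / 2) := by simp
  have e2 : (-(1 / 2) + (-(1 / 2) : ℝ) * I : ℂ).im = -(1 / 2) := by simp
  have e3 : (1 / 2 + (1 / 2 : ℝ) * I : ℂ).re = 1 / 2 := by simp
  have e4 : (1 / 2 + (1 / 2 : ℝ) * I : ℂ).im = 1 / 2 := by simp
  rw [e1, e2, e3, e4, smul_eq_mul, smul_eq_mul] at hR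
  linear_combination (hR - h1 - I * h2) / 2

end Legendre

/-! ### Partial derivatives and derivatives along curves -/

section Partial

/-- The partial derivative in the first variable. -/
def pderivFst (F : ℂ × ℂ → ℂ) (p : ℂ × ℂ) : ℂ := fderiv ℂ F p (1, 0)

/-- The partial derivative in the second variable. -/
def pderivSnd (F : ℂ × ℂ → ℂ) (p : ℂ × ℂ) : ℂ := fderiv ℂ F p (0, 1)

variable {F : ℂ × ℂ → ℂ} {p : ℂ × ℂ}

lemma contDiffAt_pderivFst {n : ℕ} (h : ContDiffAt ℂ (n + 1 : ℕ) F p) :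
    ContDiffAt ℂ n (pderivFst F) p :=
  (h.fderiv_right (m := n) (by norm_cast)).clm_apply contDiffAt_const

lemma contDiffAt_pderivSnd {n : ℕ} (h : ContDiffAt ℂ (n + 1 : ℕ) F p) :
    ContDiffAt ℂ n (pderivSnd F) p :=
  (h.fderiv_right (m := n) (by norm_cast)).clm_apply contDiffAt_const

lemma hasDerivAt_curve {δ : ℂ → ℂ} {t d : ℂ} (hF : DifferentiableAt ℂ F (δ t, t))
    (hδ : HasDerivAt δ d t) :
    HasDerivAt (fun s => F (δ s, s)) (pderivFst F (δ t, t) * d + pderivSnd F (δ t, t)) t := by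
  have h1 : HasDerivAt (fun s => (δ s, s)) (d, (1 : ℂ)) t := hδ.prodMk (hasDerivAt_id t)
  have h2 := HasFDerivAt.comp_hasDerivAt (f := fun s => (δ s, s)) t hF.hasFDerivAt h1
  refine h2.congr_deriv ?_
  have h3 : ((d, 1) : ℂ × ℂ) = d • (1, 0) + (0, 1) := by simp
  rw [h3, map_add, map_smul, smul_eq_mul, mul_comm, pderivFst, pderivSnd]

lemma hasDerivAt_pderivSnd {z t : ℂ} (hF : DifferentiableAt ℂ F (z, t)) :
    HasDerivAt (fun s => F (z, s)) (pderivSnd F (z, t)) t := by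
  simpa using hasDerivAt_curve (δ := fun _ => z) hF (hasDerivAt_const t z)

lemma hasDerivAt_pderivFst {z t : ℂ} (hF : DifferentiableAt ℂ F (z, t)) :
    HasDerivAt (fun w => F (w, t)) (pderivFst F (z, t)) z :=
  hF.hasFDerivAt.comp_hasDerivAt z ((hasDerivAt_id z).prodMk (hasDerivAt_const z t))

lemma pderivFst_pderivSnd (h : ContDiffAt ℂ 2 F p) :
    pderivFst (pderivSnd F) p = pderivSnd (pderivFst F) p := by
  have hs := h.isSymmSndFDerivAt (by simp)
  have hd : DifferentiableAt ℂ (fderiv ℂ F) p :=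
    (h.fderiv_right (m := 1) (by norm_num)).differentiableAt (by simp)
  have h1 : ∀ v w, fderiv ℂ (fun q => fderiv ℂ F q v) p w = fderiv ℂ (fderiv ℂ F) p w v := by
    intro v w
    rw [fderiv_clm_apply hd (differentiableAt_const v)]
    simp
  simp only [pderivFst, pderivSnd]
  change fderiv ℂ (fun q => fderiv ℂ F q (0, 1)) p (1, 0) =
    fderiv ℂ (fun q => fderiv ℂ F q (1, 0)) p (0, 1)
  rw [h1, h1]
  exact hs _ _

end Partial

/-! ### Joint holomorphy of zeta, `℘` and `℘'` in `(z, τ)` -/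

section TwoVariables

/-- The lattice points `m τ + n`, as functions of `τ`. -/
def latticePoint (k : Fin 2 → ℤ) (t : ℂ) : ℂ := k 0 * t + k 1

/-- The summands of the regular part of the zeta function, as functions of `(z, τ)`. -/
def zetaTerm (k : Fin 2 → ℤ) (p : ℂ × ℂ) : ℂ :=
  if k = 0 then 0 else 1 / (p.1 - latticePoint k p.2) + 1 / latticePoint k p.2 +
    p.1 / latticePoint k p.2 ^ 2

/-- The regular part `ζ(z) - 1/z` of the zeta function, as a function of `(z, τ)`. -/
def zetaRegPair (p : ℂ × ℂ) : ℂ := ∑' k : Fin 2 → ℤ, zetaTerm k p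

/-- The set of `(z, τ)` such that `z` is not a non-zero lattice point. -/
def regularSet : Set (ℂ × ℂ) := {p | 0 < p.2.im ∧ ∀ k ≠ 0, p.1 ≠ latticePoint k p.2}

/-- The lattice of the periods `(1, τ)` as an indexed family. -/
def latticeEquiv (τ : ℍ) : (Fin 2 → ℤ) ≃ (periods τ).lattice :=
  ((finTwoArrowEquiv ℤ).trans (Equiv.prodComm ℤ ℤ)).trans
    (periods τ).latticeEquivProd.symm.toEquiv

lemma coe_latticeEquiv (τ : ℍ) (k : Fin 2 → ℤ) : (latticeEquiv τ k : ℂ) = latticePoint k τ := by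
  have h := (periods τ).latticeEquiv_symm_apply (k 1, k 0)
  simp only [latticeEquiv, Equiv.trans_apply, finTwoArrowEquiv_apply, Equiv.prodComm_apply]
  refine h.trans ?_
  simp [periods, latticePoint, add_comm]

lemma latticePoint_eq_zero_iff (τ : ℍ) (k : Fin 2 → ℤ) : latticePoint k τ = 0 ↔ k = 0 := by
  have h0 : latticeEquiv τ 0 = 0 := by
    rw [← Subtype.coe_inj, coe_latticeEquiv]
    simp [latticePoint]
  rw [← coe_latticeEquiv, ZeroMemClass.coe_eq_zero, ← h0, (latticeEquiv τ).injective.eq_iff]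

lemma zetaRegPair_coe (τ : ℍ) (z : ℂ) : zetaRegPair (z, τ) = zetaReg (periods τ) z := by
  rw [zetaReg, ← (latticeEquiv τ).tsum_eq, zetaRegPair]
  congr with k
  simp only [zetaTerm, coe_latticeEquiv, latticePoint_eq_zero_iff]

lemma mem_lattice_iff_latticePoint (τ : ℍ) (z : ℂ) :
    z ∈ (periods τ).lattice ↔ ∃ k, latticePoint k τ = z := by
  constructor
  · intro h
    obtain ⟨k, hk⟩ := (latticeEquiv τ).surjective ⟨z, h⟩
    exact ⟨k, by rw [← coe_latticeEquiv, hk]⟩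
  · rintro ⟨k, rfl⟩
    rw [← coe_latticeEquiv]
    exact (latticeEquiv τ k).2

lemma mem_regularSet_iff (τ : ℍ) (z : ℂ) :
    (z, (τ : ℂ)) ∈ regularSet ↔ z ∈ (((periods τ).lattice : Set ℂ) \ {0})ᶜ := by
  simp only [regularSet, mem_ofPred_eq, mem_compl_iff, Set.mem_sdiff, SetLike.mem_coe,
    mem_singleton_iff, mem_lattice_iff_latticePoint, UpperHalfPlane.coe_im, τ.im_pos, true_and]
  constructor
  · rintro h ⟨⟨k, rfl⟩, hz⟩
    exact h k (fun hk => hz ((latticePoint_eq_zero_iff τ k).2 hk)) rfl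
  · rintro h k hk rfl
    exact h ⟨⟨k, rfl⟩, fun h0 => hk ((latticePoint_eq_zero_iff τ k).1 h0)⟩

/-- Near any `(z, τ)` almost all lattice points are large. -/
lemma exists_nhds_lattice_bound {p₀ : ℂ × ℂ} (h : 0 < p₀.2.im) :
    ∃ (W : Set (ℂ × ℂ)) (R c : ℝ) (S : Finset (Fin 2 → ℤ)), IsOpen W ∧ p₀ ∈ W ∧ 0 < c ∧ 0 ∈ S ∧
      (∀ p ∈ W, 0 < p.2.im ∧ ‖p.1‖ < R) ∧
      ∀ k ∉ S, ∀ p ∈ W, 2 * R ≤ ‖latticePoint k p.2‖ ∧ c * ‖k‖ ≤ ‖latticePoint k p.2‖ := by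
  set A := |p₀.2.re| + 1
  set B := p₀.2.im / 2
  set R := ‖p₀.1‖ + 1
  have hB : 0 < B := by positivity
  set c := EisensteinSeries.r ⟨⟨A, B⟩, hB⟩
  have hc : 0 < c := EisensteinSeries.r_pos _
  have hR : 0 < R := by positivity
  have hfin : {k : Fin 2 → ℤ | ‖k‖ < 2 * R / c}.Finite :=
    (isCompact_closedBall (0 : Fin 2 → ℤ) (2 * R / c)).finite_of_discrete.subset
      fun k hk => by simpa using (show ‖k‖ < _ from hk).le
  refine ⟨{p | ‖p.1‖ < R ∧ |p.2.re| < A ∧ B < p.2.im}, R, c, hfin.toFinset, ?_, ?_, hc, ?_, ?_, ?_⟩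
  · exact (isOpen_lt continuous_fst.norm continuous_const).inter
      ((isOpen_lt (Complex.continuous_re.comp continuous_snd).abs continuous_const).inter
      (isOpen_lt continuous_const (Complex.continuous_im.comp continuous_snd)))
  · simp only [mem_ofPred_eq, R, A, B]
    exact ⟨by linarith, by linarith, by linarith⟩
  · simp only [Finite.mem_toFinset, mem_ofPred_eq, norm_zero]
    positivity
  · rintro p ⟨h1, h2, h3⟩
    exact ⟨hB.trans h3, h1⟩
  · rintro k hk p ⟨h1, h2, h3⟩
    simp only [Finite.mem_toFinset, mem_ofPred_eq, not_lt] at hk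
    have hk0 : k ≠ 0 := by
      rintro rfl
      rw [norm_zero] at hk
      exact absurd hk (not_le.2 (by positivity))
    -- The lower bounds of Eisenstein series theory, uniform on a vertical strip, apply to `k 0 * τ
    -- + k 1`; this fixes the order of coordinates in `latticePoint`.
    set τ : ℍ := ⟨p.2, hB.trans h3⟩
    have hτ : τ ∈ UpperHalfPlane.verticalStrip A B := ⟨h2.le, h3.le⟩
    have h4 := EisensteinSeries.r_mul_max_le τ hk0
    have h5 := EisensteinSeries.r_lower_bound_on_verticalStrip τ hB hτ
    have h6 : c * ‖k‖ ≤ ‖latticePoint k p.2‖ :=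
      (mul_le_mul_of_nonneg_right h5 (norm_nonneg k)).trans h4
    rw [div_le_iff₀ hc] at hk
    exact ⟨by linarith, h6⟩

lemma contDiffAt_latticePoint (k : Fin 2 → ℤ) (p : ℂ × ℂ) {n : WithTop ℕ∞} :
    ContDiffAt ℂ n (fun p : ℂ × ℂ => latticePoint k p.2) p := by
  unfold latticePoint
  fun_prop

lemma contDiffAt_zetaTerm {k : Fin 2 → ℤ} {p : ℂ × ℂ} {n : WithTop ℕ∞}
    (hk : k ≠ 0 → latticePoint k p.2 ≠ 0 ∧ p.1 ≠ latticePoint k p.2) :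
    ContDiffAt ℂ n (zetaTerm k) p := by
  by_cases h0 : k = 0
  · have : zetaTerm k = fun _ => 0 := funext fun p => if_pos h0
    rw [this]
    exact contDiffAt_const
  · obtain ⟨h1, h2⟩ := hk h0
    have : zetaTerm k = fun p => 1 / (p.1 - latticePoint k p.2) + 1 / latticePoint k p.2 +
      p.1 / latticePoint k p.2 ^ 2 := funext fun p => if_neg h0
    rw [this]
    have hl := contDiffAt_latticePoint k p (n := n)
    exact ((contDiffAt_const.div (contDiffAt_fst.sub hl) (sub_ne_zero.2 h2)).add
      (contDiffAt_const.div hl h1)).add (contDiffAt_fst.div (hl.pow 2) (pow_ne_zero 2 h1))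

theorem contDiffAt_zetaRegPair {p₀ : ℂ × ℂ} (h : p₀ ∈ regularSet) (n : ℕ) :
    ContDiffAt ℂ n zetaRegPair p₀ := by
  classical
  obtain ⟨W, R, c, S, hW, hpW, hc, h0S, hWR, hS⟩ := exists_nhds_lattice_bound h.1
  have hR : 0 < R := (norm_nonneg _).trans_lt (hWR _ hpW).2
  -- The finitely many terms of `S`, which may have poles in `W`, are split off; the remaining
  -- series is dominated on `W`.
  set g : (Fin 2 → ℤ) → ℂ × ℂ → ℂ := fun k => if k ∈ S then fun _ => 0 else zetaTerm k with hg
  set u : (Fin 2 → ℤ) → ℝ := fun k => 2 * R ^ 2 * c ^ (-3 : ℝ) * ‖k‖ ^ (-3 : ℝ) with hu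
  have hus : Summable u :=
    (EisensteinSeries.summable_one_div_norm_rpow (k := 3) (by norm_num)).mul_left _
  have hgd : ∀ k, ContDiffOn ℂ (⊤ : ℕ∞) (g k) W := by
    intro k
    by_cases hk : k ∈ S
    · simp only [hg, hk, if_true]
      exact contDiffOn_const
    · simp only [hg, hk, if_false]
      intro p hp
      refine (contDiffAt_zetaTerm fun _ => ?_).contDiffWithinAt
      have h1 := (hS k hk p hp).1
      have h2 := (hWR p hp).2
      refine ⟨norm_pos_iff.1 (by linarith), fun h3 => ?_⟩
      rw [← h3] at h1
      linarith
  have hgb : ∀ k, ∀ p ∈ W, ‖g k p‖ ≤ u k := by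
    intro k p hp
    by_cases hk : k ∈ S
    · simp only [hg, hk, if_true, norm_zero, hu]
      positivity
    · have hk0 : k ≠ 0 := fun h => hk (h ▸ h0S)
      simp only [hg, hk, if_false, zetaTerm, hk0]
      obtain ⟨h1, h2⟩ := hS k hk p hp
      refine (norm_zeta_summand_le (hWR p hp).2 h1).trans ?_
      simp only [hu]
      rw [mul_assoc (2 * R ^ 2), ← Real.mul_rpow hc.le (norm_nonneg k)]
      refine mul_le_mul_of_nonneg_left ?_ (by positivity)
      exact Real.rpow_le_rpow_of_nonpos (mul_pos hc (norm_pos_iff.2 hk0)) h2 (by norm_num)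
  have hsum := (contDiffOn_tsum_of_norm_le n hW hus hgd hgb).contDiffAt (hW.mem_nhds hpW)
  have hfin : ContDiffAt ℂ n (fun p => ∑ k ∈ S, zetaTerm k p) p₀ :=
    ContDiffAt.sum fun k _ => contDiffAt_zetaTerm fun hk =>
      ⟨(latticePoint_eq_zero_iff ⟨p₀.2, h.1⟩ k).not.2 hk, h.2 k hk⟩
  refine (hfin.add hsum).congr_of_eventuallyEq ?_
  filter_upwards [hW.mem_nhds hpW] with p hp
  have h1 : HasSum (fun k => g k p) (∑' k, g k p) :=
    (Summable.of_norm_bounded hus fun k => hgb k p hp).hasSum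
  have h2 : HasSum (fun k => if k ∈ S then zetaTerm k p else 0) (∑ k ∈ S, zetaTerm k p) := by
    have h3 : HasSum (fun k => if k ∈ S then zetaTerm k p else 0)
        (∑ k ∈ S, if k ∈ S then zetaTerm k p else 0) :=
      hasSum_sum_of_ne_finset_zero fun k hk => if_neg hk
    rwa [Finset.sum_congr rfl fun k hk => if_pos hk] at h3
  rw [zetaRegPair, ← (h2.add h1).tsum_eq]
  congr with k
  by_cases hk : k ∈ S <;> simp [hg, hk]

/-- The set of `(z, τ)` such that `z` is not a lattice point. -/
def poleFreeSet : Set (ℂ × ℂ) := {p | 0 < p.2.im ∧ ∀ k, p.1 ≠ latticePoint k p.2}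

lemma mem_poleFreeSet_iff (τ : ℍ) (z : ℂ) :
    (z, (τ : ℂ)) ∈ poleFreeSet ↔ z ∉ (periods τ).lattice := by
  simp only [poleFreeSet, mem_ofPred_eq, mem_lattice_iff_latticePoint, UpperHalfPlane.coe_im,
    τ.im_pos, true_and, not_exists, ne_comm (a := z), ne_eq]

lemma isOpen_poleFreeSet : IsOpen poleFreeSet := by
  rw [isOpen_iff_mem_nhds]
  intro p₀ h
  obtain ⟨W, R, c, S, hW, hpW, hc, h0S, hWR, hS⟩ := exists_nhds_lattice_bound h.1
  have h1 : ∀ᶠ p in 𝓝 p₀, ∀ k ∈ S, p.1 ≠ latticePoint k p.2 := by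
    rw [Filter.eventually_all_finset]
    intro k _
    exact continuousAt_fst.ne_iff_eventually_ne
      (contDiffAt_latticePoint k p₀ (n := 0)).continuousAt |>.1 (h.2 k)
  filter_upwards [h1, hW.mem_nhds hpW] with p hp hpW'
  refine ⟨(hWR p hpW').1, fun k => ?_⟩
  by_cases hk : k ∈ S
  · exact hp k hk
  · intro h2
    have h3 := (hS k hk p hpW').1
    have h4 := (hWR p hpW').2
    have h5 := norm_nonneg p.1
    rw [← h2] at h3
    linarith

lemma poleFreeSet_subset : poleFreeSet ⊆ regularSet := fun _ hp => ⟨hp.1, fun k _ => hp.2 k⟩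

lemma fst_ne_zero_of_mem {p : ℂ × ℂ} (hp : p ∈ poleFreeSet) : p.1 ≠ 0 := by
  simpa [latticePoint] using hp.2 0

/-- The zeta function as a function of `(z, τ)`. -/
def zetaPair (p : ℂ × ℂ) : ℂ := p.1⁻¹ + zetaRegPair p

/-- The function `℘` as a function of `(z, τ)`. -/
def wpPair (p : ℂ × ℂ) : ℂ := -pderivFst zetaPair p

/-- The function `℘'` as a function of `(z, τ)`. -/
def wpPair' (p : ℂ × ℂ) : ℂ := pderivFst wpPair p

lemma contDiffAt_zetaPair {p : ℂ × ℂ} (hp : p ∈ poleFreeSet) (n : ℕ) :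
    ContDiffAt ℂ n zetaPair p :=
  (contDiffAt_fst.inv (fst_ne_zero_of_mem hp)).add
    (contDiffAt_zetaRegPair (poleFreeSet_subset hp) n)

lemma contDiffAt_wpPair {p : ℂ × ℂ} (hp : p ∈ poleFreeSet) (n : ℕ) :
    ContDiffAt ℂ n wpPair p :=
  (contDiffAt_pderivFst (contDiffAt_zetaPair hp (n + 1))).neg

lemma contDiffAt_wpPair' {p : ℂ × ℂ} (hp : p ∈ poleFreeSet) (n : ℕ) :
    ContDiffAt ℂ n wpPair' p :=
  contDiffAt_pderivFst (contDiffAt_wpPair hp (n + 1))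

lemma differentiableAt_zetaPair {p : ℂ × ℂ} (hp : p ∈ poleFreeSet) :
    DifferentiableAt ℂ zetaPair p := (contDiffAt_zetaPair hp 1).differentiableAt (by simp)

lemma differentiableAt_wpPair {p : ℂ × ℂ} (hp : p ∈ poleFreeSet) :
    DifferentiableAt ℂ wpPair p := (contDiffAt_wpPair hp 1).differentiableAt (by simp)

lemma differentiableAt_wpPair' {p : ℂ × ℂ} (hp : p ∈ poleFreeSet) :
    DifferentiableAt ℂ wpPair' p := (contDiffAt_wpPair' hp 1).differentiableAt (by simp)

variable (τ : ℍ) {z : ℂ}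

lemma zetaPair_coe (z : ℂ) : zetaPair (z, τ) = weierstrassZeta (periods τ) z := by
  rw [zetaPair, zetaRegPair_coe, weierstrassZeta_eq, one_div]

lemma wpPair_coe (hz : z ∉ (periods τ).lattice) : wpPair (z, τ) = wp τ z := by
  have h1 := hasDerivAt_pderivFst (differentiableAt_zetaPair ((mem_poleFreeSet_iff τ z).2 hz))
  simp only [zetaPair_coe] at h1
  rw [wpPair, h1.unique (hasDerivAt_weierstrassZeta _ hz), neg_neg, wp]

lemma wpPair'_coe (hz : z ∉ (periods τ).lattice) : wpPair' (z, τ) = wp' τ z := by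
  have h1 := hasDerivAt_pderivFst (differentiableAt_wpPair ((mem_poleFreeSet_iff τ z).2 hz))
  refine h1.unique ((hasDerivAt_wp τ hz).congr_of_eventuallyEq ?_)
  filter_upwards [(isOpen_compl_lattice (periods τ)).mem_nhds hz] with w hw
  exact wpPair_coe τ hw

lemma pderivFst_zetaPair (hz : z ∉ (periods τ).lattice) :
    pderivFst zetaPair (z, τ) = -wp τ z := by
  rw [← wpPair_coe τ hz, wpPair, neg_neg]

lemma pderivFst_wpPair (hz : z ∉ (periods τ).lattice) :
    pderivFst wpPair (z, τ) = wp' τ z := wpPair'_coe τ hz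

lemma pderivFst_wpPair' (hz : z ∉ (periods τ).lattice) :
    pderivFst wpPair' (z, τ) = 6 * wp τ z ^ 2 - (periods τ).g₂ / 2 := by
  have h1 := hasDerivAt_pderivFst (differentiableAt_wpPair' ((mem_poleFreeSet_iff τ z).2 hz))
  refine h1.unique ((hasDerivAt_wp' τ hz).congr_of_eventuallyEq ?_)
  filter_upwards [(isOpen_compl_lattice (periods τ)).mem_nhds hz] with w hw
  exact wpPair'_coe τ hw

lemma eventually_curve_mem {δ : ℂ → ℂ} {t : ℂ} (hδ : ContinuousAt δ t)
    (ht : (δ t, t) ∈ poleFreeSet) : ∀ᶠ s in 𝓝 t, (δ s, s) ∈ poleFreeSet :=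
  (hδ.prodMk continuousAt_id).eventually_mem (isOpen_poleFreeSet.mem_nhds ht)

end TwoVariables

/-! ### Legendre's relation for all `τ` -/

section Legendre

lemma half_mem_poleFreeSet (τ : ℍ) : ((1 / 2 : ℂ), (τ : ℂ)) ∈ poleFreeSet :=
  (mem_poleFreeSet_iff τ _).2 (half_notMem_periods τ)

lemma coe_div_two_mem_poleFreeSet (τ : ℍ) : ((τ / 2 : ℂ), (τ : ℂ)) ∈ poleFreeSet :=
  (mem_poleFreeSet_iff τ _).2 (coe_div_two_notMem_periods τ)

/-- Legendre's relation. -/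
theorem legendre (τ : ℍ) : eta₁ τ * τ - eta₃ τ = Real.pi * I := by
  set f : ℂ → ℂ := fun t => zetaPair (1 / 2, t) * t - zetaPair (t / 2, t) with hf
  have hfτ : ∀ τ : ℍ, f τ = eta₁ τ * τ - eta₃ τ := fun τ => by
    simp only [hf, zetaPair_coe, eta₁, eta₃]
  set U : Set ℂ := {t | 0 < t.im}
  have hU : IsOpen U := isOpen_lt continuous_const Complex.continuous_im
  have hd : ∀ τ : ℍ, DifferentiableAt ℂ f τ := by
    intro τ
    have h1 := (hasDerivAt_pderivSnd
      (differentiableAt_zetaPair (half_mem_poleFreeSet τ))).differentiableAt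
    have h2 := (hasDerivAt_curve (δ := fun t => t / 2)
      (differentiableAt_zetaPair (coe_div_two_mem_poleFreeSet τ))
      ((hasDerivAt_id (τ : ℂ)).div_const 2)).differentiableAt
    exact (h1.mul differentiableAt_id).sub h2
  -- Since `exp (2f) = 1` on the whole half plane, `f` is locally constant, and the value at `τ = i`
  -- determines it.
  have h0 : ∀ τ : ℍ, deriv f τ = 0 := by
    intro τ
    have h1 : HasDerivAt (fun t => exp (2 * f t)) (exp (2 * f τ) * (2 * deriv f τ)) τ :=
      ((hd τ).hasDerivAt.const_mul 2).cexp
    have h2 := (h1.congr_of_eventuallyEq (f₁ := fun _ => 1) (by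
      filter_upwards [hU.mem_nhds τ.im_pos] with t ht
      have := exp_legendre ⟨t, ht⟩
      rw [← hfτ] at this
      exact this.symm)).unique (hasDerivAt_const _ _)
    simpa [exp_ne_zero] using h2
  have hconst := hU.is_const_of_deriv_eq_zero (convex_halfSpace_im_gt 0).isPreconnected (f := f)
    (fun t ht => (hd ⟨t, ht⟩).differentiableWithinAt) (fun t ht => h0 ⟨t, ht⟩)
    (show (τ : ℂ) ∈ U from τ.im_pos) (show (UpperHalfPlane.I : ℂ) ∈ U from UpperHalfPlane.I.im_pos)
  rw [← hfτ, hconst, hfτ, UpperHalfPlane.coe_I, legendre_I]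

end Legendre

/-! ### The heat equation -/

section Heat

variable (τ : ℍ) {z : ℂ}

/-- The `τ`-derivative of `η₁`. -/
def derivEta₁ : ℂ := pderivSnd zetaPair (1 / 2, τ)

lemma hasDerivAt_eta₁ : HasDerivAt (fun t => zetaPair (1 / 2, t)) (derivEta₁ τ) τ :=
  hasDerivAt_pderivSnd (differentiableAt_zetaPair (half_mem_poleFreeSet τ))

lemma pderivSnd_zetaRegPair (hz : z ∉ (periods τ).lattice) :
    pderivSnd zetaRegPair (z, τ) = pderivSnd zetaPair (z, τ) := by
  have hp := (mem_poleFreeSet_iff τ z).2 hz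
  have h1 := hasDerivAt_pderivSnd ((contDiffAt_zetaRegPair
    (poleFreeSet_subset hp) 1).differentiableAt (by simp))
  exact (h1.const_add z⁻¹).unique (hasDerivAt_pderivSnd (differentiableAt_zetaPair hp))

lemma eventually_coe_mem {δ : ℂ → ℂ} (hδ : ContinuousAt δ τ) (h : δ τ ∉ (periods τ).lattice) :
    ∀ᶠ t in 𝓝 (τ : ℂ), ∃ τ' : ℍ, (τ' : ℂ) = t ∧ δ t ∉ (periods τ').lattice := by
  filter_upwards [eventually_curve_mem hδ ((mem_poleFreeSet_iff τ _).2 h)] with t ht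
  exact ⟨⟨t, ht.1⟩, rfl, (mem_poleFreeSet_iff ⟨t, ht.1⟩ _).1 ht⟩

lemma pderivSnd_zetaPair_add_one (hz : z ∉ (periods τ).lattice) :
    pderivSnd zetaPair (z + 1, τ) = pderivSnd zetaPair (z, τ) + 2 * derivEta₁ τ := by
  have hz1 := (add_mem_lattice_iff _ (one_mem_periods τ)).not.2 hz
  have h1 := hasDerivAt_pderivSnd (differentiableAt_zetaPair ((mem_poleFreeSet_iff τ _).2 hz1))
  have h2 := (hasDerivAt_pderivSnd (differentiableAt_zetaPair
    ((mem_poleFreeSet_iff τ _).2 hz))).fun_add ((hasDerivAt_eta₁ τ).const_mul 2)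
  refine h1.unique (h2.congr_of_eventuallyEq ?_)
  filter_upwards [eventually_coe_mem τ (δ := fun _ => z) continuousAt_const hz] with t ht
  obtain ⟨τ', rfl, ht⟩ := ht
  simp only [zetaPair_coe]
  exact weierstrassZeta_add_one τ' ht

lemma pderivSnd_zetaPair_add_coe (hz : z ∉ (periods τ).lattice) :
    pderivSnd zetaPair (z + τ, τ) = pderivSnd zetaPair (z, τ) + wp τ z + 2 * derivEta₁ τ * τ +
      2 * eta₁ τ := by
  have hz1 := (add_mem_lattice_iff _ (coe_mem_periods τ)).not.2 hz
  have h1 := hasDerivAt_curve (δ := fun t => z + t)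
    (differentiableAt_zetaPair ((mem_poleFreeSet_iff τ _).2 hz1))
    ((hasDerivAt_id (τ : ℂ)).const_add z)
  have h2 := (hasDerivAt_pderivSnd (differentiableAt_zetaPair
    ((mem_poleFreeSet_iff τ _).2 hz))).fun_add ((((hasDerivAt_eta₁ τ).fun_mul
      (hasDerivAt_id (τ : ℂ))).sub_const (Real.pi * I)).const_mul 2)
  have h3 := h1.unique (h2.congr_of_eventuallyEq (by
    filter_upwards [eventually_coe_mem τ (δ := fun _ => z) continuousAt_const hz] with t ht
    obtain ⟨τ', rfl, ht⟩ := ht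
    simp only [zetaPair_coe, id]
    rw [weierstrassZeta_add_coe τ' ht, ← legendre τ', eta₁]
    ring))
  rw [pderivFst_zetaPair τ hz1, show wp τ (z + τ) = wp τ z from
    weierstrassP_add _ (coe_mem_periods τ), zetaPair_coe] at h3
  simp only [id, eta₁] at h3 ⊢
  linear_combination h3

/-- The defect in the heat equation for the logarithmic derivative of the theta function. -/
def heatDefect (z : ℂ) : ℂ :=
  4 * Real.pi * I * (pderivSnd zetaPair (z, τ) - 2 * derivEta₁ τ * z) + wp' τ z +
    2 * (weierstrassZeta (periods τ) z - 2 * eta₁ τ * z) * (wp τ z + 2 * eta₁ τ)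

/-- Zeta picks up `2η₃` under the period `τ` while `2η₁z` picks up `2η₁τ`; by Legendre's relation
the difference is the constant `-2πi`. It balances the term `℘ + 2η₁` that arises because the period
itself moves with `τ`. -/
lemma heatDefect_add (l : ℂ) (hl : l ∈ (periods τ).lattice) (hz : z ∉ (periods τ).lattice) :
    heatDefect τ (z + l) = heatDefect τ z := by
  refine periodic_of_generators (periods τ) (f := heatDefect τ) ?_ ?_ l hl z hz
  · intro z hz
    change heatDefect τ (z + 1) = _
    simp only [heatDefect, wp, wp']
    rw [pderivSnd_zetaPair_add_one τ hz, derivWeierstrassP_add _ (one_mem_periods τ),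
      weierstrassP_add _ (one_mem_periods τ), weierstrassZeta_add_one τ hz]
    ring
  · intro z hz
    change heatDefect τ (z + τ) = _
    simp only [heatDefect]
    rw [pderivSnd_zetaPair_add_coe τ hz, weierstrassZeta_add_coe τ hz]
    simp only [wp, wp']
    rw [derivWeierstrassP_add _ (coe_mem_periods τ), weierstrassP_add _ (coe_mem_periods τ)]
    linear_combination (-4 * ((periods τ).weierstrassP z + 2 * eta₁ τ)) * legendre τ

lemma differentiableAt_pderivSnd_zetaRegPair (hz : (z, (τ : ℂ)) ∈ regularSet) :
    DifferentiableAt ℂ (fun w => pderivSnd zetaRegPair (w, τ)) z :=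
  (hasDerivAt_pderivFst ((contDiffAt_pderivSnd (n := 1)
    (contDiffAt_zetaRegPair hz 2)).differentiableAt (by simp))).differentiableAt

lemma differentiableAt_pderivSnd_zetaPair (hz : z ∉ (periods τ).lattice) :
    DifferentiableAt ℂ (fun w => pderivSnd zetaPair (w, τ)) z :=
  (hasDerivAt_pderivFst ((contDiffAt_pderivSnd (n := 1)
    (contDiffAt_zetaPair ((mem_poleFreeSet_iff τ z).2 hz) 2)).differentiableAt
      (by simp))).differentiableAt

lemma differentiableAt_heatDefect (hz : z ∉ (periods τ).lattice) :
    DifferentiableAt ℂ (heatDefect τ) z := by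
  have h1 := differentiableAt_pderivSnd_zetaPair τ hz
  have h2 := (hasDerivAt_wp' τ hz).differentiableAt
  have h3 := (hasDerivAt_wp τ hz).differentiableAt
  have h4 := (hasDerivAt_weierstrassZeta (periods τ) hz).differentiableAt
  unfold heatDefect
  fun_prop

lemma derivWeierstrassPExcept_zero_eq (L : PeriodPair) (z : ℂ) :
    L.derivWeierstrassPExcept 0 z = L.derivWeierstrassP z + 2 / z ^ 3 := by
  have := L.derivWeierstrassPExcept_def 0 z
  simpa [sub_eq_add_neg] using this

/-- The poles `-2/z³` of `℘'` and `2/z³` of `2ζ℘` cancel, and so do the terms `±4η₁/z`. The function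
`g`, together with twice `zetaReg(w)/w`, is the product rewritten in regular parts. -/
lemma tendsto_mul_heatDefect : Tendsto (fun z => z * heatDefect τ z) (𝓝[≠] 0) (𝓝 0) := by
  set L := periods τ
  have hreg : ((0 : ℂ), (τ : ℂ)) ∈ regularSet := (mem_regularSet_iff τ 0).2 (by simp)
  have c1 : ContinuousAt (fun w => pderivSnd zetaRegPair (w, τ)) 0 :=
    (differentiableAt_pderivSnd_zetaRegPair τ hreg).continuousAt
  have hz0 : HasDerivAt (zetaReg L) 0 0 := by
    have h := hasDerivAt_zetaReg L (z := 0) (by simp)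
    simpa using h
  have c2 : ContinuousAt (zetaReg L) 0 := hz0.continuousAt
  have c3 : ContinuousAt (L.weierstrassPExcept 0) 0 :=
    (L.analyticAt_weierstrassPExcept 0).continuousAt
  have c4 : ContinuousAt (L.derivWeierstrassPExcept 0) 0 :=
    (L.analyticAt_derivWeierstrassPExcept 0).continuousAt
  have h1 : Tendsto (fun w => w⁻¹ * zetaReg L w) (𝓝[≠] 0) (𝓝 0) := by
    rw [hasDerivAt_iff_tendsto_slope_zero] at hz0
    refine hz0.congr fun w => ?_
    rw [zero_add, zetaReg_zero, sub_zero, smul_eq_mul]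
  set g : ℂ → ℂ := fun w => w * (4 * Real.pi * I * (pderivSnd zetaRegPair (w, τ) -
    2 * derivEta₁ τ * w) + L.derivWeierstrassPExcept 0 w) - 4 * eta₁ τ +
    2 * (1 + w * zetaReg L w - 2 * eta₁ τ * w ^ 2) * (L.weierstrassPExcept 0 w + 2 * eta₁ τ)
    with hg
  have c5 : ContinuousAt g 0 := by fun_prop
  have hg0 : g 0 = 0 := by
    simp [hg]
    ring
  have h2 := (c5.tendsto.mono_left (nhdsWithin_le_nhds (s := {0}ᶜ))).add (h1.const_mul 2)
  rw [hg0, mul_zero, add_zero] at h2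
  refine h2.congr' ?_
  filter_upwards [eventually_notMem_lattice L] with w hw
  have hw0 := ne_zero_of_notMem L hw
  simp only [hg, heatDefect]
  rw [pderivSnd_zetaRegPair τ hw, weierstrassPExcept_zero_eq, derivWeierstrassPExcept_zero_eq,
    weierstrassZeta_eq, wp, wp']
  field_simp
  ring

/-- The heat equation, in terms of the zeta function. -/
theorem heat_zeta (hz : z ∉ (periods τ).lattice) :
    4 * Real.pi * I * (pderivSnd zetaPair (z, τ) - 2 * derivEta₁ τ * z) =
      -(wp' τ z + 2 * (weierstrassZeta (periods τ) z - 2 * eta₁ τ * z) *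
        (wp τ z + 2 * eta₁ τ)) := by
  have h := elliptic_eq_of_mul_tendsto_zero (periods τ) (f := heatDefect τ)
    (fun z hz => differentiableAt_heatDefect τ hz) (fun l hl z hz => heatDefect_add τ l hl hz)
    (tendsto_mul_heatDefect τ) hz (half_notMem_periods τ)
  -- At `z = 1/2` each of the three parts of the defect vanishes, which identifies the constant as
  -- zero.
  have h0 : wp' τ (1 / 2) = 0 := derivWeierstrassP_half _ (by simpa using one_mem_periods τ)
  have h1 : heatDefect τ (1 / 2) = 0 := by
    rw [heatDefect, h0, ← eta₁, derivEta₁]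
    ring
  rw [h1, heatDefect] at h
  linear_combination h

/-- The heat equation, in terms of `℘`. -/
theorem heat_wp (hz : z ∉ (periods τ).lattice) :
    4 * Real.pi * I * (pderivSnd wpPair (z, τ) + 2 * derivEta₁ τ) =
      6 * wp τ z ^ 2 - (periods τ).g₂ / 2 - 2 * (wp τ z + 2 * eta₁ τ) ^ 2 +
        2 * (weierstrassZeta (periods τ) z - 2 * eta₁ τ * z) * wp' τ z := by
  have hp := (mem_poleFreeSet_iff τ z).2 hz
  have h1 := hasDerivAt_pderivFst ((contDiffAt_pderivSnd (n := 1)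
    (contDiffAt_zetaPair hp 2)).differentiableAt (by simp))
  have h1' := (h1.fun_sub ((hasDerivAt_id z).const_mul (2 * derivEta₁ τ))).const_mul
    (4 * Real.pi * I)
  have h2 := ((hasDerivAt_wp' τ hz).fun_add ((((hasDerivAt_weierstrassZeta (periods τ) hz).fun_sub
    ((hasDerivAt_id z).const_mul (2 * eta₁ τ))).const_mul 2).fun_mul
    ((hasDerivAt_wp τ hz).add_const (2 * eta₁ τ)))).fun_neg
  have h3 := h1'.unique (h2.congr_of_eventuallyEq (by
    filter_upwards [(isOpen_compl_lattice (periods τ)).mem_nhds hz] with w hw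
    exact heat_zeta τ hw))
  have h4 : pderivFst (pderivSnd zetaPair) (z, τ) = -pderivSnd wpPair (z, τ) := by
    rw [pderivFst_pderivSnd (contDiffAt_zetaPair hp 2)]
    have h5 : pderivFst zetaPair = fun p => -wpPair p := funext fun p => by rw [wpPair, neg_neg]
    rw [h5, pderivSnd, fderiv_fun_neg]
    rfl
  rw [h4] at h3
  simp only [id] at h3
  change _ = -(6 * wp τ z ^ 2 - (periods τ).g₂ / 2 + (2 * (-wp τ z - 2 * eta₁ τ * 1) *
    (wp τ z + 2 * eta₁ τ) + _)) at h3
  linear_combination -h3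

/-- The heat equation, in terms of `℘'`. -/
theorem heat_wp' (hz : z ∉ (periods τ).lattice) :
    4 * Real.pi * I * pderivSnd wpPair' (z, τ) =
      wp' τ z * (6 * wp τ z - 12 * eta₁ τ) +
        2 * (weierstrassZeta (periods τ) z - 2 * eta₁ τ * z) *
          (6 * wp τ z ^ 2 - (periods τ).g₂ / 2) := by
  have hp := (mem_poleFreeSet_iff τ z).2 hz
  have h1 := ((hasDerivAt_pderivFst ((contDiffAt_pderivSnd (n := 1)
    (contDiffAt_wpPair hp 2)).differentiableAt (by simp))).add_const (2 * derivEta₁ τ)).const_mul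
    (4 * Real.pi * I)
  have hP := hasDerivAt_wp τ hz
  have h2 := ((((hP.fun_pow 2).const_mul 6).sub_const ((periods τ).g₂ / 2)).fun_sub
    (((hP.add_const (2 * eta₁ τ)).fun_pow 2).const_mul 2)).fun_add
    ((((hasDerivAt_weierstrassZeta (periods τ) hz).fun_sub
    ((hasDerivAt_id z).const_mul (2 * eta₁ τ))).const_mul 2).fun_mul (hasDerivAt_wp' τ hz))
  have h3 := h1.unique (h2.congr_of_eventuallyEq (by
    filter_upwards [(isOpen_compl_lattice (periods τ)).mem_nhds hz] with w hw
    exact heat_wp τ hw))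
  rw [pderivFst_pderivSnd (contDiffAt_wpPair hp 2)] at h3
  simp only [id] at h3
  change 4 * Real.pi * I * pderivSnd wpPair' (z, τ) = _ at h3
  rw [h3]
  change _ + (2 * (-wp τ z - _) * _ + _) = _
  norm_num
  ring

end Heat

/-! ### Derivatives along curves and of the modular quantities -/

section Curves

variable {τ : ℍ} {δ : ℂ → ℂ} {d : ℂ}

/-- `ζ(δ) - 2η₁δ + 2πi δ'`. -/
def curveKappa (τ : ℍ) (z d : ℂ) : ℂ :=
  weierstrassZeta (periods τ) z - 2 * eta₁ τ * z + 2 * Real.pi * I * d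

lemma four_pi_I_ne_zero : (4 * Real.pi * I : ℂ) ≠ 0 := by
  simp [Real.pi_ne_zero]

lemma eq_div_four_pi_I {a b : ℂ} (h : 4 * Real.pi * I * a = b) : a = b / (4 * Real.pi * I) := by
  rw [eq_div_iff four_pi_I_ne_zero, ← h]
  ring

/-- The chain rule term with `δ'` has the same coefficient, up to `2πi`, as `ζ(δ) - 2η₁δ` in the
heat equation. Hence both enter only through `curveKappa`, here and for `℘` and `℘'`. -/
lemma hasDerivAt_zeta_curve (hδ : HasDerivAt δ d τ) (h : δ τ ∉ (periods τ).lattice) :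
    HasDerivAt (fun t => zetaPair (δ t, t) - 2 * zetaPair (1 / 2, t) * δ t)
      (-(wp' τ (δ τ) + 2 * curveKappa τ (δ τ) d * (wp τ (δ τ) + 2 * eta₁ τ)) /
        (4 * Real.pi * I)) τ := by
  have h1 := (hasDerivAt_curve (differentiableAt_zetaPair ((mem_poleFreeSet_iff τ _).2 h))
    hδ).fun_sub (((hasDerivAt_eta₁ τ).const_mul 2).fun_mul hδ)
  refine h1.congr_deriv (eq_div_four_pi_I ?_)
  have h2 := heat_zeta τ h
  rw [pderivFst_zetaPair τ h, zetaPair_coe, ← eta₁, curveKappa]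
  linear_combination h2

lemma hasDerivAt_wp_add_curve (hδ : HasDerivAt δ d τ) (h : δ τ ∉ (periods τ).lattice) :
    HasDerivAt (fun t => wpPair (δ t, t))
      ((6 * wp τ (δ τ) ^ 2 - (periods τ).g₂ / 2 - 2 * (wp τ (δ τ) + 2 * eta₁ τ) ^ 2 +
        2 * curveKappa τ (δ τ) d * wp' τ (δ τ)) / (4 * Real.pi * I) - 2 * derivEta₁ τ) τ := by
  have h1 := hasDerivAt_curve (differentiableAt_wpPair ((mem_poleFreeSet_iff τ _).2 h)) hδ
  refine h1.congr_deriv ?_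
  rw [eq_sub_iff_add_eq]
  refine eq_div_four_pi_I ?_
  have h2 := heat_wp τ h
  rw [pderivFst_wpPair τ h, curveKappa]
  linear_combination h2

lemma hasDerivAt_wp'_curve (hδ : HasDerivAt δ d τ) (h : δ τ ∉ (periods τ).lattice) :
    HasDerivAt (fun t => wpPair' (δ t, t))
      ((wp' τ (δ τ) * (6 * wp τ (δ τ) - 12 * eta₁ τ) +
        2 * curveKappa τ (δ τ) d * (6 * wp τ (δ τ) ^ 2 - (periods τ).g₂ / 2)) /
        (4 * Real.pi * I)) τ := by
  have h1 := hasDerivAt_curve (differentiableAt_wpPair' ((mem_poleFreeSet_iff τ _).2 h)) hδ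
  refine h1.congr_deriv (eq_div_four_pi_I ?_)
  have h2 := heat_wp' τ h
  rw [pderivFst_wpPair' τ h, curveKappa]
  linear_combination h2

/-- The half periods as functions of `τ`. -/
def halfPeriodFun (i : Fin 3) (t : ℂ) : ℂ := ![1 / 2, -(1 / 2) - t / 2, t / 2] i

/-- The derivatives of the half periods. -/
def halfPeriodSlope (i : Fin 3) : ℂ := ![0, -(1 / 2), 1 / 2] i

lemma hasDerivAt_halfPeriodFun (i : Fin 3) (t : ℂ) :
    HasDerivAt (halfPeriodFun i) (halfPeriodSlope i) t := by
  have h := (hasDerivAt_id t).div_const 2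
  fin_cases i
  · exact hasDerivAt_const t _
  · refine (h.const_sub (-(1 / 2))).congr_deriv ?_
    simp [halfPeriodSlope]
  · exact h

lemma zeta_halfPeriod_one (τ : ℍ) :
    weierstrassZeta (periods τ) (-(1 / 2) - τ / 2) = -eta₁ τ - eta₃ τ := by
  have hmem : (1 / 2 - τ / 2 : ℂ) ∉ (periods τ).lattice := by
    have h := (rat_mem_periods τ (1 / 2) (-(1 / 2))).not.2 (by norm_num)
    convert h using 2
    push_cast
    ring
  have hmem' : (-(1 / 2) - τ / 2 : ℂ) ∉ (periods τ).lattice := halfPeriod_notMem τ 1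
  have h1 := weierstrassZeta_add_one τ hmem'
  have h2 := weierstrassZeta_add_coe τ hmem'
  have h3 := weierstrassZeta_neg (periods τ) (1 / 2 - τ / 2)
  rw [show (-(1 / 2) - τ / 2 + 1 : ℂ) = 1 / 2 - τ / 2 by ring] at h1
  rw [show (-(1 / 2) - τ / 2 + τ : ℂ) = -(1 / 2 - τ / 2) by ring, h3, h1] at h2
  linear_combination -h2 / 2

/-- By Legendre's relation the half periods are curves with vanishing `curveKappa`, so the
`τ`-derivatives of the `eᵢ` contain no zeta values except `η₁`. -/
lemma curveKappa_halfPeriod (τ : ℍ) (i : Fin 3) :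
    curveKappa τ (halfPeriod τ i) (halfPeriodSlope i) = 0 := by
  have hl := legendre τ
  have h1 := zeta_halfPeriod_one τ
  fin_cases i <;> simp only [halfPeriod, halfPeriodSlope, curveKappa, Fin.zero_eta, Fin.mk_one,
    Fin.reduceFinMk, Matrix.cons_val]
  · rw [eta₁]
    ring
  · linear_combination h1 + hl
  · rw [← eta₃]
    linear_combination -hl

/-- The `eᵢ` as functions of `τ`. -/
def ePair (i : Fin 3) (t : ℂ) : ℂ := wpPair (halfPeriodFun i t, t)

lemma ePair_coe (τ : ℍ) (i : Fin 3) : ePair i τ = e τ i :=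
  wpPair_coe τ (halfPeriod_notMem τ i)

lemma hasDerivAt_ePair_aux (τ : ℍ) (i : Fin 3) : HasDerivAt (ePair i)
    ((6 * e τ i ^ 2 - (periods τ).g₂ / 2 - 2 * (e τ i + 2 * eta₁ τ) ^ 2) / (4 * Real.pi * I) -
      2 * derivEta₁ τ) τ := by
  have h := hasDerivAt_wp_add_curve (hasDerivAt_halfPeriodFun i τ) (halfPeriod_notMem τ i)
  refine h.congr_deriv ?_
  have h1 : curveKappa τ (halfPeriodFun i τ) (halfPeriodSlope i) = 0 := curveKappa_halfPeriod τ i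
  rw [h1]
  change (6 * e τ i ^ 2 - _ - 2 * (e τ i + _) ^ 2 + _) / _ - _ = _
  ring

/-- The relation `e₁ + e₂ + e₃ = 0` is differentiated in `τ`; the derivative of `η₁` is the only
unknown. -/
lemma derivEta₁_eq (τ : ℍ) :
    derivEta₁ τ = ((periods τ).g₂ / 12 - 4 * eta₁ τ ^ 2) / (4 * Real.pi * I) := by
  have h := ((hasDerivAt_ePair_aux τ 0).fun_add (hasDerivAt_ePair_aux τ 1)).fun_add
    (hasDerivAt_ePair_aux τ 2)
  have h0 := h.unique ((hasDerivAt_const (τ : ℂ) (0 : ℂ)).congr_of_eventuallyEq (by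
    filter_upwards [(isOpen_lt continuous_const Complex.continuous_im).mem_nhds
      (show (0 : ℝ) < (τ : ℂ).im from τ.im_pos)] with t ht
    have := sum_e ⟨t, ht⟩
    simpa only [← ePair_coe] using this))
  refine eq_div_four_pi_I ?_
  have h2 : e τ 2 = -e τ 0 - e τ 1 := by linear_combination sum_e τ
  have hc := four_pi_I_ne_zero
  rw [h2, g₂_eq] at h0
  rw [g₂_eq]
  generalize (4 * Real.pi * I : ℂ) = c at *
  field_simp at h0
  linear_combination -h0 / 12

lemma hasDerivAt_wp_curve (hδ : HasDerivAt δ d τ) (h : δ τ ∉ (periods τ).lattice) :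
    HasDerivAt (fun t => wpPair (δ t, t))
      ((4 * wp τ (δ τ) ^ 2 - 8 * wp τ (δ τ) * eta₁ τ - 2 * (periods τ).g₂ / 3 +
        2 * curveKappa τ (δ τ) d * wp' τ (δ τ)) / (4 * Real.pi * I)) τ := by
  refine (hasDerivAt_wp_add_curve hδ h).congr_deriv ?_
  rw [derivEta₁_eq]
  ring

lemma hasDerivAt_ePair (τ : ℍ) (i : Fin 3) : HasDerivAt (ePair i)
    ((4 * e τ i ^ 2 - 8 * e τ i * eta₁ τ - 2 * (periods τ).g₂ / 3) / (4 * Real.pi * I)) τ := by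
  refine (hasDerivAt_ePair_aux τ i).congr_deriv ?_
  rw [derivEta₁_eq]
  ring

/-- The invariant `g₂` as a function of `τ`. -/
def g₂Fun (t : ℂ) : ℂ := 4 * (ePair 0 t ^ 2 + ePair 0 t * ePair 1 t + ePair 1 t ^ 2)

lemma g₂Fun_coe (τ : ℍ) : g₂Fun τ = (periods τ).g₂ := by
  rw [g₂_eq, g₂Fun, ePair_coe, ePair_coe]

lemma hasDerivAt_g₂Fun (τ : ℍ) : HasDerivAt g₂Fun
    ((12 * (periods τ).g₃ - 16 * (periods τ).g₂ * eta₁ τ) / (4 * Real.pi * I)) τ := by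
  have h0 := hasDerivAt_ePair τ 0
  have h1 := hasDerivAt_ePair τ 1
  have h := (((h0.fun_pow 2).fun_add (h0.fun_mul h1)).fun_add (h1.fun_pow 2)).const_mul 4
  refine h.congr_deriv ?_
  have h2 : e τ 2 = -e τ 0 - e τ 1 := by linear_combination sum_e τ
  rw [ePair_coe, ePair_coe, g₃_eq, g₂_eq, h2]
  norm_num
  ring

end Curves

/-! ### The function `b₁` and its differential equation -/

section Hitchin

variable (C₁ C₃ : ℂ)

/-- `ω` as a function of `τ`. -/
def omegaFun (t : ℂ) : ℂ := C₁ * (t / 2) - C₃ * (1 / 2)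

/-- `ζ(ω) - η` as a function of `τ`. -/
def kappaFun (t : ℂ) : ℂ := zetaPair (omegaFun C₁ C₃ t, t) -
  2 * zetaPair (1 / 2, t) * omegaFun C₁ C₃ t + Real.pi * I * C₁

/-- `b₁` as a function of `τ`. -/
def b₁Fun (t : ℂ) : ℂ := wpPair (omegaFun C₁ C₃ t, t) +
  wpPair' (omegaFun C₁ C₃ t, t) / (2 * kappaFun C₁ C₃ t)

variable (τ : ℍ)

lemma omegaFun_coe : omegaFun C₁ C₃ τ = omega C₁ C₃ τ := rfl

lemma eta_eq : eta C₁ C₃ τ = 2 * eta₁ τ * omega C₁ C₃ τ - Real.pi * I * C₁ := by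
  rw [eta, omega]
  linear_combination -C₁ * legendre τ

lemma kappaFun_coe : kappaFun C₁ C₃ τ = kappa C₁ C₃ τ := by
  rw [kappaFun, omegaFun_coe, zetaPair_coe, zetaPair_coe, kappa, eta_eq, eta₁]
  ring

/-- The slope of `ω` is `C₁/2`, so its contribution `πi C₁` is what Legendre's relation leaves of
`2η₁ω - η`. -/
lemma curveKappa_omega : curveKappa τ (omega C₁ C₃ τ) (C₁ / 2) = kappa C₁ C₃ τ := by
  rw [curveKappa, kappa, eta_eq]
  ring

variable {C₁ C₃ τ}

lemma b₁Fun_coe (hω : omega C₁ C₃ τ ∉ (periods τ).lattice) : b₁Fun C₁ C₃ τ = b₁ C₁ C₃ τ := by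
  rw [b₁Fun, kappaFun_coe, omegaFun_coe, wpPair_coe τ hω, wpPair'_coe τ hω, b₁]

lemma hasDerivAt_omegaFun (t : ℂ) : HasDerivAt (omegaFun C₁ C₃) (C₁ / 2) t := by
  refine ((((hasDerivAt_id t).div_const 2).const_mul C₁).sub_const (C₃ * (1 / 2))).congr_deriv ?_
  ring

lemma contDiffAt_omegaFun {n : WithTop ℕ∞} (t : ℂ) : ContDiffAt ℂ n (omegaFun C₁ C₃) t := by
  unfold omegaFun
  fun_prop

lemma omega_mem_poleFreeSet (hω : omega C₁ C₃ τ ∉ (periods τ).lattice) :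
    (omegaFun C₁ C₃ τ, (τ : ℂ)) ∈ poleFreeSet := (mem_poleFreeSet_iff τ _).2 hω

lemma contDiffAt_comp_curve {F : ℂ × ℂ → ℂ} {δ : ℂ → ℂ} {t : ℂ} {n : WithTop ℕ∞}
    (hF : ContDiffAt ℂ n F (δ t, t)) (hδ : ContDiffAt ℂ n δ t) :
    ContDiffAt ℂ n (fun s => F (δ s, s)) t :=
  ContDiffAt.comp (f := fun s => (δ s, s)) t hF (hδ.prodMk contDiffAt_id)

lemma contDiffAt_kappaFun (hω : omega C₁ C₃ τ ∉ (periods τ).lattice) (n : ℕ) :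
    ContDiffAt ℂ n (kappaFun C₁ C₃) τ :=
  ((contDiffAt_comp_curve (contDiffAt_zetaPair (omega_mem_poleFreeSet hω) n)
    (contDiffAt_omegaFun _)).sub ((contDiffAt_const.mul (contDiffAt_comp_curve (δ := fun _ => 1 / 2)
      (contDiffAt_zetaPair (half_mem_poleFreeSet τ) n) contDiffAt_const)).mul
      (contDiffAt_omegaFun _))).add contDiffAt_const

lemma contDiffAt_b₁Fun (hω : omega C₁ C₃ τ ∉ (periods τ).lattice) (hK : kappa C₁ C₃ τ ≠ 0) (n : ℕ) :
    ContDiffAt ℂ n (b₁Fun C₁ C₃) τ :=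
  (contDiffAt_comp_curve (contDiffAt_wpPair (omega_mem_poleFreeSet hω) n)
    (contDiffAt_omegaFun _)).add ((contDiffAt_comp_curve
    (contDiffAt_wpPair' (omega_mem_poleFreeSet hω) n) (contDiffAt_omegaFun _)).div
    (contDiffAt_const.mul (contDiffAt_kappaFun hω n))
    (by rw [kappaFun_coe]; exact mul_ne_zero two_ne_zero hK))

lemma hasDerivAt_kappaFun (hω : omega C₁ C₃ τ ∉ (periods τ).lattice) :
    HasDerivAt (kappaFun C₁ C₃) (-(wp' τ (omega C₁ C₃ τ) + 2 * kappa C₁ C₃ τ *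
      (wp τ (omega C₁ C₃ τ) + 2 * eta₁ τ)) / (4 * Real.pi * I)) τ := by
  have h := (hasDerivAt_zeta_curve (hasDerivAt_omegaFun (C₁ := C₁) (C₃ := C₃) τ) hω).add_const
    (Real.pi * I * C₁)
  rwa [omegaFun_coe, curveKappa_omega] at h

lemma hasDerivAt_wp_omega (hω : omega C₁ C₃ τ ∉ (periods τ).lattice) :
    HasDerivAt (fun t => wpPair (omegaFun C₁ C₃ t, t))
      ((4 * wp τ (omega C₁ C₃ τ) ^ 2 - 8 * wp τ (omega C₁ C₃ τ) * eta₁ τ -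
        2 * (periods τ).g₂ / 3 + 2 * kappa C₁ C₃ τ * wp' τ (omega C₁ C₃ τ)) /
          (4 * Real.pi * I)) τ := by
  have h := hasDerivAt_wp_curve (hasDerivAt_omegaFun (C₁ := C₁) (C₃ := C₃) τ) hω
  rwa [omegaFun_coe, curveKappa_omega] at h

lemma b₁_sub_wp : b₁ C₁ C₃ τ - wp τ (omega C₁ C₃ τ) =
    wp' τ (omega C₁ C₃ τ) / (2 * kappa C₁ C₃ τ) := by
  rw [b₁]
  ring

lemma two_kappa_mul_wp' (hK : kappa C₁ C₃ τ ≠ 0) (hP : wp' τ (omega C₁ C₃ τ) ≠ 0) :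
    2 * kappa C₁ C₃ τ * wp' τ (omega C₁ C₃ τ) =
      wp' τ (omega C₁ C₃ τ) ^ 2 / (b₁ C₁ C₃ τ - wp τ (omega C₁ C₃ τ)) := by
  rw [b₁_sub_wp]
  field_simp

/-- The form is made for comparison with `hasDerivAt_wp_curve`: if `℘(δ) = b₁`, the cubic is
`℘'(δ)²`, the last bracket is `℘''(δ)`, and their combination stands where `2k℘'(δ)` stands there.
-/
lemma hasDerivAt_b₁Fun (hω : omega C₁ C₃ τ ∉ (periods τ).lattice) (hK : kappa C₁ C₃ τ ≠ 0)
    (hP : wp' τ (omega C₁ C₃ τ) ≠ 0) :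
    HasDerivAt (b₁Fun C₁ C₃) ((4 * b₁ C₁ C₃ τ ^ 2 - 8 * b₁ C₁ C₃ τ * eta₁ τ -
      2 * (periods τ).g₂ / 3 + ((4 * b₁ C₁ C₃ τ ^ 3 - (periods τ).g₂ * b₁ C₁ C₃ τ -
        (periods τ).g₃) / (b₁ C₁ C₃ τ - wp τ (omega C₁ C₃ τ)) -
        (6 * b₁ C₁ C₃ τ ^ 2 - (periods τ).g₂ / 2))) / (4 * Real.pi * I)) τ := by
  have h1 := hasDerivAt_wp_omega hω
  have h2 := hasDerivAt_wp'_curve (hasDerivAt_omegaFun (C₁ := C₁) (C₃ := C₃) τ) hω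
  have h3 := hasDerivAt_kappaFun hω
  rw [omegaFun_coe, curveKappa_omega] at h2
  have h4 := h1.fun_add (h2.fun_div (h3.const_mul 2)
    (by rw [kappaFun_coe]; exact mul_ne_zero two_ne_zero hK))
  refine h4.congr_deriv ?_
  rw [b₁_sub_wp, kappaFun_coe, omegaFun_coe, wpPair'_coe τ hω, b₁]
  have hc := four_pi_I_ne_zero
  generalize (4 * Real.pi * I : ℂ) = c at *
  field_simp
  linear_combination 24 * kappa C₁ C₃ τ ^ 3 * wp'_sq τ hω

/-- If `℘'(ω)` were zero, `b₁` would reduce to `℘(ω)`, which would be one of the `eᵢ`. -/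
lemma wp'_omega_ne_zero (hτ : τ ∈ domain C₁ C₃) : wp' τ (omega C₁ C₃ τ) ≠ 0 := by
  intro h
  obtain ⟨i, hi⟩ := exists_wp_eq_e τ hτ.1 h
  refine hτ.2.2 i ?_
  rw [b₁, h, zero_div, add_zero, hi]

lemma continuousAt_ePair (τ : ℍ) (i : Fin 3) : ContinuousAt (ePair i) τ :=
  (hasDerivAt_ePair τ i).continuousAt

lemma eventually_mem_domain (hτ : τ ∈ domain C₁ C₃) :
    ∀ᶠ t in 𝓝 (τ : ℂ), t ∈ (fun τ : ℍ => (τ : ℂ)) '' domain C₁ C₃ := by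
  obtain ⟨hω, hK, hb⟩ := hτ
  have h1 := eventually_coe_mem τ (hasDerivAt_omegaFun (C₁ := C₁) (C₃ := C₃) τ).continuousAt hω
  have h2 : ∀ᶠ t in 𝓝 (τ : ℂ), kappaFun C₁ C₃ t ≠ 0 :=
    (contDiffAt_kappaFun hω 0).continuousAt.eventually_ne (by rwa [kappaFun_coe])
  have h3 : ∀ i, ∀ᶠ t in 𝓝 (τ : ℂ), b₁Fun C₁ C₃ t ≠ ePair i t := fun i =>
    ((contDiffAt_b₁Fun hω hK 0).continuousAt.ne_iff_eventually_ne (continuousAt_ePair τ i)).1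
      (by rw [b₁Fun_coe hω, ePair_coe]; exact hb i)
  filter_upwards [h1, h2, Filter.eventually_all.2 h3] with t ht1 ht2 ht3
  obtain ⟨τ', rfl, hω'⟩ := ht1
  refine ⟨τ', ⟨hω', by rwa [kappaFun_coe] at ht2, fun i => ?_⟩, rfl⟩
  have := ht3 i
  rwa [b₁Fun_coe hω', ePair_coe] at this

end Hitchin

/-! ### Local branches of `℘(δ) = b₁` -/

section Existence

/-- The implicit function theorem for functions of two complex variables. -/
lemma exists_implicit_function {f : ℂ × ℂ → ℂ} {u : ℂ × ℂ} (hf : ContDiffAt ℂ 1 f u)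
    (h : pderivSnd f u ≠ 0) :
    ∃ ψ : ℂ → ℂ, ContDiffAt ℂ 1 ψ u.1 ∧ ψ u.1 = u.2 ∧ (∀ᶠ t in 𝓝 u.1, f (t, ψ t) = f u) ∧
      ∀ᶠ v in 𝓝 u, f v = f u ↔ ψ v.1 = v.2 := by
  have hinv : (fderiv ℂ f u ∘L .inr ℂ ℂ ℂ).IsInvertible := by
    refine ⟨ContinuousLinearEquiv.unitsEquivAut ℂ (Units.mk0 _ h), ?_⟩
    ext
    simp [pderivSnd]
  exact ⟨hf.implicitFunction one_ne_zero hinv, hf.contDiffAt_implicitFunction one_ne_zero hinv,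
    hf.implicitFunction_apply_self one_ne_zero hinv,
    hf.eventually_apply_implicitFunction one_ne_zero hinv,
    hf.eventually_apply_eq_iff_implicitFunction one_ne_zero hinv⟩

variable {C₁ C₃ : ℂ} {τ : ℍ}

/-- Local solutions `ψ` of `℘(ψ) = b₁`. -/
lemma exists_local_branch (hτ : τ ∈ domain C₁ C₃) {z : ℂ} (hz : z ∉ (periods τ).lattice)
    (hb : wp τ z = b₁ C₁ C₃ τ) :
    ∃ ψ : ℂ → ℂ, ContDiffAt ℂ 1 ψ τ ∧ ψ τ = z ∧
      (∀ᶠ t in 𝓝 (τ : ℂ), wpPair (ψ t, t) = b₁Fun C₁ C₃ t) ∧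
      ∀ᶠ v in 𝓝 ((τ : ℂ), z), wpPair (v.2, v.1) = b₁Fun C₁ C₃ v.1 → ψ v.1 = v.2 := by
  obtain ⟨hω, hK, he⟩ := hτ
  set f : ℂ × ℂ → ℂ := fun v => wpPair (v.2, v.1) - b₁Fun C₁ C₃ v.1 with hf
  have hp := (mem_poleFreeSet_iff τ z).2 hz
  have hfu : f (τ, z) = 0 := by
    simp only [hf]
    rw [wpPair_coe τ hz, b₁Fun_coe hω, hb, sub_self]
  have h1 : ContDiffAt ℂ 1 f (τ, z) := by
    refine ContDiffAt.sub ?_ ?_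
    · exact ContDiffAt.comp (f := fun v : ℂ × ℂ => (v.2, v.1)) (τ, z)
        (contDiffAt_wpPair hp 1) (contDiffAt_snd.prodMk contDiffAt_fst)
    · exact ContDiffAt.comp (f := fun v : ℂ × ℂ => v.1) (τ, z)
        (contDiffAt_b₁Fun hω hK 1) contDiffAt_fst
  have h2 : pderivSnd f (τ, z) = wp' τ z := by
    have h3 := hasDerivAt_pderivSnd (h1.differentiableAt (by simp))
    have h4 := (hasDerivAt_pderivFst (differentiableAt_wpPair hp)).sub_const (b₁Fun C₁ C₃ τ)
    rw [h3.unique h4, pderivFst_wpPair τ hz]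
  -- The partial derivative in `z` is `℘'(z)`, non-zero because `b₁` avoids the `eᵢ`. The uniqueness
  -- part is kept: it later shows that a merely continuous branch equals `ψ`.
  obtain ⟨ψ, hψ, hψ0, hψ1, hψ2⟩ := exists_implicit_function h1
    (h2 ▸ wp'_ne_zero τ hz fun i => hb ▸ he i)
  refine ⟨ψ, hψ, hψ0, ?_, ?_⟩
  · filter_upwards [hψ1] with t ht
    rw [hfu] at ht
    exact sub_eq_zero.1 ht
  · filter_upwards [hψ2] with v hv hv'
    refine hv.1 ?_
    rw [hfu]
    exact sub_eq_zero.2 hv'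

theorem exists_branch (hτ : τ ∈ domain C₁ C₃) : ∃ (V : Set ℂ) (δ : ℂ → ℂ),
    IsOpen V ∧ (τ : ℂ) ∈ V ∧ ContinuousOn δ V ∧ IsBranchOn C₁ C₃ V δ := by
  obtain ⟨z, hz, hb⟩ := exists_wp_eq τ (b₁ C₁ C₃ τ)
  obtain ⟨ψ, hψ, hψ0, hψ1, -⟩ := exists_local_branch hτ hz hb
  have h1 : ∀ᶠ t in 𝓝 (τ : ℂ), (ψ t, t) ∈ poleFreeSet :=
    eventually_curve_mem hψ.continuousAt (by rw [hψ0]; exact (mem_poleFreeSet_iff τ z).2 hz)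
  have h2 := (hψ.eventually (by simp)).and (h1.and (hψ1.and (eventually_mem_domain hτ)))
  obtain ⟨V, hV, hVo, hτV⟩ := _root_.eventually_nhds_iff.1 h2
  refine ⟨V, ψ, hVo, hτV, fun t ht => (hV t ht).1.continuousAt.continuousWithinAt,
    fun t ht => (hV t ht).2.2.2, fun τ' hτ' => ?_⟩
  obtain ⟨-, h3, h4, τ'', h5, h6⟩ := hV _ hτ'
  obtain rfl : τ'' = τ' := UpperHalfPlane.ext h6
  have h7 := (mem_poleFreeSet_iff τ'' _).1 h3
  refine ⟨h7, ?_⟩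
  rw [← wpPair_coe τ'' h7, h4, b₁Fun_coe h5.1]

end Existence

/-! ### Density of the domain -/

section Density

variable {C₁ C₃ : ℂ}

lemma two_mul_mem_of_wp'_eq_zero (τ : ℍ) {z : ℂ} (hz : z ∉ (periods τ).lattice)
    (h : wp' τ z = 0) : 2 * z ∈ (periods τ).lattice := by
  obtain ⟨i, hi⟩ := exists_wp_eq_e τ hz h
  have h1 := weierstrassSigma_sub_mul_add (periods τ) hz (halfPeriod_notMem τ i)
  have h2 : (periods τ).weierstrassP z - (periods τ).weierstrassP (halfPeriod τ i) = 0 :=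
    sub_eq_zero.2 hi
  rw [h2, mul_zero, neg_zero] at h1
  have h3 := two_mul_halfPeriod_mem τ i
  rcases mul_eq_zero.1 h1 with h4 | h4
  · have h5 : z - halfPeriod τ i ∈ (periods τ).lattice := by
      by_contra hn
      exact weierstrassSigma_ne_zero _ hn h4
    have h6 := add_mem (add_mem h5 h5) h3
    ring_nf at h6 ⊢
    exact h6
  · have h5 : z + halfPeriod τ i ∈ (periods τ).lattice := by
      by_contra hn
      exact weierstrassSigma_ne_zero _ hn h4
    have h6 := sub_mem (add_mem h5 h5) h3
    ring_nf at h6 ⊢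
    exact h6

lemma notMem_of_two_mul_notMem {L : PeriodPair} {z : ℂ} (h : 2 * z ∉ L.lattice) :
    z ∉ L.lattice := fun hz => h (by rw [two_mul]; exact add_mem hz hz)

lemma exists_open_subset_ne {W : Set ℂ} {f g : ℂ → ℂ} (hW : IsOpen W) (hne : W.Nonempty)
    (hf : ∀ t ∈ W, ContinuousAt f t) (hg : ∀ t ∈ W, ContinuousAt g t)
    (h : ∀ t ∈ W, ¬ f =ᶠ[𝓝 t] g) :
    ∃ W' ⊆ W, IsOpen W' ∧ W'.Nonempty ∧ ∀ t ∈ W', f t ≠ g t := by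
  obtain ⟨t, ht⟩ := hne
  have h1 : ∃ s ∈ W, f s ≠ g s := by
    by_contra! hcon
    exact h t ht (Filter.eventually_of_mem (hW.mem_nhds ht) hcon)
  obtain ⟨s, hs, hfs⟩ := h1
  have h2 := ((hf s hs).ne_iff_eventually_ne (hg s hs)).1 hfs
  obtain ⟨V, hV, hVo, hsV⟩ := _root_.eventually_nhds_iff.1 (h2.and (hW.mem_nhds hs))
  exact ⟨V, fun t ht => (hV t ht).2, hVo, ⟨s, hsV⟩, fun t ht => (hV t ht).1⟩

/-- For fixed `k` the equation is affine in `t`: it has at most one solution unless it is an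
identity, which would make both constants integers. -/
lemma countable_two_omega_mem (hC : ¬ ∃ m n : ℤ, C₁ = m ∧ C₃ = n) :
    {t : ℂ | ∃ k, 2 * omegaFun C₁ C₃ t = latticePoint k t}.Countable := by
  rw [ofPred_exists]
  refine countable_iUnion fun k => Set.Subsingleton.countable ?_
  intro s hs t ht
  simp only [mem_ofPred_eq, omegaFun, latticePoint] at hs ht
  have h1 : (C₁ - k 0) * (s - t) = 0 := by linear_combination hs - ht
  rcases mul_eq_zero.1 h1 with h | h
  · refine absurd ⟨k 0, -k 1, by linear_combination h, ?_⟩ hC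
    push_cast
    linear_combination s * h - hs
  · exact sub_eq_zero.1 h

/-- The conditions are imposed successively, each time shrinking a non-empty open set. No identity
theorem is needed: a failure on an open set contradicts a derivative formula. -/
theorem dense_domain (hC : ¬ ∃ m n : ℤ, C₁ = m ∧ C₃ = n) : Dense (domain C₁ C₃) := by
  rw [dense_iff_inter_open]
  rintro U hU ⟨τ₀, hτ₀⟩
  set W₀ : Set ℂ := (fun τ : ℍ => (τ : ℂ)) '' U with hW₀
  have hW₀o : IsOpen W₀ := UpperHalfPlane.isOpenEmbedding_coe.isOpenMap U hU
  have hW₀n : W₀.Nonempty := ⟨τ₀, τ₀, hτ₀, rfl⟩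
  obtain ⟨t₁, ht₁, ht₁'⟩ := ((countable_two_omega_mem hC).dense_compl ℂ).inter_open_nonempty
    W₀ hW₀o hW₀n
  obtain ⟨τ₁, hτ₁, rfl⟩ := ht₁
  -- Keeping `2ω`, not only `ω`, off the lattice also ensures `℘'(ω) ≠ 0`.
  have h2ω : (2 * omegaFun C₁ C₃ τ₁, (τ₁ : ℂ)) ∈ poleFreeSet :=
    ⟨τ₁.im_pos, fun k hk => ht₁' ⟨k, hk⟩⟩
  obtain ⟨W₁, hW₁, hW₁o, hτW₁⟩ := _root_.eventually_nhds_iff.1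
    ((eventually_curve_mem ((hasDerivAt_omegaFun (C₁ := C₁) (C₃ := C₃) τ₁).const_mul 2).continuousAt
      h2ω).and (hW₀o.mem_nhds ⟨τ₁, hτ₁, rfl⟩))
  have good : ∀ t ∈ W₁, ∃ τ ∈ U, (τ : ℂ) = t ∧ omega C₁ C₃ τ ∉ (periods τ).lattice ∧
      wp' τ (omega C₁ C₃ τ) ≠ 0 := by
    intro t ht
    obtain ⟨h1, τ, hτ, rfl⟩ := hW₁ t ht
    have h2 : 2 * omega C₁ C₃ τ ∉ (periods τ).lattice := (mem_poleFreeSet_iff τ _).1 h1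
    have h3 := notMem_of_two_mul_notMem h2
    exact ⟨τ, hτ, rfl, h3, fun h => h2 (two_mul_mem_of_wp'_eq_zero τ h3 h)⟩
  -- Where `ζ(ω) - η` vanishes, `4πi` times its derivative is `-℘'(ω) ≠ 0`.
  obtain ⟨W₂, hW₂, hW₂o, hW₂n, hK⟩ := exists_open_subset_ne (f := kappaFun C₁ C₃) (g := fun _ => 0)
    hW₁o ⟨_, hτW₁⟩ (fun t ht => by
      obtain ⟨τ, -, rfl, hω, -⟩ := good t ht
      exact (contDiffAt_kappaFun hω 0).continuousAt) (fun t _ => continuousAt_const) (fun t ht h => by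
      obtain ⟨τ, -, rfl, hω, hP⟩ := good t ht
      have h1 := (hasDerivAt_kappaFun hω).unique ((hasDerivAt_const (τ : ℂ) (0 : ℂ)).congr_of_eventuallyEq h)
      have h2 := h.self_of_nhds
      rw [kappaFun_coe] at h2
      rw [h2, div_eq_zero_iff, or_iff_left four_pi_I_ne_zero] at h1
      exact hP (by linear_combination -h1))
  -- If `b₁ = eᵢ` locally, the cubic drops out, and comparing derivatives leaves `6eᵢ² - g₂/2 = 0`;
  -- but this is twice the non-zero `halfShift`.
  have step : ∀ i : Fin 3, ∀ W : Set ℂ, W ⊆ W₂ → IsOpen W → W.Nonempty →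
      ∃ W' ⊆ W, IsOpen W' ∧ W'.Nonempty ∧ ∀ t ∈ W', b₁Fun C₁ C₃ t ≠ ePair i t := by
    intro i W hWs hWo hWn
    refine exists_open_subset_ne hWo hWn (fun t ht => ?_) (fun t ht => ?_) (fun t ht h => ?_)
    · obtain ⟨τ, -, rfl, hω, -⟩ := good t (hW₂ (hWs ht))
      have h0 := hK _ (hWs ht)
      rw [kappaFun_coe] at h0
      exact (contDiffAt_b₁Fun hω h0 0).continuousAt
    · obtain ⟨τ, -, rfl, -, -⟩ := good t (hW₂ (hWs ht))
      exact continuousAt_ePair τ i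
    · obtain ⟨τ, -, rfl, hω, hP⟩ := good t (hW₂ (hWs ht))
      have h0 := hK _ (hWs ht)
      rw [kappaFun_coe] at h0
      have h1 := (hasDerivAt_b₁Fun hω h0 hP).unique ((hasDerivAt_ePair τ i).congr_of_eventuallyEq h)
      have h2 := h.self_of_nhds
      rw [b₁Fun_coe hω, ePair_coe] at h2
      rw [h2, cubic_e, zero_div, div_left_inj' four_pi_I_ne_zero] at h1
      refine halfShift_ne_zero _ (halfPeriod_notMem τ i) ?_
      rw [halfShift_eq]
      linear_combination -h1 / 2
  obtain ⟨W₃, hW₃, hW₃o, hW₃n, he0⟩ := step 0 W₂ subset_rfl hW₂o hW₂n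
  obtain ⟨W₄, hW₄, hW₄o, hW₄n, he1⟩ := step 1 W₃ hW₃ hW₃o hW₃n
  obtain ⟨W₅, hW₅, hW₅o, ⟨t, ht⟩, he2⟩ := step 2 W₄ (hW₄.trans hW₃) hW₄o hW₄n
  have ht₂ := hW₃ (hW₄ (hW₅ ht))
  obtain ⟨τ, hτ, rfl, hω, -⟩ := good t (hW₂ ht₂)
  have h0 := hK _ ht₂
  rw [kappaFun_coe] at h0
  refine ⟨τ, hτ, hω, h0, fun i => ?_⟩
  have e0 := he0 _ (hW₄ (hW₅ ht))
  have e1 := he1 _ (hW₅ ht)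
  have e2 := he2 _ ht
  rw [b₁Fun_coe hω, ePair_coe] at e0 e1 e2
  fin_cases i
  exacts [e0, e1, e2]

end Density

/-! ### The Painlevé equation -/

section Painleve

variable {C₁ C₃ : ℂ} {τ : ℍ} {δ : ℂ → ℂ} {d : ℂ}

variable (C₁ C₃) in
/-- `b₁ - ℘(ω)` as a function of `τ`. -/
def gapFun (t : ℂ) : ℂ := b₁Fun C₁ C₃ t - wpPair (omegaFun C₁ C₃ t, t)

lemma gapFun_coe (hω : omega C₁ C₃ τ ∉ (periods τ).lattice) :
    gapFun C₁ C₃ τ = b₁ C₁ C₃ τ - wp τ (omega C₁ C₃ τ) := by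
  rw [gapFun, b₁Fun_coe hω, omegaFun_coe, wpPair_coe τ hω]

lemma b₁_sub_wp_ne_zero (hτ : τ ∈ domain C₁ C₃) :
    b₁ C₁ C₃ τ - wp τ (omega C₁ C₃ τ) ≠ 0 := by
  rw [b₁_sub_wp]
  exact div_ne_zero (wp'_omega_ne_zero hτ) (mul_ne_zero two_ne_zero hτ.2.1)

lemma hasDerivAt_gapFun (hτ : τ ∈ domain C₁ C₃) :
    HasDerivAt (gapFun C₁ C₃) ((-4 * (b₁ C₁ C₃ τ + 2 * eta₁ τ) *
      (b₁ C₁ C₃ τ - wp τ (omega C₁ C₃ τ)) + (6 * b₁ C₁ C₃ τ ^ 2 - (periods τ).g₂ / 2)) /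
        (4 * Real.pi * I)) τ := by
  have hP := wp'_omega_ne_zero hτ
  have hu := b₁_sub_wp_ne_zero hτ
  refine ((hasDerivAt_b₁Fun hτ.1 hτ.2.1 hP).fun_sub (hasDerivAt_wp_omega hτ.1)).congr_deriv ?_
  rw [two_kappa_mul_wp' hτ.2.1 hP, wp'_sq τ hτ.1, ← sub_div]
  congr 1
  field_simp
  ring

/-- Both formulas for the derivative of `℘(δ) = b₁` agree exactly when `2kw = w²/u - D`, with `w =
℘'(δ)`, `D = ℘''(δ)`, `u = b₁ - ℘(ω)`. -/
lemma curveKappa_eq (hτ : τ ∈ domain C₁ C₃) (hδ : HasDerivAt δ d τ)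
    (hz : δ τ ∉ (periods τ).lattice) (hw : wp' τ (δ τ) ≠ 0)
    (hb : ∀ᶠ t in 𝓝 (τ : ℂ), wpPair (δ t, t) = b₁Fun C₁ C₃ t) :
    curveKappa τ (δ τ) d = wp' τ (δ τ) / (2 * (b₁ C₁ C₃ τ - wp τ (omega C₁ C₃ τ))) -
      (6 * b₁ C₁ C₃ τ ^ 2 - (periods τ).g₂ / 2) / (2 * wp' τ (δ τ)) := by
  have hu := b₁_sub_wp_ne_zero hτ
  have h0 := hb.self_of_nhds
  rw [wpPair_coe τ hz, b₁Fun_coe hτ.1] at h0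
  have h1 := (hasDerivAt_wp_curve hδ hz).unique
    ((hasDerivAt_b₁Fun hτ.1 hτ.2.1 (wp'_omega_ne_zero hτ)).congr_of_eventuallyEq hb)
  rw [div_left_inj' four_pi_I_ne_zero, h0] at h1
  have h2 := wp'_sq τ hz
  rw [h0] at h2
  rw [← h2] at h1
  field_simp at h1 ⊢
  linear_combination h1 / 3

variable (C₁ C₃ δ) in
/-- `k = ζ(δ) - 2 η₁ δ + 2 π i δ'` as a function of `τ`. -/
def slopeFun (t : ℂ) : ℂ := wpPair' (δ t, t) / (2 * gapFun C₁ C₃ t) -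
  (6 * b₁Fun C₁ C₃ t ^ 2 - g₂Fun t / 2) / (2 * wpPair' (δ t, t))

lemma hasDerivAt_slopeFun (hτ : τ ∈ domain C₁ C₃) (hδ : HasDerivAt δ d τ)
    (hz : δ τ ∉ (periods τ).lattice) (hw : wp' τ (δ τ) ≠ 0)
    (hb : ∀ᶠ t in 𝓝 (τ : ℂ), wpPair (δ t, t) = b₁Fun C₁ C₃ t) :
    HasDerivAt (slopeFun C₁ C₃ δ) (((6 * b₁ C₁ C₃ τ ^ 2 - (periods τ).g₂ / 2) *
      (12 * b₁ C₁ C₃ τ * wp' τ (δ τ) ^ 2 - (6 * b₁ C₁ C₃ τ ^ 2 - (periods τ).g₂ / 2) ^ 2) /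
        (2 * wp' τ (δ τ) ^ 3) - 3 * wp' τ (δ τ) -
        2 * curveKappa τ (δ τ) d * (b₁ C₁ C₃ τ + 2 * eta₁ τ)) / (4 * Real.pi * I)) τ := by
  have hu := b₁_sub_wp_ne_zero hτ
  have h0 := hb.self_of_nhds
  rw [wpPair_coe τ hz, b₁Fun_coe hτ.1] at h0
  have hk := curveKappa_eq hτ hδ hz hw hb
  have h1 := hasDerivAt_wp'_curve hδ hz
  have h2 := hasDerivAt_gapFun hτ
  have h3 := hasDerivAt_b₁Fun hτ.1 hτ.2.1 (wp'_omega_ne_zero hτ)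
  have h4 := hasDerivAt_g₂Fun τ
  have hsq := wp'_sq τ hz
  rw [hk, h0] at h1
  rw [h0] at hsq
  rw [← hsq] at h3
  -- The cubic relation at `δ` removes `g₃`, and below `g₂` is traded for `D = ℘''(δ)`. The claim
  -- becomes a rational identity in independent `b, w, u, η, D, c`.
  have hg₃ : (periods τ).g₃ = 4 * b₁ C₁ C₃ τ ^ 3 - (periods τ).g₂ * b₁ C₁ C₃ τ -
    wp' τ (δ τ) ^ 2 := by linear_combination hsq
  rw [hg₃] at h4
  have hv1 : wpPair' (δ τ, τ) ≠ 0 := by rwa [wpPair'_coe τ hz]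
  have hv2 : gapFun C₁ C₃ τ ≠ 0 := by rwa [gapFun_coe hτ.1]
  have h5 := (h1.fun_div (h2.const_mul 2) (mul_ne_zero two_ne_zero hv2)).fun_sub
    ((((h3.fun_pow 2).const_mul 6).fun_sub (h4.div_const 2)).fun_div (h1.const_mul 2)
      (mul_ne_zero two_ne_zero hv1))
  refine h5.congr_deriv ?_
  rw [hk, wpPair'_coe τ hz, gapFun_coe hτ.1, b₁Fun_coe hτ.1, g₂Fun_coe]
  have hc := four_pi_I_ne_zero
  clear h1 h2 h3 h4 h5 hk hg₃ hsq h0 hv1 hv2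
  generalize (4 * Real.pi * I : ℂ) = c at *
  generalize b₁ C₁ C₃ τ - wp τ (omega C₁ C₃ τ) = u at *
  generalize wp' τ (δ τ) = w at *
  generalize b₁ C₁ C₃ τ = b at *
  generalize eta₁ τ = η at *
  generalize hD : 6 * b ^ 2 - (periods τ).g₂ / 2 = D at *
  obtain hg : (periods τ).g₂ = 12 * b ^ 2 - 2 * D := by linear_combination -2 * hD
  rw [hg]
  simp only [Nat.cast_ofNat, Nat.reduceSub, pow_one]
  field_simp
  ring

/-- Both sides are `2℘'(2z)` when `b = ℘(z)`, `w = ℘'(z)`: the left by differentiating `℘(2z) =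
℘''²/(4℘'²) - 2℘`, the right because the four translates of `℘'` add up to `8℘'(2z)`. The proof
verifies the identity directly by partial fractions in the `eᵢ`. -/
lemma sum_wp'_half_shift {b w : ℂ} (hb : ∀ i, b ≠ e τ i) (hw : w ≠ 0)
    (hwb : w ^ 2 = 4 * b ^ 3 - (periods τ).g₂ * b - (periods τ).g₃) :
    (6 * b ^ 2 - (periods τ).g₂ / 2) *
      (12 * b * w ^ 2 - (6 * b ^ 2 - (periods τ).g₂ / 2) ^ 2) / (2 * w ^ 3) - 2 * w =
    1 / 4 * (w + -(3 * e τ 0 ^ 2 - (periods τ).g₂ / 4) * w / (b - e τ 0) ^ 2 +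
      -(3 * e τ 1 ^ 2 - (periods τ).g₂ / 4) * w / (b - e τ 1) ^ 2 +
      -(3 * e τ 2 ^ 2 - (periods τ).g₂ / 4) * w / (b - e τ 2) ^ 2) := by
  have h0 := sub_ne_zero.2 (hb 0)
  have h1 := sub_ne_zero.2 (hb 1)
  have h2 := sub_ne_zero.2 (hb 2)
  rw [cubic_eq] at hwb
  have he : e τ 2 = -e τ 0 - e τ 1 := by linear_combination sum_e τ
  have hS : 16 * ((3 * e τ 0 ^ 2 - (periods τ).g₂ / 4) * ((b - e τ 1) * (b - e τ 2)) ^ 2 +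
      (3 * e τ 1 ^ 2 - (periods τ).g₂ / 4) * ((b - e τ 0) * (b - e τ 2)) ^ 2 +
      (3 * e τ 2 ^ 2 - (periods τ).g₂ / 4) * ((b - e τ 0) * (b - e τ 1)) ^ 2) =
      9 * w ^ 4 - 24 * b * w ^ 2 * (6 * b ^ 2 - (periods τ).g₂ / 2) +
        2 * (6 * b ^ 2 - (periods τ).g₂ / 2) ^ 3 := by
    rw [show w ^ 4 = (w ^ 2) ^ 2 by ring, hwb, g₂_eq, he]
    ring
  have hR : (3 * e τ 0 ^ 2 - (periods τ).g₂ / 4) / (b - e τ 0) ^ 2 +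
      (3 * e τ 1 ^ 2 - (periods τ).g₂ / 4) / (b - e τ 1) ^ 2 +
      (3 * e τ 2 ^ 2 - (periods τ).g₂ / 4) / (b - e τ 2) ^ 2 =
      (9 * w ^ 4 - 24 * b * w ^ 2 * (6 * b ^ 2 - (periods τ).g₂ / 2) +
        2 * (6 * b ^ 2 - (periods τ).g₂ / 2) ^ 3) / w ^ 4 := by
    rw [← hS, show w ^ 4 = (w ^ 2) ^ 2 by ring, hwb]
    generalize (3 * e τ 0 ^ 2 - (periods τ).g₂ / 4) = H0
    generalize (3 * e τ 1 ^ 2 - (periods τ).g₂ / 4) = H1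
    generalize (3 * e τ 2 ^ 2 - (periods τ).g₂ / 4) = H2
    generalize b - e τ 0 = x0 at *
    generalize b - e τ 1 = x1 at *
    generalize b - e τ 2 = x2 at *
    field_simp
    ring
  have hR' := congrArg (fun x => 1 / 4 * (w * (1 - x))) hR
  beta_reduce at hR'
  trans 1 / 4 * (w * (1 - (9 * w ^ 4 - 24 * b * w ^ 2 * (6 * b ^ 2 - (periods τ).g₂ / 2) +
        2 * (6 * b ^ 2 - (periods τ).g₂ / 2) ^ 3) / w ^ 4))
  · generalize 6 * b ^ 2 - (periods τ).g₂ / 2 = D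
    field_simp
    ring
  · rw [← hR']
    ring

theorem isSolutionOn_of_isBranchOn {V : Set ℂ} (hV : IsOpen V) (hδ : ContinuousOn δ V)
    (h : IsBranchOn C₁ C₃ V δ) : IsSolutionOn (1 / 2) (1 / 2) (1 / 2) (1 / 2) V δ := by
  have dom : ∀ t ∈ V, ∃ τ ∈ domain C₁ C₃, (τ : ℂ) = t := fun t ht => h.1 ht
  have dom' : ∀ τ : ℍ, (τ : ℂ) ∈ V → τ ∈ domain C₁ C₃ := by
    intro τ hτ
    obtain ⟨τ', h1, h2⟩ := h.1 hτ
    rwa [← UpperHalfPlane.ext h2]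
  have hbr : ∀ t ∈ V, wpPair (δ t, t) = b₁Fun C₁ C₃ t := by
    intro t ht
    obtain ⟨τ, hτ, rfl⟩ := dom t ht
    obtain ⟨h1, h2⟩ := h.2 τ ht
    rw [wpPair_coe τ h1, h2, b₁Fun_coe hτ.1]
  have hev : ∀ t ∈ V, ∀ᶠ s in 𝓝 t, wpPair (δ s, s) = b₁Fun C₁ C₃ s := fun t ht =>
    Filter.eventually_of_mem (hV.mem_nhds ht) hbr
  have hw : ∀ τ : ℍ, (τ : ℂ) ∈ V → wp' τ (δ τ) ≠ 0 := fun τ hτ =>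
    wp'_ne_zero τ (h.2 τ hτ).1 fun i => (h.2 τ hτ).2 ▸ (dom' τ hτ).2.2 i
  have hdiff : ∀ t ∈ V, DifferentiableAt ℂ δ t := by
    intro t ht
    obtain ⟨τ, hτ, rfl⟩ := dom t ht
    obtain ⟨h1, h2⟩ := h.2 τ ht
    obtain ⟨ψ, hψ, -, -, hψ2⟩ := exists_local_branch hτ h1 h2
    have hc : ContinuousAt δ τ := hδ.continuousAt (hV.mem_nhds ht)
    -- Continuity keeps `(s, δ s)` in the uniqueness neighbourhood of the implicit function, so `δ`
    -- coincides with `ψ` near `τ`.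
    have h3 := (continuousAt_id.prodMk hc).eventually hψ2
    refine (hψ.differentiableAt (by simp)).congr_of_eventuallyEq ?_
    filter_upwards [h3, hev _ ht] with s hs hs'
    exact (hs hs').symm
  have hslope : ∀ t ∈ V, deriv δ t = (slopeFun C₁ C₃ δ t -
      (zetaPair (δ t, t) - 2 * zetaPair (1 / 2, t) * δ t)) / (2 * Real.pi * I) := by
    intro t ht
    obtain ⟨τ, hτ, rfl⟩ := dom t ht
    obtain ⟨h1, h2⟩ := h.2 τ ht
    have h3 := curveKappa_eq hτ (hdiff _ ht).hasDerivAt h1 (hw τ ht) (hev _ ht)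
    rw [slopeFun, gapFun_coe hτ.1, wpPair'_coe τ h1, b₁Fun_coe hτ.1, g₂Fun_coe, ← h3, curveKappa,
      zetaPair_coe, zetaPair_coe, eta₁]
    have hpi : (Real.pi : ℂ) ≠ 0 := ofReal_ne_zero.2 Real.pi_ne_zero
    field_simp
    ring
  refine ⟨fun t ht => (hdiff t ht).differentiableWithinAt, fun τ hτ => ⟨fun hn =>
    hw τ hτ (derivWeierstrassP_half _ hn), ?_⟩⟩
  obtain ⟨h1, h2⟩ := h.2 τ hτ
  have hd := (hdiff _ hτ).hasDerivAt
  -- The terms `2k(b₁ + 2η₁)` of the two derivatives cancel in the difference.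
  have h3 := ((hasDerivAt_slopeFun (dom' τ hτ) hd h1 (hw τ hτ) (hev _ hτ)).fun_sub
    (hasDerivAt_zeta_curve hd h1)).div_const (2 * Real.pi * I)
  have hne : ∀ i, wp τ (δ τ) ≠ e τ i := fun i => h2 ▸ (dom' τ hτ).2.2 i
  rw [(h3.congr_of_eventuallyEq (Filter.eventually_of_mem (hV.mem_nhds hτ) hslope)).deriv, h2]
  have h4 := sum_wp'_half_shift (dom' τ hτ).2.2 (hw τ hτ) (h2 ▸ wp'_sq τ h1)
  have s0 := wp'_add_halfPeriod τ h1 0 (hne 0)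
  have s1 := wp'_add_halfPeriod τ h1 1 (hne 1)
  have s2 := wp'_add_halfPeriod τ h1 2 (hne 2)
  rw [h2] at s0 s1 s2
  rw [← s0, ← s1, ← s2] at h4
  -- The point `(τ + 1)/2` differs from the half period `ω₂` by the lattice point `1 + τ`.
  have s1' : wp' τ (δ τ + (τ + 1) / 2) = wp' τ (δ τ + halfPeriod τ 1) := by
    rw [show δ τ + ((τ : ℂ) + 1) / 2 = δ τ + halfPeriod τ 1 + (1 + τ) by
      simp only [halfPeriod, Matrix.cons_val_one, Matrix.cons_val_zero]; ring]
    exact derivWeierstrassP_add _ (add_mem (one_mem_periods τ) (coe_mem_periods τ))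
  rw [← s1', show halfPeriod τ 0 = 1 / 2 from rfl, show halfPeriod τ 2 = τ / 2 from rfl] at h4
  have hpi : (Real.pi : ℂ) ≠ 0 := ofReal_ne_zero.2 Real.pi_ne_zero
  rw [← sub_div, div_div, div_eq_iff (by simp [Real.pi_ne_zero])]
  have hI : -(1 / (4 * (Real.pi : ℂ) ^ 2)) * (4 * Real.pi * I * (2 * Real.pi * I)) = 2 := by
    field_simp
    linear_combination -I_sq
  linear_combination h4 - (wp' τ (δ τ) + wp' τ (δ τ + 1 / 2) + wp' τ (δ τ + (τ + 1) / 2) +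
    wp' τ (δ τ + τ / 2)) / 8 * hI

end Painleve

/-! ### The linear equation and its multipliers -/

section HermiteKrichever

/-- The Hermite–Krichever function `exp (κ x) Φ₀(x, α)`. -/
def hermiteKrichever (τ : ℍ) (κ α x : ℂ) : ℂ := exp (κ * x) * Phi₀ τ x α

variable (τ : ℍ) (κ : ℂ) {α x : ℂ}

lemma differentiableAt_hermiteKrichever (hx : x ∉ (periods τ).lattice) :
    DifferentiableAt ℂ (hermiteKrichever τ κ α) x := by
  have h1 := (hasDerivAt_weierstrassSigma (periods τ) hx).differentiableAt
  have h2 : DifferentiableAt ℂ (fun x => weierstrassSigma (periods τ) (x - α)) x :=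
    ((differentiable_weierstrassSigma (periods τ)) (x - α)).comp x (f := fun x => x - α)
      (differentiableAt_id.sub_const α)
  have h3 := h2.fun_div h1 (weierstrassSigma_ne_zero _ hx)
  unfold hermiteKrichever Phi₀
  fun_prop

lemma analyticOnNhd_hermiteKrichever :
    AnalyticOnNhd ℂ (hermiteKrichever τ κ α) ((periods τ).lattice : Set ℂ)ᶜ :=
  DifferentiableOn.analyticOnNhd (fun _ hx =>
    (differentiableAt_hermiteKrichever τ κ hx).differentiableWithinAt)
    (isOpen_compl_lattice (periods τ))

/-- The logarithmic derivative is `κ + ζ(x - α) - ζ(x) + ζ(α)`, which the addition theorem turns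
into a rational expression in `℘` and `℘'`. -/
lemma hasDerivAt_hermiteKrichever (hα : α ∉ (periods τ).lattice) (hx : x ∉ (periods τ).lattice)
    (hxα : wp τ x ≠ wp τ α) :
    HasDerivAt (hermiteKrichever τ κ α) (hermiteKrichever τ κ α x *
      (κ + (wp' τ x + wp' τ α) / (2 * (wp τ x - wp τ α)))) x := by
  have h0 := (notMem_of_weierstrassP_ne (periods τ) hx hα hxα).1
  have hs := weierstrassSigma_ne_zero _ hx
  have hζ := weierstrassZeta_sub (periods τ) hx hα hxα
  have h1 := ((hasDerivAt_weierstrassSigma (periods τ) h0).comp_sub_const x α).fun_div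
    (hasDerivAt_weierstrassSigma (periods τ) hx) hs
  have h2 := ((hasDerivAt_id x).const_mul κ).cexp.fun_mul (h1.fun_mul
    ((hasDerivAt_id x).const_mul (weierstrassZeta (periods τ) α)).cexp)
  refine h2.congr_deriv ?_
  rw [wp', wp', wp, wp, ← hζ, hermiteKrichever, Phi₀]
  simp only [id]
  field_simp

variable {κ} in
lemma hermiteKrichever_identity {X X' A A' b μ g₂ g₃ : ℂ} (hμ : μ ≠ 0) (hA : A = b - 1 / (2 * μ))
    (hκ : κ = -μ * A') (hX : X' ^ 2 = 4 * X ^ 3 - g₂ * X - g₃)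
    (hA' : A' ^ 2 = 4 * A ^ 3 - g₂ * A - g₃) (hXA : X ≠ A) (hXb : X ≠ b) :
    -((κ + (X' + A') / (2 * (X - A))) ^ 2 + ((6 * X ^ 2 - g₂ / 2) / (2 * (X - A)) -
      (X' + A') * X' / (2 * (X - A) ^ 2))) + X' / (X - b) * (κ + (X' + A') / (2 * (X - A))) -
      μ * (4 * b ^ 3 - g₂ * b - g₃) / (X - b) -
      (-(4 * b ^ 3 - g₂ * b - g₃) * μ ^ 2 + (6 * b ^ 2 - g₂ / 2) * μ) = 0 := by
  have h1 := sub_ne_zero.2 hXA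
  have h2 := sub_ne_zero.2 hXb
  obtain ⟨m, hm⟩ : ∃ m, m = b - A := ⟨_, rfl⟩
  have hμm : μ = 1 / (2 * m) := by
    rw [hm, hA]
    field_simp
    ring
  have hm0 : m ≠ 0 := by
    rintro rfl
    exact hμ (by rw [hμm, mul_zero, div_zero])
  obtain rfl : g₃ = 4 * A ^ 3 - g₂ * A - A' ^ 2 := by linear_combination hA'
  have hX' : X' ^ 2 - (4 * X ^ 3 - g₂ * X - (4 * A ^ 3 - g₂ * A - A' ^ 2)) = 0 := sub_eq_zero.2 hX
  clear hX hA hA' hXA hXb hμ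
  -- With `g₃` eliminated through the point `(A, A')`, the left side is an explicit multiple of the
  -- cubic relation for `(X, X')`. Here `m = b - A = 1/(2μ)`.
  trans (1 / (4 * (X - A) ^ 2) + 1 / (2 * (X - b) * (X - A))) *
    (X' ^ 2 - (4 * X ^ 3 - g₂ * X - (4 * A ^ 3 - g₂ * A - A' ^ 2)))
  · rw [hκ, hμm]
    obtain ⟨Y, hY⟩ : ∃ Y, Y = X - A := ⟨_, rfl⟩
    obtain ⟨W, hW⟩ : ∃ W, W = X - b := ⟨_, rfl⟩
    rw [← hY] at h1 ⊢
    rw [← hW] at h2 ⊢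
    field_simp
    obtain rfl : m = Y - W := by rw [hm, hY, hW]; ring
    obtain rfl : X = A + Y := by rw [hY]; ring
    obtain rfl : b = A + Y - W := by rw [hW]; ring
    ring
  · rw [hX', mul_zero]

theorem solvesLinear_hermiteKrichever {b μ : ℂ} (hα : α ∉ (periods τ).lattice) (hμ : μ ≠ 0)
    (hA : wp τ α = b - 1 / (2 * μ)) (hκ : κ = -μ * wp' τ α) :
    SolvesLinear τ b μ (hermiteKrichever τ κ α) := by
  have generic : ∀ x, x ∉ (periods τ).lattice → wp τ x ≠ b → wp τ x ≠ wp τ α →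
      -deriv (deriv (hermiteKrichever τ κ α)) x +
        wp' τ x / (wp τ x - b) * deriv (hermiteKrichever τ κ α) x
      - μ * (4 * b ^ 3 - (periods τ).g₂ * b - (periods τ).g₃) / (wp τ x - b) *
        hermiteKrichever τ κ α x - accessory τ b μ * hermiteKrichever τ κ α x = 0 := by
    intro x hx hxb hxα
    have hd := hasDerivAt_hermiteKrichever τ κ hα hx hxα
    have hev : deriv (hermiteKrichever τ κ α) =ᶠ[𝓝 x] fun y => hermiteKrichever τ κ α y *
        (κ + (wp' τ y + wp' τ α) / (2 * (wp τ y - wp τ α))) := by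
      filter_upwards [(isOpen_compl_lattice (periods τ)).mem_nhds hx,
        (hasDerivAt_wp τ hx).continuousAt.eventually_ne hxα] with y hy hy'
      exact (hasDerivAt_hermiteKrichever τ κ hα hy hy').deriv
    have hd2 := hd.fun_mul ((((hasDerivAt_wp' τ hx).add_const (wp' τ α)).fun_div
      (((hasDerivAt_wp τ hx).sub_const (wp τ α)).const_mul 2)
      (mul_ne_zero two_ne_zero (sub_ne_zero.2 hxα))).const_add κ)
    rw [(hd2.congr_of_eventuallyEq hev).deriv, hd.deriv, accessory]
    have h := hermiteKrichever_identity hμ hA hκ (wp'_sq τ hx) (wp'_sq τ hα) hxα hxb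
    have h1 := sub_ne_zero.2 hxα
    have h2 : ((6 * wp τ x ^ 2 - (periods τ).g₂ / 2) * (2 * (wp τ x - wp τ α)) -
        (wp' τ x + wp' τ α) * (2 * wp' τ x)) / (2 * (wp τ x - wp τ α)) ^ 2 =
        (6 * wp τ x ^ 2 - (periods τ).g₂ / 2) / (2 * (wp τ x - wp τ α)) -
      (wp' τ x + wp' τ α) * wp' τ x / (2 * (wp τ x - wp τ α) ^ 2) := by
      field_simp
    rw [h2]
    linear_combination hermiteKrichever τ κ α x * h
  intro x hx hxb
  -- The excluded points with `℘(x) = ℘(α)` are isolated and the left side of the equation is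
  -- continuous there, so it vanishes at them too.
  have hf := analyticOnNhd_hermiteKrichever τ κ (α := α) x hx
  have c0 := hf.continuousAt
  have c1 := hf.deriv.continuousAt
  have c2 := hf.deriv.deriv.continuousAt
  have c3 := (hasDerivAt_wp τ hx).continuousAt
  have c4 := (hasDerivAt_wp' τ hx).continuousAt
  have c5 : ContinuousAt (fun y => wp τ y - b) x := c3.sub continuousAt_const
  have hc := ((c2.neg.add ((c4.div c5 (sub_ne_zero.2 hxb)).mul c1)).sub
    (((continuousAt_const (y := μ * (4 * b ^ 3 - (periods τ).g₂ * b - (periods τ).g₃))).div c5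
      (sub_ne_zero.2 hxb)).mul c0)).sub ((continuousAt_const (y := accessory τ b μ)).mul c0)
  refine tendsto_nhds_unique (hc.tendsto.mono_left nhdsWithin_le_nhds)
    ((tendsto_const_nhds (f := 𝓝[≠] x)).congr' ?_)
  filter_upwards [eventually_wp_ne τ b hx, eventually_wp_ne τ (wp τ α) hx,
    nhdsWithin_le_nhds ((isOpen_compl_lattice (periods τ)).mem_nhds hx)] with y h1 h2 h3
  exact (generic y h3 h1 h2).symm

variable {C₁ C₃ : ℂ} {τ}

/-- With `α = -ω` the values `ζ(ω)` cancel. The exponents left are `2η₁ω - η` and `2η₃ω - ητ`, equal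
to `πi C₁` and `πi C₃` by Legendre's relation. -/
lemma hasMultipliers_hermiteKrichever :
    HasMultipliers τ C₁ C₃ (hermiteKrichever τ (kappa C₁ C₃ τ) (-omega C₁ C₃ τ)) := by
  intro x hx
  have hs := weierstrassSigma_ne_zero _ hx
  simp only [hermiteKrichever, Phi₀, weierstrassZeta_neg, sub_neg_eq_add, kappa]
  constructor
  · rw [add_right_comm x 1, weierstrassSigma_add_one, weierstrassSigma_add_one]
    have h1 : (Real.pi : ℂ) * I * C₁ = 2 * eta₁ τ * omega C₁ C₃ τ - eta C₁ C₃ τ := by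
      rw [eta_eq]; ring
    have h2 : exp (2 * eta₁ τ * (x + omega C₁ C₃ τ + 1 / 2)) =
        exp (2 * eta₁ τ * (x + 1 / 2)) * exp (2 * eta₁ τ * omega C₁ C₃ τ) := by
      rw [← exp_add]; ring_nf
    rw [h1, h2, mul_add_one, mul_add_one, exp_add, exp_add, exp_sub, exp_sub, exp_neg]
    field_simp
  · rw [add_right_comm x τ, weierstrassSigma_add_coe, weierstrassSigma_add_coe]
    have h1 : (Real.pi : ℂ) * I * C₃ = 2 * eta₃ τ * omega C₁ C₃ τ - eta C₁ C₃ τ * τ := by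
      rw [← legendre τ, eta, omega]; ring
    have h2 : exp (2 * eta₃ τ * (x + omega C₁ C₃ τ + τ / 2)) =
        exp (2 * eta₃ τ * (x + τ / 2)) * exp (2 * eta₃ τ * omega C₁ C₃ τ) := by
      rw [← exp_add]; ring_nf
    have h3 : exp ((weierstrassZeta (periods τ) (omega C₁ C₃ τ) - eta C₁ C₃ τ) * (x + τ)) *
        exp (-weierstrassZeta (periods τ) (omega C₁ C₃ τ) * (x + τ)) =
        exp ((weierstrassZeta (periods τ) (omega C₁ C₃ τ) - eta C₁ C₃ τ) * x) *
        exp (-weierstrassZeta (periods τ) (omega C₁ C₃ τ) * x) * exp (-(eta C₁ C₃ τ * τ)) := by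
      rw [← exp_add, ← exp_add, ← exp_add]; ring_nf
    rw [h1, h2, sub_eq_add_neg (2 * eta₃ τ * omega C₁ C₃ τ), exp_add (2 * eta₃ τ * omega C₁ C₃ τ)]
    have h4 := exp_ne_zero (2 * eta₃ τ * (x + τ / 2))
    generalize exp (2 * eta₃ τ * (x + τ / 2)) = E at *
    have h5 : -(E * exp (2 * eta₃ τ * omega C₁ C₃ τ)) *
        weierstrassSigma (periods τ) (x + omega C₁ C₃ τ) / (-E * weierstrassSigma (periods τ) x) =
        exp (2 * eta₃ τ * omega C₁ C₃ τ) * (weierstrassSigma (periods τ) (x + omega C₁ C₃ τ) /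
          weierstrassSigma (periods τ) x) := by
      field_simp
    rw [h5]
    linear_combination exp (2 * eta₃ τ * omega C₁ C₃ τ) * (weierstrassSigma (periods τ)
      (x + omega C₁ C₃ τ) / weierstrassSigma (periods τ) x) * h3

theorem exists_isHermiteKrichever (hτ : τ ∈ domain C₁ C₃) : ∃ μ : ℂ,
    IsHermiteKrichever τ (b₁ C₁ C₃ τ) μ (-omega C₁ C₃ τ) (kappa C₁ C₃ τ) := by
  have hP := wp'_omega_ne_zero hτ
  obtain ⟨hω, hK, -⟩ := hτ
  have hα : -omega C₁ C₃ τ ∉ (periods τ).lattice := neg_mem_iff.not.2 hω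
  have hA : wp τ (-omega C₁ C₃ τ) = wp τ (omega C₁ C₃ τ) := (periods τ).weierstrassP_neg _
  have hA' : wp' τ (-omega C₁ C₃ τ) = -wp' τ (omega C₁ C₃ τ) := (periods τ).derivWeierstrassP_neg _
  have hb := b₁_sub_wp (C₁ := C₁) (C₃ := C₃) (τ := τ)
  have hsq := wp'_sq τ hω
  rw [cubic_eq] at hsq
  set P := wp τ (omega C₁ C₃ τ)
  set P' := wp' τ (omega C₁ C₃ τ)
  set K := kappa C₁ C₃ τ
  -- The requirement `1/(2μ) = b₁ - ℘(ω) = ℘'(ω)/(2κ)` forces `μ = κ/℘'(ω)`.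
  have hμ : K / P' ≠ 0 := div_ne_zero hK hP
  have hAb : wp τ (-omega C₁ C₃ τ) = b₁ C₁ C₃ τ - 1 / (2 * (K / P')) := by
    rw [hA, eq_sub_iff_add_eq', ← eq_sub_iff_add_eq, hb]
    field_simp
  -- The square root is prescribed by `κ = s/(2μ)`. Each factor of `Q` becomes `2μ(eᵢ - ℘(ω))`, so
  -- their product is a multiple of `℘'(ω)²`.
  have hQ : (2 * (K / P') * K) ^ 2 = -Qval τ (b₁ C₁ C₃ τ) (K / P') := by
    have h1 : ∀ i, 2 * (K / P') * (e τ i - b₁ C₁ C₃ τ) + 1 = 2 * (K / P') * (e τ i - P) := by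
      intro i
      rw [eq_add_of_sub_eq hb]
      field_simp
      ring
    rw [Qval, Fin.prod_univ_three, h1, h1, h1]
    have h2 : (2 * (K / P') * K) ^ 2 = 4 * (K / P') ^ 4 * P' ^ 2 := by
      field_simp
      norm_num
    rw [h2, hsq]
    ring
  refine ⟨K / P', hμ, fun h0 => ?_, hα, ⟨2 * (K / P') * K, hQ, hAb, ?_, ?_⟩,
    solvesLinear_hermiteKrichever τ K hα hμ hAb ?_⟩
  · rw [h0, neg_zero] at hQ
    exact pow_ne_zero 2 (mul_ne_zero (mul_ne_zero two_ne_zero hμ) hK) hQ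
  · rw [hA']
    field_simp
  · field_simp
  · rw [hA']
    field_simp

end HermiteKrichever

end EllipticPVI

end

theorem mainTheorem5 (C₁ C₃ : ℂ) :
    -- every continuous `δ` on an open set with `℘(δ) = b₁` solves the equation
    (∀ (V : Set ℂ) (δ : ℂ → ℂ), IsOpen V → ContinuousOn δ V →
      EllipticPVI.IsBranchOn C₁ C₃ V δ →
      EllipticPVI.IsSolutionOn (1 / 2) (1 / 2) (1 / 2) (1 / 2) V δ) ∧
    -- such a `δ` exists near every point of the domain of `b₁`
    (∀ τ₀ ∈ EllipticPVI.domain C₁ C₃, ∃ (V : Set ℂ) (δ : ℂ → ℂ),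
      IsOpen V ∧ (τ₀ : ℂ) ∈ V ∧ ContinuousOn δ V ∧ EllipticPVI.IsBranchOn C₁ C₃ V δ) ∧
    -- this domain is dense unless both constants are integers
    ((¬ ∃ m n : ℤ, C₁ = m ∧ C₃ = n) → Dense (EllipticPVI.domain C₁ C₃)) ∧
    -- `b₁` comes from Hermite-Krichever data with monodromy independent of `τ`
    (∀ τ ∈ EllipticPVI.domain C₁ C₃, ∃ μ : ℂ,
      EllipticPVI.IsHermiteKrichever τ (EllipticPVI.b₁ C₁ C₃ τ) μ
        (-EllipticPVI.omega C₁ C₃ τ) (EllipticPVI.kappa C₁ C₃ τ) ∧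
      EllipticPVI.HasMultipliers τ C₁ C₃
        (fun x => Complex.exp (EllipticPVI.kappa C₁ C₃ τ * x) *
          EllipticPVI.Phi₀ τ x (-EllipticPVI.omega C₁ C₃ τ))) := by
  exact ⟨fun V δ hV hδ h => EllipticPVI.isSolutionOn_of_isBranchOn hV hδ h,
    fun τ₀ h => EllipticPVI.exists_branch h, EllipticPVI.dense_domain, fun τ h =>
      (EllipticPVI.exists_isHermiteKrichever h).imp fun _ hμ =>
        ⟨hμ, EllipticPVI.hasMultipliers_hermiteKrichever⟩⟩
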